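/- A system $M=(S,s_0,A,\mathtt{step},\mathtt{obs},\mathtt{dom})$ consists of finite sets $S$ of states, $A$ of actions and $D$ of agents, an initial state $s_0\in S$, a transition function $\mathtt{step}\colon S\times A\to S$, observations $\mathtt{obs}_u(s)\in O$ (for $u\in D$, $s\in S$, with $O$ an arbitrary set), and a map $\mathtt{dom}\colon A\to D$. For $\alpha\in A^*$ let $s\cdot\alpha$ be the state reached from $s$ by performing $\alpha$. A global policy is a reflexive relation $\rightarrowtail$ on $D$. For $u\in D$ let $\mathtt{src}(\epsilon,u)=\{u\}$, and let $\mathtt{src}(a\alpha,u)=\mathtt{src}(\alpha,u)\cup\{\mathtt{dom}(a)\}$ if $\mathtt{dom}(a)\rightarrowtail v$ for some $v\in\mathtt{src}(\alpha,u)$, and $\mathtt{src}(a\alpha,u)=\mathtt{src}(\alpha,u)$ otherwise. Let $\mathtt{ipurge}(\epsilon,u)=\epsilon$, and let $\mathtt{ipurge}(a\alpha,u)=a\,\mathtt{ipurge}(\alpha,u)$ if $\mathtt{dom}(a)\in\mathtt{src}(a\alpha,u)$, and $\mathtt{ipurge}(a\alpha,u)=\mathtt{ipurge}(\alpha,u)$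 otherwise. $M$ is IP-secure with respect to $\rightarrowtail$ if for all $u\in D$, $s\in S$ and $\alpha,\beta\in A^*$ with $\mathtt{ipurge}(\alpha,u)=\mathtt{ipurge}(\beta,u)$ we have $\mathtt{obs}_u(s\cdot\alpha)=\mathtt{obs}_u(s\cdot\beta)$. 1. A system $M$ is IP-secure with respect to a global policy $\rightarrowtail$ if and only if there is a family of equivalence relations $\sim^{\tilde s,v}_u$ on $S$ ($\tilde s\in S$, $u,v\in D$) such that for all $\tilde s,s,t\in S$, $u,v\in D$ and $a\in A$: - (OC) if $s\sim^{\tilde s,v}_u t$, then $\mathtt{obs}_u(s)=\mathtt{obs}_u(t)$; - (SC) if $s\sim^{\tilde s,v}_u t$ and $v\not\rightarrowtail\mathtt{dom}(a)$, then $s\cdot a\sim^{\tilde s,v}_u t\cdot a$; - (LR) if $\mathtt{dom}(a)\not\rightarrowtail u$, then $\tilde s\sim^{\tilde s,\mathtt{dom}(a)}_u\tilde s\cdot a$. 2. IP-security can be verified in nondeterministic logarithmic space: the set of (explicitly encoded) pairs of a system and a global policy such that the system is IP-secure with respect to the policy belongs to the complexity class $\mathrm{NL}$. -/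

import Mathlib

/-! ### Systems, policies, IP-security and uniform intransitive unwindings -/

namespace Noninterference

/-- A state-observed system with states `S`, actions `A`, agents `D` and observations `O`.
(Finiteness of `S`, `A` and `D` is asked for where systems are used.) -/
structure System (S A D O : Type*) where
  /-- the initial state -/
  start : S
  /-- the transition function -/
  step : S → A → S
  /-- `obs s u` is the observation of agent `u` in state `s` -/
  obs : S → D → O
  /-- the agent to whom an action belongs -/
  dom : A → D

variable {S A D O : Type*}

namespace System

/-- `M.run s α` is the state `s · α` reached from `s` by performing the actions of `α`. -/
def run (M : System S A D O) (s : S) (α : List A) : S := α.foldl M.step s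

/-- `sources(α, u)` with respect to a global policy `pol` (`pol u v` means `u ↣ v`). -/
def sources (M : System S A D O) (pol : D → D → Prop) : List A → D → Set D
  | [], u => {u}
  | a :: α, u =>
    {v | v ∈ M.sources pol α u ∨ (v = M.dom a ∧ ∃ w ∈ M.sources pol α u, pol (M.dom a) w)}

open Classical in
/-- `ipurge(α, u)` with respect to a global policy `pol`: the actions which must not be
transmitted to `u` are removed. -/
noncomputable def ipurge (M : System S A D O) (pol : D → D → Prop) : List A → D → List A
  | [], _ => []
  | a :: α, u =>
    if M.dom a ∈ M.sources pol (a :: α) u then a :: M.ipurge pol α u else M.ipurge pol α u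

/-- IP-security of the runs that begin in the state `s`. -/
def IPSecureFrom (M : System S A D O) (pol : D → D → Prop) (s : S) : Prop :=
  ∀ (u : D) (α β : List A),
    M.ipurge pol α u = M.ipurge pol β u → M.obs (M.run s α) u = M.obs (M.run s β) u

/-- IP-security: for every agent and every state, runs with the same purged action sequence lead
to the same observation. If all states are reachable, it suffices to begin in the initial state,
see `ipSecure_iff_from_start`. -/
def IPSecure (M : System S A D O) (pol : D → D → Prop) : Prop :=
  ∀ s : S, M.IPSecureFrom pol s

/-- Output consistency of a family of equivalence relations; `R s₀ v u` is `∼ᵤ^{s₀,v}`. -/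
def OC (M : System S A D O) (R : S → D → D → Setoid S) : Prop :=
  ∀ (s₀ : S) (v u : D) (s t : S), R s₀ v u s t → M.obs s u = M.obs t u

/-- Step consistency, for a policy that assigns the local policy `pol s` to the state `s`. -/
def SC (M : System S A D O) (pol : S → D → D → Prop) (R : S → D → D → Setoid S) : Prop :=
  ∀ (s₀ : S) (v u : D) (s t : S) (a : A),
    R s₀ v u s t → ¬ pol s₀ v (M.dom a) → R s₀ v u (M.step s a) (M.step t a)

/-- Local respect, for a policy that assigns the local policy `pol s` to the state `s`. -/
def LR (M : System S A D O) (pol : S → D → D → Prop) (R : S → D → D → Setoid S) : Prop :=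
  ∀ (s₀ : S) (u : D) (a : A), ¬ pol s₀ (M.dom a) u → R s₀ (M.dom a) u s₀ (M.step s₀ a)

theorem sources_ipurge (M : System S A D O) (pol : D → D → Prop) (α : List A) (u : D) :
    M.sources pol (M.ipurge pol α u) u = M.sources pol α u := by
  induction α with
  | nil => rfl
  | cons a α ih =>
    unfold ipurge
    split_ifs with h
    · simp only [sources, ih]
    · rw [ih]
      ext v
      simp only [sources, Set.mem_ofPred_eq] at h ⊢
      constructor
      · exact Or.inl
      · rintro (hv | ⟨rfl, hw⟩)
        · exact hv
        · exact absurd (Or.inr ⟨trivial, hw⟩) h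

theorem ipurge_append_congr (M : System S A D O) (pol : D → D → Prop) (γ α β : List A) (u : D)
    (h : M.ipurge pol α u = M.ipurge pol β u) :
    M.sources pol (γ ++ α) u = M.sources pol (γ ++ β) u ∧
      M.ipurge pol (γ ++ α) u = M.ipurge pol (γ ++ β) u := by
  induction γ with
  | nil =>
    refine ⟨?_, h⟩
    rw [List.nil_append, List.nil_append, ← sources_ipurge, h, sources_ipurge]
  | cons a γ ih =>
    have hs : M.sources pol (a :: (γ ++ α)) u = M.sources pol (a :: (γ ++ β)) u := by
      simp only [sources, ih.1]
    refine ⟨hs, ?_⟩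
    rw [List.cons_append, List.cons_append, ipurge, ipurge, hs, ih.2]

/-- If every state is reachable, then IP-security is the same as its variant that only looks at
runs which begin in the initial state. -/
theorem ipSecure_iff_from_start (M : System S A D O) (pol : D → D → Prop)
    (hreach : ∀ s, ∃ γ, M.run M.start γ = s) :
    M.IPSecure pol ↔ M.IPSecureFrom pol M.start := by
  refine ⟨fun h => h _, fun h s u α β hαβ => ?_⟩
  obtain ⟨γ, rfl⟩ := hreach s
  have := h u (γ ++ α) (γ ++ β) (M.ipurge_append_congr pol γ α β u hαβ).2
  simpa only [run, List.foldl_append] using this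

end System

/-! ### Nondeterministic logarithmic space -/

/-- Head moves. -/
inductive Move
  | left
  | stay
  | right

/-- What the input head may scan: the left end marker, an input letter, the right end marker. -/
inductive Scan (Λ : Type)
  | leftEnd
  | letter (x : Λ)
  | rightEnd

/-- A nondeterministic Turing machine with input alphabet `Λ`: a finite control, a two-way
read-only input tape with end markers, and `k` read-write work tapes. -/
structure NTM (Λ : Type) where
  /-- the number of work tapes -/
  k : ℕ
  /-- the states of the finite control -/
  Q : Type
  /-- the work alphabet -/
  Γ : Type
  finiteQ : Finite Q
  finiteΓ : Finite Γ
  blank : Γ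
  start : Q
  accepting : Set Q
  /-- Given the control state, the scanned input symbol and the scanned work symbols: the possible
  triples of a next control state, a move of the input head, and for every work tape the symbol
  to write and the move of its head. -/
  trans : Q → Scan Λ → (Fin k → Γ) → Set (Q × Move × (Fin k → Γ × Move))

namespace NTM

variable {Λ : Type}

/-- The symbol at position `p` of the input tape, which holds the left end marker at `0`, the
letters of `w` at `1, …, |w|`, and the right end marker at `|w| + 1`. -/
def scan (w : List Λ) (p : ℕ) : Scan Λ :=
  if p = 0 then .leftEnd
  else match w[p - 1]? with
    | some x => .letter x
    | none => .rightEnd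

/-- A configuration. The work tapes are one-way infinite. -/
structure Cfg (M : NTM Λ) where
  state : M.Q
  inPos : ℕ
  tape : Fin M.k → ℕ → M.Γ
  head : Fin M.k → ℕ

/-- The initial configuration: blank work tapes, all heads at position `0`. -/
def initCfg (M : NTM Λ) : M.Cfg where
  state := M.start
  inPos := 0
  tape := fun _ _ => M.blank
  head := fun _ => 0

/-- The position of a head after a move; a move to the left at position `0` has no effect. -/
def moveHead : Move → ℕ → ℕ
  | .left, p => p - 1
  | .stay, p => p
  | .right, p => p + 1

/-- One computation step on input `w`. The input head does not go beyond the right end marker. -/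
def Step (M : NTM Λ) (w : List Λ) (c c' : M.Cfg) : Prop :=
  ∃ (q : M.Q) (d : Move) (act : Fin M.k → M.Γ × Move),
    (q, d, act) ∈ M.trans c.state (scan w c.inPos) (fun i => c.tape i (c.head i)) ∧
    c' = { state := q
           inPos := min (moveHead d c.inPos) (w.length + 1)
           tape := fun i => Function.update (c.tape i) (c.head i) (act i).1
           head := fun i => moveHead (act i).2 (c.head i) }

/-- `c` occurs in some computation on input `w`. -/
def Reaches (M : NTM Λ) (w : List Λ) (c : M.Cfg) : Prop :=
  Relation.ReflTransGen (M.Step w) M.initCfg c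

/-- Some computation on input `w` reaches an accepting control state. -/
def Accepts (M : NTM Λ) (w : List Λ) : Prop :=
  ∃ c : M.Cfg, M.Reaches w c ∧ c.state ∈ M.accepting

/-- On every computation, the work space is at most logarithmic in the length of the input. -/
def LogSpace (M : NTM Λ) : Prop :=
  ∃ C : ℕ, ∀ (w : List Λ) (c : M.Cfg), M.Reaches w c →
    ∀ i, c.head i ≤ C * (Nat.log 2 w.length + 1)

end NTM

/-- The complexity class NL, over a finite alphabet. -/
def InNL {Λ : Type} [Finite Λ] (L : Language Λ) : Prop :=
  ∃ M : NTM Λ, M.LogSpace ∧ ∀ w, w ∈ L ↔ M.Accepts w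

/-! ### IP-security as a decision problem -/

/-- The alphabet in which systems are written down. -/
inductive Letter
  | zero
  | one
  | sep
  deriving DecidableEq

instance : Finite Letter :=
  Finite.of_surjective (fun i : Fin 3 => ![Letter.zero, Letter.one, Letter.sep] i) fun x => by
    cases x
    exacts [⟨0, rfl⟩, ⟨1, rfl⟩, ⟨2, rfl⟩]

/-- A truth value as a letter. -/
def encodeBool (b : Bool) : Letter := if b then .one else .zero

/-- The `i`-th element of a finite set, or the size of a finite set, as a block of `i` ones. -/
def encodeNat (i : ℕ) : List Letter := List.replicate i .one ++ [.sep]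

/-- A bit string as a block. -/
def encodeBits (x : List Bool) : List Letter := x.map encodeBool ++ [.sep]

/-- The explicit description of a finite system with a global policy: the numbers of states,
actions and agents, the initial state, and the tables of `dom`, `step`, `obs` (whose values are
named by arbitrary bit strings) and of the policy. -/
def encode {n m d : ℕ} (M : System (Fin n) (Fin m) (Fin d) (List Bool))
    (pol : Fin d → Fin d → Bool) : List Letter :=
  encodeNat n ++ encodeNat m ++ encodeNat d ++ encodeNat M.start ++
  (List.finRange m).flatMap (fun a => encodeNat (M.dom a)) ++
  (List.finRange n).flatMap (fun s =>
    (List.finRange m).flatMap fun a => encodeNat (M.step s a)) ++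
  (List.finRange n).flatMap (fun s =>
    (List.finRange d).flatMap fun u => encodeBits (M.obs s u)) ++
  (List.finRange d).flatMap (fun u => encodeBits ((List.finRange d).map (pol u)))

/-- The problem of verifying IP-security: the set of the descriptions of finite systems with a
(reflexive) global policy that are IP-secure. -/
def ipSecurityProblem : Language Letter :=
  {w | ∃ (n m d : ℕ) (M : System (Fin n) (Fin m) (Fin d) (List Bool))
      (pol : Fin d → Fin d → Bool),
    (∀ u, pol u u = true) ∧ M.IPSecure (fun u v => pol u v = true) ∧ w = encode M pol}

end Noninterference

/-! ### Local security and unwindings -/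

namespace Noninterference
namespace System

variable {S A D O : Type*} (M : System S A D O) (pol : D → D → Prop)

/-! Both parts go through a one-action form of security, `LocallySecure`: an action `a` that may not
interfere with `u` can be deleted in front of any `γ` all of whose actions belong to agents with
which `dom a` may not interfere either. Purging a word is a succession of such deletions, made from
the right, so this form implies IP-security. Conversely, reflexivity of the policy guarantees that
`a` is dropped when `a :: γ` is purged. A family of unwinding relations expresses the same thing
step by step. The largest candidate relates two states when `u` cannot tell them apart after any `γ`
of the above kind.

For the complexity, local security fails exactly when some pair of states with different
observations for `u` is reachable from `(s, s · a)`, in the graph on pairs of states where both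
components perform the same action and `dom a` may not interfere with its agent. So security is a
non-reachability statement about graphs of polynomial size, and the point is the closure of NL under
complement, proved by inductive counting (Immerman and Szelepcsényi). If the number `c` of nodes
reachable in less than `j` steps is known, then `c` such nodes, none of which is `x` or has an edge
to `x`, certify that `x ≠ a` is not reachable from `a` in less than `j + 1` steps. Certifying every
node positively or negatively gives the next count, and once the count stabilises, everything
reachable has been found.

Logarithmic space is handled through regular programs with finitely many polynomially bounded
registers. Predicates that such programs check (`Checkable`) are closed under conjunction,
disjunction, existential quantification and transitive closure on tuples. `Checkable.not_reachable`
adds the complement of reachability on pairs. Hence the predicates checkable together with their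
negations (`Definable`) are closed under Boolean operations, bounded quantifiers and reachability on
pairs. Arithmetic, parsing into blocks, well-formedness and security of a description are all
expressed in this language.

Finally, `Checkable.inNL` turns programs into machines. The lists of programs still to be executed
form a finite control, and each register becomes a work tape with as many digits to the base 16 as
`|w| + 1` has binary digits. -/

theorem self_mem_sources (α : List A) (u : D) : u ∈ M.sources pol α u := by
  induction α with
  | nil => exact rfl
  | cons a α ih => exact Or.inl ih

theorem dom_mem_sources_of_mem_ipurge {α : List A} {u : D} {b : A}
    (hb : b ∈ M.ipurge pol α u) : M.dom b ∈ M.sources pol α u := by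
  induction α with
  | nil => simp [ipurge] at hb
  | cons a α ih =>
    unfold ipurge at hb
    split_ifs at hb with h
    · rcases List.mem_cons.1 hb with rfl | hb
      · exact h
      · exact Or.inl (ih hb)
    · exact Or.inl (ih hb)

theorem eq_or_exists_of_mem_sources {γ : List A} {u v : D} (hv : v ∈ M.sources pol γ u) :
    v = u ∨ ∃ b ∈ γ, v = M.dom b := by
  induction γ with
  | nil => exact Or.inl hv
  | cons a γ ih =>
    rcases hv with hv | ⟨rfl, -⟩
    · rcases ih hv with h | ⟨b, hb, h⟩
      · exact Or.inl h
      · exact Or.inr ⟨b, List.mem_cons_of_mem _ hb, h⟩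
    · exact Or.inr ⟨a, List.mem_cons_self, rfl⟩

/-- An action that may not interfere with `u`, followed only by actions of agents with which it
may not interfere, is invisible to `u`. -/
def LocallySecure : Prop :=
  ∀ (s : S) (a : A) (u : D), ¬ pol (M.dom a) u → ∀ γ : List A,
    (∀ b ∈ γ, ¬ pol (M.dom a) (M.dom b)) →
      M.obs (M.run s γ) u = M.obs (M.run (M.step s a) γ) u

variable {M pol}

/-- The sources of `γ` for `u` consist of `u` and agents of actions in `γ`. None of them may be
interfered with by `dom a`, and by reflexivity none of them is `dom a`. So `a` is purged from `a ::
γ`. -/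
theorem IPSecure.locallySecure (hrefl : ∀ u, pol u u) (h : M.IPSecure pol) :
    M.LocallySecure pol := by
  intro s a u hau γ hγ
  refine (h s u (a :: γ) γ ?_).symm
  rw [ipurge, if_neg]
  rintro (hmem | ⟨-, w, hw, haw⟩)
  · rcases M.eq_or_exists_of_mem_sources pol hmem with e | ⟨b, hb, e⟩
    · exact hau (e ▸ hrefl _)
    · exact hγ b hb (e ▸ hrefl _)
  · rcases M.eq_or_exists_of_mem_sources pol hw with rfl | ⟨b, hb, rfl⟩
    · exact hau haw
    · exact hγ b hb haw

/-- The tail is purged before `a` is considered. Every action that is left then belongs to a source,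
and an `a` that is purged may not interfere with any source, so local security applies to `a` in
front of the purged tail. -/
theorem LocallySecure.obs_run_ipurge (h : M.LocallySecure pol) (u : D) (α : List A) (s : S) :
    M.obs (M.run s α) u = M.obs (M.run s (M.ipurge pol α u)) u := by
  induction α generalizing s with
  | nil => rfl
  | cons a α ih =>
    unfold ipurge
    split_ifs with ha
    · exact ih (M.step s a)
    · have hno : ∀ w ∈ M.sources pol α u, ¬ pol (M.dom a) w := fun w hw hp =>
        ha (Or.inr ⟨rfl, w, hw, hp⟩)
      exact (ih (M.step s a)).trans (h s a u (hno u (M.self_mem_sources pol α u)) _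
        fun b hb => hno _ (M.dom_mem_sources_of_mem_ipurge pol hb)).symm

theorem LocallySecure.ipSecure (h : M.LocallySecure pol) : M.IPSecure pol := by
  intro s u α β hαβ
  rw [h.obs_run_ipurge, hαβ, ← h.obs_run_ipurge]

theorem ipSecure_iff_locallySecure (hrefl : ∀ u, pol u u) :
    M.IPSecure pol ↔ M.LocallySecure pol :=
  ⟨IPSecure.locallySecure hrefl, LocallySecure.ipSecure⟩

theorem locallySecure_iff_exists_unwinding :
    M.LocallySecure pol ↔
      ∃ R : S → D → D → Setoid S, M.OC R ∧ M.SC (fun _ => pol) R ∧ M.LR (fun _ => pol) R := by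
  constructor
  · intro h
    -- The coarsest possible relation: `u` observes the same after every word of actions with whose
    -- agents `v` may not interfere. It is the same for all base states.
    refine ⟨fun _ v u => ⟨fun s t => ∀ γ : List A, (∀ b ∈ γ, ¬ pol v (M.dom b)) →
      M.obs (M.run s γ) u = M.obs (M.run t γ) u, ⟨fun _ _ _ => rfl, fun h γ hγ => (h γ hγ).symm,
        fun h₁ h₂ γ hγ => (h₁ γ hγ).trans (h₂ γ hγ)⟩⟩, ?_, ?_, ?_⟩
    · intro _ v u s t hst
      exact hst [] (by simp)
    · intro _ v u s t a hst hva γ hγ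
      exact hst (a :: γ) (by simpa [hva] using hγ)
    · intro s u a hau γ hγ
      exact h s a u hau γ hγ
  · rintro ⟨R, hOC, hSC, hLR⟩ s a u hau γ hγ
    have key : ∀ (γ : List A) (x y : S), (∀ b ∈ γ, ¬ pol (M.dom a) (M.dom b)) →
        R s (M.dom a) u x y → R s (M.dom a) u (M.run x γ) (M.run y γ) := by
      intro γ
      induction γ with
      | nil => exact fun _ _ _ h => h
      | cons b γ ih =>
        intro x y hb hxy
        exact ih _ _ (fun c hc => hb c (List.mem_cons_of_mem _ hc))
          (hSC _ _ _ _ _ b hxy (hb b List.mem_cons_self))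
    exact hOC _ _ _ _ _ (key γ _ _ hγ (hLR s u a hau))

end System
end Noninterference

namespace Noninterference

open Relation

/-! ### Nondeterministic programs over bounded registers -/

/-- The number of values of a register on an input of length `n`. -/
def regBound (n : ℕ) : ℕ := 16 ^ Nat.size (n + 1)

/-- Registers must hold counts of pairs of numbers below `n + 2`, thus values up to `(n + 2) * (n +
2)`, and also the step number that follows such a value. The base 16 leaves room for this: the bound
is the fourth power of `2 ^ Nat.size (n + 1)`, which is at least `n + 2`. -/
theorem sq_add_two_lt_regBound (n : ℕ) : (n + 2) * (n + 2) + 2 ≤ regBound n := by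
  have h : n + 2 ≤ 2 ^ Nat.size (n + 1) := Nat.lt_size_self (n + 1)
  have h16 : regBound n = (2 ^ Nat.size (n + 1)) ^ 4 := by
    rw [regBound, ← pow_mul, mul_comm, pow_mul]; norm_num
  rw [h16]
  generalize 2 ^ Nat.size (n + 1) = x at h
  have h2 : 2 ≤ x := by omega
  have h3 : (n + 2) * (n + 2) ≤ x * x := Nat.mul_le_mul h h
  have h4 : 4 ≤ x * x := Nat.mul_le_mul h2 h2
  calc (n + 2) * (n + 2) + 2 ≤ x * x * 4 := by omega
    _ ≤ x * x * (x * x) := Nat.mul_le_mul_left _ h4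
    _ = x ^ 4 := by ring

theorem add_two_lt_regBound (n : ℕ) : n + 2 < regBound n := by
  have := sq_add_two_lt_regBound n
  nlinarith

/-- The operations on a register: increment, decrement, and the test for zero. Operations that are
not possible block. -/
inductive Mode
  | inc
  | dec
  | zero

/-- The effect of an operation on the value of a register. -/
def Mode.Rel : Mode → ℕ → ℕ → Prop
  | .inc, v, v' => v' = v + 1
  | .dec, v, v' => v = v' + 1
  | .zero, v, v' => v = 0 ∧ v' = v

/-- The instructions: register operations, and moves and tests of the input head. -/
inductive Instr (Λ : Type)
  | reg (m : Mode) (i : ℕ)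
  | left
  | right
  | look (c : Scan Λ)

/-- The registers and the position of the input head. -/
structure Store {Λ : Type} (w : List Λ) where
  reg : ℕ → Fin (regBound w.length)
  head : ℕ

/-- The values of the registers. -/
def Store.val {Λ : Type} {w : List Λ} (s : Store w) (i : ℕ) : ℕ := s.reg i

variable {Λ : Type}

theorem Store.val_lt {w : List Λ} (s : Store w) (i : ℕ) : s.val i < regBound w.length :=
  (s.reg i).2

theorem Store.ext_val {w : List Λ} {s t : Store w} (h : ∀ i, s.val i = t.val i)
    (hh : s.head = t.head) : s = t := by
  cases s; cases t
  simp only [Store.val] at h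
  simp only at hh
  subst hh
  congr
  funext i
  exact Fin.ext (h i)

/-- The effect of an instruction. -/
def Instr.sem (w : List Λ) : Instr Λ → Store w → Store w → Prop
  | .reg m i, s, s' => m.Rel (s.val i) (s'.val i) ∧
      (∀ j, j ≠ i → s'.val j = s.val j) ∧ s'.head = s.head
  | .left, s, s' => s.head = s'.head + 1 ∧ s'.reg = s.reg
  | .right, s, s' => s.head ≤ w.length ∧ s'.head = s.head + 1 ∧ s'.reg = s.reg
  | .look c, s, s' => NTM.scan w s.head = c ∧ s' = s

/-- Regular programs. -/
inductive Prog (Λ : Type)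
  | skip
  | atom (a : Instr Λ)
  | seq (p q : Prog Λ)
  | alt (p q : Prog Λ)
  | star (p : Prog Λ)

/-- The input-output relation of a program. -/
def Prog.sem (w : List Λ) : Prog Λ → Store w → Store w → Prop
  | .skip => fun s t => s = t
  | .atom a => a.sem w
  | .seq p q => fun s t => ∃ r, p.sem w s r ∧ q.sem w r t
  | .alt p q => fun s t => p.sem w s t ∨ q.sem w s t
  | .star p => ReflTransGen (p.sem w)

/-- The program `p` can be completed if and only if `P` holds, and it preserves the registers
below `K`. -/
structure Checks (p : Prog Λ) (K : ℕ) (P : List Λ → (ℕ → ℕ) → Prop) : Prop where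
  sound : ∀ w (s s' : Store w), p.sem w s s' → P w s.val
  frame : ∀ w (s s' : Store w), p.sem w s s' → ∀ i < K, s'.val i = s.val i
  complete : ∀ w (s : Store w), P w s.val → ∃ s', p.sem w s s'

/-- A predicate on the input and on numbers named by `V` is checkable if, wherever these numbers
are stored, there is a program for it. -/
def Checkable {V : Type} (P : List Λ → (V → ℕ) → Prop) : Prop :=
  ∀ (ι : V → ℕ) (K : ℕ), (∀ v, ι v < K) → ∃ p : Prog Λ, Checks p K fun w σ => P w fun v => σ (ι v)

/-! ### Basic programs -/

namespace Prog

variable {w : List Λ}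

theorem exists_reg (s : Store w) (m : Mode) (i : ℕ) {v : ℕ} (hv : v < regBound w.length)
    (h : m.Rel (s.val i) v) :
    ∃ s', (atom (.reg m i)).sem w s s' ∧ s'.val i = v := by
  classical
  have e : (⟨Function.update s.reg i ⟨v, hv⟩, s.head⟩ : Store w).val i = v := by
    simp [Store.val]
  refine ⟨⟨Function.update s.reg i ⟨v, hv⟩, s.head⟩, ⟨?_, ?_, rfl⟩, e⟩
  · rw [e]; exact h
  · intro j hj
    simp [Store.val, Function.update_of_ne hj]

/-- Guess the value of the register `i`. -/
def guess (i : ℕ) : Prog Λ := star (alt (atom (.reg .inc i)) (atom (.reg .dec i)))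

theorem guess_frame {i : ℕ} {s s' : Store w} (h : (guess i).sem w s s') :
    (∀ j, j ≠ i → s'.val j = s.val j) ∧ s'.head = s.head := by
  change ReflTransGen _ s s' at h
  induction h with
  | refl => exact ⟨fun _ _ => rfl, rfl⟩
  | tail _ h ih =>
    rcases h with ⟨-, h, h'⟩ | ⟨-, h, h'⟩
    · exact ⟨fun j hj => (h j hj).trans (ih.1 j hj), h'.trans ih.2⟩
    · exact ⟨fun j hj => (h j hj).trans (ih.1 j hj), h'.trans ih.2⟩

/-- The old value is unknown, so the register is counted down to zero and then up to `v`; no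
increment blocks below the bound. -/
theorem exists_guess (s : Store w) (i : ℕ) {v : ℕ} (hv : v < regBound w.length) :
    ∃ s', (guess i).sem w s s' ∧ s'.val i = v := by
  have down : ∃ s', (guess i).sem w s s' ∧ s'.val i = 0 := by
    generalize hn : s.val i = n
    induction n generalizing s with
    | zero => exact ⟨s, ReflTransGen.refl, hn⟩
    | succ n ih =>
      have := s.val_lt i
      obtain ⟨r, hr, hr'⟩ := exists_reg s .dec i (v := n) (by omega) hn
      obtain ⟨s', hs, hs'⟩ := ih r hr'
      exact ⟨s', ReflTransGen.head (Or.inr hr) hs, hs'⟩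
  induction v with
  | zero => exact down
  | succ v ih =>
    obtain ⟨r, hr, hr'⟩ := ih (by omega)
    obtain ⟨s', hs, hs'⟩ := exists_reg r .inc i hv (by rw [hr']; rfl)
    exact ⟨s', ReflTransGen.tail hr (Or.inl hs), hs'⟩

/-- Guess the values of the `n` registers from `K` on. -/
def guesses (K : ℕ) : ℕ → Prog Λ
  | 0 => skip
  | n + 1 => seq (guesses K n) (guess (K + n))

theorem guesses_frame {K n : ℕ} {s s' : Store w} (h : (guesses K n).sem w s s') :
    ∀ j, (j < K ∨ K + n ≤ j) → s'.val j = s.val j := by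
  induction n generalizing s' with
  | zero => cases h; exact fun _ _ => rfl
  | succ n ih =>
    obtain ⟨r, h₁, h₂⟩ := h
    intro j hj
    exact ((guess_frame h₂).1 j (by omega)).trans (ih h₁ j (by omega))

theorem exists_guesses (s : Store w) (K n : ℕ) (v : Fin n → ℕ)
    (hv : ∀ i, v i < regBound w.length) :
    ∃ s', (guesses K n).sem w s s' ∧ ∀ i : Fin n, s'.val (K + i) = v i := by
  induction n with
  | zero => exact ⟨s, rfl, fun i => i.elim0⟩
  | succ n ih =>
    obtain ⟨r, hr, hr'⟩ := ih (fun i => v i.castSucc) (fun i => hv _)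
    obtain ⟨s', hs, hs'⟩ := exists_guess r (K + n) (hv (Fin.last n))
    refine ⟨s', ⟨r, hr, hs⟩, fun i => ?_⟩
    refine Fin.lastCases hs' (fun i => ?_) i
    rw [← hr' i]
    refine (guess_frame hs).1 _ ?_
    simp; omega

end Prog

/-! ### Closure properties of checkable predicates -/

namespace Checkable

open Prog

variable {V W : Type}

/-- It suffices to compare the predicates at values that fit into registers. -/
theorem congr {P Q : List Λ → (V → ℕ) → Prop} (hP : Checkable P)
    (h : ∀ w ρ, (∀ v, ρ v < regBound w.length) → (P w ρ ↔ Q w ρ)) : Checkable Q := by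
  intro ι K hι
  obtain ⟨p, hp⟩ := hP ι K hι
  exact ⟨p, fun w s s' hs => (h _ _ fun v => s.val_lt _).1 (hp.sound w s s' hs), hp.frame,
    fun w s hs => hp.complete w s ((h _ _ fun v => s.val_lt _).2 hs)⟩

theorem subst {P : List Λ → (V → ℕ) → Prop} (hP : Checkable P) (f : V → W) :
    Checkable fun w (ρ : W → ℕ) => P w fun v => ρ (f v) :=
  fun ι K hι => hP (fun v => ι (f v)) K fun _ => hι _

theorem const_true : Checkable fun (_ : List Λ) (_ : V → ℕ) => True :=
  fun _ _ _ => ⟨skip, fun _ _ _ _ => trivial, fun _ _ _ h => by cases h; exact fun _ _ => rfl,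
    fun _ s _ => ⟨s, rfl⟩⟩

theorem and {P Q : List Λ → (V → ℕ) → Prop} (hP : Checkable P) (hQ : Checkable Q) :
    Checkable fun w ρ => P w ρ ∧ Q w ρ := by
  intro ι K hι
  obtain ⟨p, hp⟩ := hP ι K hι
  obtain ⟨q, hq⟩ := hQ ι K hι
  have key : ∀ w (s r : Store w), p.sem w s r →
      (fun v => r.val (ι v)) = fun v => s.val (ι v) :=
    fun w s r h => funext fun v => hp.frame w s r h _ (hι v)
  refine ⟨seq p q, ?_, ?_, ?_⟩
  · rintro w s s' ⟨r, h₁, h₂⟩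
    refine ⟨hp.sound w s r h₁, ?_⟩
    rw [← key w s r h₁]
    exact hq.sound w r s' h₂
  · rintro w s s' ⟨r, h₁, h₂⟩ i hi
    exact (hq.frame w r s' h₂ i hi).trans (hp.frame w s r h₁ i hi)
  · rintro w s ⟨h₁, h₂⟩
    obtain ⟨r, hr⟩ := hp.complete w s h₁
    rw [← key w s r hr] at h₂
    obtain ⟨s', hs⟩ := hq.complete w r h₂
    exact ⟨s', r, hr, hs⟩

theorem or {P Q : List Λ → (V → ℕ) → Prop} (hP : Checkable P) (hQ : Checkable Q) :
    Checkable fun w ρ => P w ρ ∨ Q w ρ := by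
  intro ι K hι
  obtain ⟨p, hp⟩ := hP ι K hι
  obtain ⟨q, hq⟩ := hQ ι K hι
  refine ⟨alt p q, ?_, ?_, ?_⟩
  · rintro w s s' (h | h)
    exacts [Or.inl (hp.sound w s s' h), Or.inr (hq.sound w s s' h)]
  · rintro w s s' (h | h)
    exacts [hp.frame w s s' h, hq.frame w s s' h]
  · rintro w s (h | h)
    · exact (hp.complete w s h).imp fun _ => Or.inl
    · exact (hq.complete w s h).imp fun _ => Or.inr

theorem forallFin {k : ℕ} {P : Fin k → List Λ → (V → ℕ) → Prop} (h : ∀ i, Checkable (P i)) :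
    Checkable fun w ρ => ∀ i, P i w ρ := by
  induction k with
  | zero => exact const_true.congr fun _ _ _ => ⟨fun _ i => i.elim0, fun _ => trivial⟩
  | succ k ih =>
    exact ((h 0).and (ih fun i => h i.succ)).congr fun _ _ _ => by rw [Fin.forall_fin_succ]

theorem ex {P : List Λ → (V → ℕ) → ℕ → Prop}
    (h : Checkable fun w (ρ : Option V → ℕ) => P w (fun v => ρ (some v)) (ρ none)) :
    Checkable fun w ρ => ∃ x, x < regBound w.length ∧ P w ρ x := by
  intro ι K hι
  -- Registers from `K` on are free. The witness is guessed in register `K`, which the program for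
  -- the body then has to preserve.
  obtain ⟨p, hp⟩ := h (fun v => v.elim K ι) (K + 1) (by
    rintro (_ | v)
    · exact Nat.lt_succ_self K
    · exact (hι v).trans (Nat.lt_succ_self K))
  have key : ∀ (w : List Λ) (s r : Store w), (guess K).sem w s r →
      (fun v => r.val (ι v)) = fun v => s.val (ι v) :=
    fun w s r h => funext fun v => (guess_frame h).1 _ (hι v).ne
  refine ⟨seq (guess K) p, ?_, ?_, ?_⟩
  · rintro w s s' ⟨r, h₁, h₂⟩
    have := hp.sound w r s' h₂
    simp only [Option.elim] at this
    rw [key w s r h₁] at this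
    exact ⟨_, r.val_lt K, this⟩
  · rintro w s s' ⟨r, h₁, h₂⟩ i hi
    exact (hp.frame w r s' h₂ i (by omega)).trans ((guess_frame h₁).1 _ hi.ne)
  · rintro w s ⟨x, hx, hP⟩
    obtain ⟨r, hr, hr'⟩ := exists_guess s K hx
    obtain ⟨s', hs⟩ := hp.complete w r (by
      simp only [Option.elim]
      rw [key w s r hr, hr']
      exact hP)
    exact ⟨s', r, hr, hs⟩

theorem zero (x : V) : Checkable fun (_ : List Λ) ρ => ρ x = 0 := by
  intro ι K hι
  refine ⟨atom (.reg .zero (ι x)), fun w s s' h => h.1.1, fun w s s' h i hi => ?_, fun w s h => ?_⟩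
  · rcases eq_or_ne i (ι x) with rfl | hne
    exacts [h.1.2, h.2.1 i hne]
  · exact ⟨s, ⟨h, rfl⟩, fun _ _ => rfl, rfl⟩

section Eq

variable {w : List Λ} {i j t : ℕ}

/-- The sums of the registers `i` and `t` and of the registers `j` and `t` are the same, and so
are all other registers. -/
def SameSums (i j t : ℕ) (s s' : Store w) : Prop :=
  s'.val i + s'.val t = s.val i + s.val t ∧ s'.val j + s'.val t = s.val j + s.val t ∧
    ∀ l, l ≠ i → l ≠ j → l ≠ t → s'.val l = s.val l

theorem sameSums_of_sem_star {p : Prog Λ}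
    (hp : ∀ s s' : Store w, p.sem w s s' → SameSums i j t s s') {s s' : Store w}
    (h : (star p).sem w s s') : SameSums i j t s s' := by
  change ReflTransGen _ s s' at h
  induction h with
  | refl => exact ⟨rfl, rfl, fun _ _ _ _ => rfl⟩
  | tail _ h ih =>
    have := hp _ _ h
    exact ⟨this.1.trans ih.1, this.2.1.trans ih.2.1,
      fun l h₁ h₂ h₃ => (this.2.2 l h₁ h₂ h₃).trans (ih.2.2 l h₁ h₂ h₃)⟩

/-- Decrement the registers `i` and `j` and increment the register `t`. -/
def take (i j t : ℕ) : Prog Λ :=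
  seq (atom (.reg .dec i)) (seq (atom (.reg .dec j)) (atom (.reg .inc t)))

/-- Increment the registers `i` and `j` and decrement the register `t`. -/
def give (i j t : ℕ) : Prog Λ :=
  seq (atom (.reg .dec t)) (seq (atom (.reg .inc i)) (atom (.reg .inc j)))

theorem take_sem (hij : i ≠ j) (hit : i ≠ t) (hjt : j ≠ t) {s s' : Store w}
    (h : (take i j t).sem w s s') : SameSums i j t s s' := by
  obtain ⟨r, ⟨a, b, -⟩, r', ⟨a', b', -⟩, ⟨a'', b'', -⟩⟩ := h
  simp only [Mode.Rel] at a a' a''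
  have h₁ := b j hij.symm
  have h₂ := b t hit.symm
  have h₃ := b' i hij
  have h₄ := b' t hjt.symm
  have h₅ := b'' i hit
  have h₆ := b'' j hjt
  refine ⟨by omega, by omega, fun l h₁ h₂ h₃ => ?_⟩
  rw [b'' l h₃, b' l h₂, b l h₁]

theorem give_sem (hij : i ≠ j) (hit : i ≠ t) (hjt : j ≠ t) {s s' : Store w}
    (h : (give i j t).sem w s s') : SameSums i j t s s' := by
  obtain ⟨r, ⟨a, b, -⟩, r', ⟨a', b', -⟩, ⟨a'', b'', -⟩⟩ := h
  simp only [Mode.Rel] at a a' a''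
  have h₁ := b i hit
  have h₂ := b j hjt
  have h₃ := b' j hij.symm
  have h₄ := b' t hit.symm
  have h₅ := b'' i hij
  have h₆ := b'' t hjt.symm
  refine ⟨by omega, by omega, fun l h₁ h₂ h₃ => ?_⟩
  rw [b'' l h₂, b' l h₁, b l h₃]

theorem exists_take (hij : i ≠ j) (hit : i ≠ t) (hjt : j ≠ t) (s : Store w) {n : ℕ}
    (hi : s.val i = n) (hj : s.val j = n) (ht : s.val t + n < regBound w.length) :
    ∃ s', (star (take i j t)).sem w s s' ∧ s'.val i = 0 ∧ s'.val j = 0 := by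
  induction n generalizing s with
  | zero => exact ⟨s, ReflTransGen.refl, hi, hj⟩
  | succ n ih =>
    have hB := s.val_lt i
    obtain ⟨r, hr, ri⟩ := exists_reg s .dec i (v := n) (by omega) hi
    have h₁ := hr.2.1 j hij.symm
    have h₂ := hr.2.1 t hit.symm
    obtain ⟨r', hr', rj⟩ := exists_reg r .dec j (v := n) (by omega) (by simp [Mode.Rel]; omega)
    have h₃ := hr'.2.1 i hij
    have h₄ := hr'.2.1 t hjt.symm
    obtain ⟨r'', hr'', rt⟩ := exists_reg r' .inc t (v := s.val t + 1) (by omega)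
      (by simp [Mode.Rel]; omega)
    have h₅ := hr''.2.1 i hit
    have h₆ := hr''.2.1 j hjt
    obtain ⟨s', hs, hs'⟩ := ih r'' (by omega) (by omega) (by omega)
    exact ⟨s', ReflTransGen.head ⟨r, hr, r', hr', hr''⟩ hs, hs'⟩

theorem exists_give (hij : i ≠ j) (hit : i ≠ t) (hjt : j ≠ t) (s : Store w) {n : ℕ}
    (hi : s.val i + n < regBound w.length) (hj : s.val j + n < regBound w.length)
    (ht : s.val t = n) :
    ∃ s', (star (give i j t)).sem w s s' ∧ s'.val t = 0 := by
  induction n generalizing s with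
  | zero => exact ⟨s, ReflTransGen.refl, ht⟩
  | succ n ih =>
    have hB := s.val_lt t
    obtain ⟨r, hr, rt⟩ := exists_reg s .dec t (v := n) (by omega) ht
    have h₁ := hr.2.1 i hit
    have h₂ := hr.2.1 j hjt
    obtain ⟨r', hr', ri⟩ := exists_reg r .inc i (v := s.val i + 1) (by omega)
      (by simp [Mode.Rel]; omega)
    have h₃ := hr'.2.1 j hij.symm
    have h₄ := hr'.2.1 t hit.symm
    obtain ⟨r'', hr'', rj⟩ := exists_reg r' .inc j (v := s.val j + 1) (by omega)
      (by simp [Mode.Rel]; omega)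
    have h₅ := hr''.2.1 i hij
    have h₆ := hr''.2.1 t hjt.symm
    obtain ⟨s', hs, hs'⟩ := ih r'' (by omega) (by omega) (by omega)
    exact ⟨s', ReflTransGen.head ⟨r, hr, r', hr', hr''⟩ hs, hs'⟩

/-- Test the registers `i` and `j` for equality, with the scratch register `t`. -/
def eqProg (i j t : ℕ) : Prog Λ :=
  seq (guess t) (seq (atom (.reg .zero t)) (seq (star (take i j t)) (seq (atom (.reg .zero i))
    (seq (atom (.reg .zero j)) (seq (star (give i j t)) (atom (.reg .zero t)))))))

theorem zero_sem {s s' : Store w} (h : (atom (.reg .zero i)).sem w s s') :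
    s.val i = 0 ∧ s' = s := by
  refine ⟨h.1.1, Store.ext_val (fun l => ?_) h.2.2⟩
  rcases eq_or_ne l i with rfl | hne
  exacts [h.1.2, h.2.1 l hne]

theorem sem_zero {s : Store w} (h : s.val i = 0) : (atom (.reg .zero i)).sem w s s :=
  ⟨⟨h, rfl⟩, fun _ _ => rfl, rfl⟩

/-- The same amount is moved from `i` and `j` to the scratch register until both are zero, and is
then moved back. The two sums with the scratch register are invariant, and the tests for zero pin
down the values at the turning point and at the end; so success means equality and restores both
registers. -/
theorem checks_eqProg (hij : i ≠ j) {K : ℕ} (hi : i < K) (hj : j < K) :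
    Checks (Λ := Λ) (eqProg i j K) K fun _ σ => σ i = σ j := by
  have both : ∀ w (s s' : Store w), (eqProg (Λ := Λ) i j K).sem w s s' →
      s.val i = s.val j ∧ ∀ l < K, s'.val l = s.val l := by
    rintro w s s' ⟨s₁, h₁, _, h₂, s₃, h₃, _, h₄, _, h₅, s₆, h₆, h₇⟩
    obtain ⟨z₂, rfl⟩ := zero_sem h₂
    obtain ⟨z₄, rfl⟩ := zero_sem h₄
    obtain ⟨z₅, rfl⟩ := zero_sem h₅
    obtain ⟨z₇, rfl⟩ := zero_sem h₇
    have a₁ := (guess_frame h₁).1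
    obtain ⟨b₁, b₂, b₃⟩ := sameSums_of_sem_star (fun _ _ => take_sem hij hi.ne hj.ne) h₃
    obtain ⟨c₁, c₂, c₃⟩ := sameSums_of_sem_star (fun _ _ => give_sem hij hi.ne hj.ne) h₆
    have a₂ := a₁ i hi.ne
    have a₃ := a₁ j hj.ne
    refine ⟨by omega, fun l hl => ?_⟩
    by_cases hli : l = i
    · subst hli; omega
    by_cases hlj : l = j
    · subst hlj; omega
    rw [c₃ l hli hlj hl.ne, b₃ l hli hlj hl.ne, a₁ l hl.ne]
  refine ⟨fun w s s' h => (both w s s' h).1, fun w s s' h => (both w s s' h).2, fun w s h => ?_⟩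
  have hB := s.val_lt i
  obtain ⟨s₁, h₁, z₁⟩ := exists_guess s K (v := 0) (by omega)
  have a₁ := (guess_frame h₁).1
  have a₂ := a₁ i hi.ne
  have a₃ := a₁ j hj.ne
  obtain ⟨s₃, h₃, z₃, z₃'⟩ := exists_take (t := K) hij hi.ne hj.ne s₁ (n := s.val i) a₂ (by omega)
    (by omega)
  obtain ⟨b₁, b₂, b₃⟩ := sameSums_of_sem_star (fun _ _ => take_sem hij hi.ne hj.ne) h₃
  obtain ⟨s₆, h₆, z₆⟩ := exists_give (t := K) hij hi.ne hj.ne s₃ (n := s.val i) (by omega)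
    (by omega) (by omega)
  exact ⟨s₆, s₁, h₁, s₁, sem_zero z₁, s₃, h₃, s₃, sem_zero z₃, s₃, sem_zero z₃', s₆, h₆,
    sem_zero z₆⟩

theorem eq (x y : V) : Checkable fun (_ : List Λ) ρ => ρ x = ρ y := by
  intro ι K hι
  -- Two names may share a register. The equality program would decrement it twice, but then there
  -- is nothing to test.
  by_cases h : ι x = ι y
  · obtain ⟨p, hp⟩ := Checkable.const_true (Λ := Λ) ι K hι
    exact ⟨p, fun w s s' _ => congrArg s.val h, hp.frame, fun w s _ => hp.complete w s trivial⟩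
  · exact ⟨_, checks_eqProg h (hι x) (hι y)⟩

end Eq

/-- The register of `x` must be preserved, so a copy in register `K` is incremented and compared
with `y`. If the predicate holds, the increment does not block, because its result is the value of a
register. -/
theorem succ (x y : V) : Checkable fun (_ : List Λ) ρ => ρ y = ρ x + 1 := by
  intro ι K hι
  obtain ⟨p, hp⟩ := Checkable.eq (Λ := Λ) false true (fun b => bif b then ι x else K)
    (K + 1) (by rintro (_ | _) <;> simp [(hι x).trans (Nat.lt_succ_self K)])
  obtain ⟨q, hq⟩ := Checkable.eq (Λ := Λ) false true (fun b => bif b then ι y else K)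
    (K + 1) (by rintro (_ | _) <;> simp [(hι y).trans (Nat.lt_succ_self K)])
  have both : ∀ w (s s' : Store w),
      (seq (guess K) (seq p (seq (atom (.reg .inc K)) q))).sem w s s' →
      s.val (ι y) = s.val (ι x) + 1 ∧ ∀ l < K, s'.val l = s.val l := by
    rintro w s s' ⟨s₁, h₁, s₂, h₂, s₃, h₃, h₄⟩
    have a₁ := (guess_frame h₁).1
    have b := hp.sound _ _ _ h₂
    have a₂ := hp.frame _ _ _ h₂
    have a₃ := h₃.2.1
    have c := h₃.1
    have d := hq.sound _ _ _ h₄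
    have a₄ := hq.frame _ _ _ h₄
    simp only [cond_true, cond_false, Mode.Rel] at b c d
    have fr : ∀ l < K, s₃.val l = s.val l := fun l hl => by
      rw [a₃ l hl.ne, a₂ l (by omega), a₁ l hl.ne]
    refine ⟨?_, fun l hl => by rw [a₄ l (by omega), fr l hl]⟩
    rw [← fr _ (hι y), ← d, c, a₂ K (by omega), b, a₁ _ (hι x).ne]
  refine ⟨seq (guess K) (seq p (seq (atom (.reg .inc K)) q)), fun w s s' h => (both w s s' h).1,
    fun w s s' h => (both w s s' h).2, fun w s h => ?_⟩
  obtain ⟨s₁, h₁, z₁⟩ := exists_guess s K (s.val_lt (ι x))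
  have a₁ := (guess_frame h₁).1
  obtain ⟨s₂, h₂⟩ := hp.complete w s₁ (by
    simp only [cond_true, cond_false]; rw [z₁, a₁ _ (hι x).ne])
  have a₂ := hp.frame _ _ _ h₂
  obtain ⟨s₃, h₃, z₃⟩ := exists_reg s₂ .inc K (s.val_lt (ι y)) (by
    simp only [Mode.Rel]; rw [a₂ K (by omega), z₁]; exact h)
  obtain ⟨s₄, h₄⟩ := hq.complete w s₃ (by
    simp only [cond_true, cond_false]
    rw [z₃, h₃.2.1 _ (hι y).ne, a₂ _ ((hι y).trans (Nat.lt_succ_self K)), a₁ _ (hι y).ne])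
  exact ⟨s₄, s₁, h₁, s₂, h₂, s₃, h₃, h₄⟩

section Scan

variable {w : List Λ} {i : ℕ}

theorem scan_eq_leftEnd_iff {h : ℕ} : NTM.scan w h = .leftEnd ↔ h = 0 := by
  unfold NTM.scan
  split_ifs with h0
  · simp [h0]
  · cases w[h - 1]? <;> simp [h0]

/-- Move the input head to the left end. -/
def rewind : Prog Λ := seq (star (atom .left)) (atom (.look .leftEnd))

theorem rewind_sem {s s' : Store w} (h : rewind.sem w s s') : s'.reg = s.reg ∧ s'.head = 0 := by
  obtain ⟨r, h₁, h₂, rfl⟩ := h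
  refine ⟨?_, scan_eq_leftEnd_iff.1 h₂⟩
  change ReflTransGen _ s s' at h₁
  clear h₂
  induction h₁ with
  | refl => rfl
  | tail _ h ih => exact h.2.trans ih

theorem sem_rewind (s : Store w) : rewind.sem w s ⟨s.reg, 0⟩ := by
  refine ⟨⟨s.reg, 0⟩, ?_, scan_eq_leftEnd_iff.2 rfl, rfl⟩
  obtain ⟨f, n⟩ := s
  change ReflTransGen _ _ _
  induction n with
  | zero => exact .refl
  | succ n ih => exact .head (b := ⟨f, n⟩) ⟨rfl, rfl⟩ ih

/-- The sum of the register `i` and the head position is the same, and so are all other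
registers. -/
def SameSum (i : ℕ) (s s' : Store w) : Prop :=
  s'.val i + s'.head = s.val i + s.head ∧ ∀ l, l ≠ i → s'.val l = s.val l

theorem sameSum_of_sem_star {p : Prog Λ}
    (hp : ∀ s s' : Store w, p.sem w s s' → SameSum i s s') {s s' : Store w}
    (h : (star p).sem w s s') : SameSum i s s' := by
  change ReflTransGen _ s s' at h
  induction h with
  | refl => exact ⟨rfl, fun _ _ => rfl⟩
  | tail _ h ih =>
    have := hp _ _ h
    exact ⟨this.1.trans ih.1, fun l h₁ => (this.2 l h₁).trans (ih.2 l h₁)⟩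

/-- Decrement the register `i` and move the head to the right. -/
def advance (i : ℕ) : Prog Λ := seq (atom (.reg .dec i)) (atom .right)

/-- Increment the register `i` and move the head to the left. -/
def retreat (i : ℕ) : Prog Λ := seq (atom (.reg .inc i)) (atom .left)

theorem val_eq_of_reg_eq {s s' : Store w} (h : s'.reg = s.reg) (l : ℕ) : s'.val l = s.val l := by
  simp only [Store.val, h]

theorem advance_sem {s s' : Store w} (h : (advance i).sem w s s') : SameSum i s s' := by
  obtain ⟨r, ⟨a, b, c⟩, d, e, f⟩ := h
  simp only [Mode.Rel] at a
  refine ⟨?_, fun l hl => ?_⟩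
  · rw [val_eq_of_reg_eq f]; omega
  · rw [val_eq_of_reg_eq f, b l hl]

theorem retreat_sem {s s' : Store w} (h : (retreat i).sem w s s') : SameSum i s s' := by
  obtain ⟨r, ⟨a, b, c⟩, d, f⟩ := h
  simp only [Mode.Rel] at a
  refine ⟨?_, fun l hl => ?_⟩
  · rw [val_eq_of_reg_eq f]; omega
  · rw [val_eq_of_reg_eq f, b l hl]

theorem exists_advance (s : Store w) {n : ℕ} (hn : s.val i = n) (h : s.head + n ≤ w.length + 1) :
    ∃ s', (star (advance i)).sem w s s' ∧ s'.val i = 0 := by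
  induction n generalizing s with
  | zero => exact ⟨s, ReflTransGen.refl, hn⟩
  | succ n ih =>
    have hB := s.val_lt i
    obtain ⟨r, hr, ri⟩ := exists_reg s .dec i (v := n) (by omega) hn
    have hh := hr.2.2
    obtain ⟨s', hs, hs'⟩ := ih ⟨r.reg, r.head + 1⟩ ri (by simp only; omega)
    have step : (advance i).sem w s ⟨r.reg, r.head + 1⟩ := ⟨r, hr, by omega, rfl, rfl⟩
    exact ⟨s', ReflTransGen.head step hs, hs'⟩

theorem exists_retreat (s : Store w) {n : ℕ} (hn : s.head = n)
    (h : s.val i + n < regBound w.length) :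
    ∃ s', (star (retreat i)).sem w s s' ∧ s'.head = 0 := by
  induction n generalizing s with
  | zero => exact ⟨s, ReflTransGen.refl, hn⟩
  | succ n ih =>
    obtain ⟨r, hr, ri⟩ := exists_reg s .inc i (v := s.val i + 1) (by omega) rfl
    have hh := hr.2.2
    have hv : (⟨r.reg, n⟩ : Store w).val i = r.val i := rfl
    obtain ⟨s', hs, hs'⟩ := ih ⟨r.reg, n⟩ rfl (by omega)
    have step : (retreat i).sem w s ⟨r.reg, n⟩ := ⟨r, hr, by simp only; omega, rfl⟩
    exact ⟨s', ReflTransGen.head step hs, hs'⟩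

/-- Test the input symbol at the position given by the register `i`. -/
def scanProg (i : ℕ) (c : Scan Λ) : Prog Λ :=
  seq rewind (seq (star (advance i)) (seq (atom (.reg .zero i)) (seq (atom (.look c))
    (seq (star (retreat i)) (atom (.look .leftEnd))))))

theorem advance_head_le {s s' : Store w} (h : (star (advance i)).sem w s s')
    (hs : s.head ≤ w.length + 1) : s'.head ≤ w.length + 1 := by
  change ReflTransGen _ s s' at h
  induction h with
  | refl => exact hs
  | tail _ h _ =>
    obtain ⟨r, -, d, e, -⟩ := h
    omega

/-- From the left end, the head moves right while the register counts down to zero, so that it stops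
at the position stored there. The sum of register and head position is invariant, and retreating
until the left end marker is seen restores the register. -/
theorem checks_scanProg (i : ℕ) (c : Scan Λ) (K : ℕ) :
    Checks (scanProg i c) K fun w σ => σ i ≤ w.length + 1 ∧ NTM.scan w (σ i) = c := by
  have both : ∀ w (s s' : Store w), (scanProg i c).sem w s s' →
      (s.val i ≤ w.length + 1 ∧ NTM.scan w (s.val i) = c) ∧ ∀ l, s'.val l = s.val l := by
    rintro w s s' ⟨s₁, h₁, s₂, h₂, _, h₃, s₄, ⟨h₄, e₄⟩, s₅, h₅, h₆, e₅⟩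
    subst e₄ e₅
    obtain ⟨z₃, e₃⟩ := zero_sem h₃
    subst e₃
    obtain ⟨a₁, b₁⟩ := rewind_sem h₁
    have a₁ := val_eq_of_reg_eq a₁
    obtain ⟨a₂, b₂⟩ := sameSum_of_sem_star (fun _ _ => advance_sem) h₂
    obtain ⟨a₅, b₅⟩ := sameSum_of_sem_star (fun _ _ => retreat_sem) h₅
    have h0 := scan_eq_leftEnd_iff.1 h₆
    have h₇ := advance_head_le h₂ (by omega)
    have e : s.val i = s₄.head := by
      have := a₁ i
      omega
    rw [← e] at h₄ h₇
    refine ⟨⟨h₇, h₄⟩, fun l => ?_⟩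
    by_cases hl : l = i
    · subst hl; omega
    · rw [b₅ l hl, b₂ l hl, a₁ l]
  refine ⟨fun w s s' h => (both w s s' h).1, fun w s s' h l _ => (both w s s' h).2 l, ?_⟩
  rintro w s ⟨hl, hc⟩
  obtain ⟨s₂, h₂, z₂⟩ := exists_advance (i := i) (⟨s.reg, 0⟩ : Store w) (n := s.val i) rfl
    (by simpa using hl)
  obtain ⟨a₂, b₂⟩ := sameSum_of_sem_star (fun _ _ => advance_sem) h₂
  have e : s.val i = s₂.head := by
    have hv : (⟨s.reg, 0⟩ : Store w).val i = s.val i := rfl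
    simp only at a₂
    omega
  have hB := s.val_lt i
  obtain ⟨s₅, h₅, z₅⟩ := exists_retreat (i := i) s₂ rfl (by omega)
  rw [e] at hc
  exact ⟨s₅, _, sem_rewind s, s₂, h₂, s₂, sem_zero z₂, s₂, ⟨hc, rfl⟩, s₅, h₅,
    scan_eq_leftEnd_iff.2 z₅, rfl⟩

theorem scan (x : V) (c : Scan Λ) :
    Checkable fun w ρ => ρ x ≤ w.length + 1 ∧ NTM.scan w (ρ x) = c :=
  fun ι K _ => ⟨_, checks_scanProg (ι x) c K⟩

end Scan

/-- The relation `E` between tuples of register values. -/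
def Bounded (w : List Λ) {k : ℕ} (E : (Fin k → ℕ) → (Fin k → ℕ) → Prop) (x y : Fin k → ℕ) : Prop :=
  (∀ i, y i < regBound w.length) ∧ E x y

/-- The program walks along a path and only remembers two tuples: the current one in the `k`
registers from `K` on, the next one in the `k` registers after these. Since intermediate tuples are
stored in registers, their entries are bounded. -/
theorem reflTransGen {k : ℕ} {E : List Λ → (V → ℕ) → (Fin k → ℕ) → (Fin k → ℕ) → Prop}
    (hE : Checkable fun w (ρ : V ⊕ (Fin k ⊕ Fin k) → ℕ) =>
      E w (fun v => ρ (.inl v)) (fun i => ρ (.inr (.inl i))) (fun i => ρ (.inr (.inr i))))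
    (a b : Fin k → V) :
    Checkable fun w ρ =>
      ReflTransGen (Bounded w (E w ρ)) (fun i => ρ (a i)) (fun i => ρ (b i)) := by
  intro ι K hι
  obtain ⟨p, hp⟩ := hE (Sum.elim ι (Sum.elim (fun i => K + i) (fun i => K + k + i))) (K + k + k)
    (by
      rintro (v | i | i)
      · have := hι v
        simp only [Sum.elim_inl]
        omega
      all_goals simp only [Sum.elim_inl, Sum.elim_inr]; omega)
  obtain ⟨c, hc⟩ := forallFin (V := Fin k ⊕ Fin k)
    (fun i => Checkable.eq (Λ := Λ) (.inl i) (.inr i)) (Sum.elim (fun i => K + i)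
      (fun i => K + k + i)) (K + k + k) (by rintro (i | i) <;> (simp only [Sum.elim_inl, Sum.elim_inr]; omega))
  obtain ⟨ca, hca⟩ := forallFin (V := Fin k ⊕ V)
    (fun i => Checkable.eq (Λ := Λ) (.inl i) (.inr (a i))) (Sum.elim (fun i => K + i) ι)
      (K + k) (by
        rintro (i | v)
        · simp only [Sum.elim_inl]; omega
        · have := hι v
          simp only [Sum.elim_inr]; omega)
  obtain ⟨cb, hcb⟩ := forallFin (V := Fin k ⊕ V)
    (fun i => Checkable.eq (Λ := Λ) (.inl i) (.inr (b i))) (Sum.elim (fun i => K + i) ι)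
      (K + k) (by
        rintro (i | v)
        · simp only [Sum.elim_inl]; omega
        · have := hι v
          simp only [Sum.elim_inr]; omega)
  simp only [Sum.elim_inl, Sum.elim_inr] at hp hc hca hcb
  -- Guess the next tuple, check the edge, and make the next tuple the current one; copying is
  -- guessing anew and comparing.
  let body : Prog Λ := seq (guesses (K + k) k) (seq p (seq (guesses K k) c))
  have body_sound : ∀ w (s s' : Store w), body.sem w s s' → (∀ l < K, s'.val l = s.val l) ∧
      E w (fun v => s.val (ι v)) (fun i => s.val (K + i)) (fun i => s'.val (K + i)) := by
    rintro w s s' ⟨s₁, h₁, s₂, h₂, s₃, h₃, h₄⟩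
    have a₁ := guesses_frame h₁
    have a₂ := hp.frame _ _ _ h₂
    have a₃ := guesses_frame h₃
    have a₄ := hc.frame _ _ _ h₄
    have b₂ := hp.sound _ _ _ h₂
    have b₄ := hc.sound _ _ _ h₄
    refine ⟨fun l hl => ?_, ?_⟩
    · rw [a₄ l (by omega), a₃ l (by omega), a₂ l (by omega), a₁ l (by omega)]
    · convert b₂ using 1
      · funext v
        have := hι v
        rw [a₁ _ (by omega)]
      · funext i
        rw [a₁ _ (by omega)]
      · funext i
        rw [a₄ _ (by omega), b₄ i, a₃ _ (by omega), a₂ _ (by omega)]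
  have star_sound : ∀ w (s s' : Store w), (star body).sem w s s' →
      (∀ l < K, s'.val l = s.val l) ∧
      ReflTransGen (Bounded w (E w fun v => s.val (ι v))) (fun i => s.val (K + i))
        (fun i => s'.val (K + i)) := by
    intro w s s' h
    change ReflTransGen _ s s' at h
    induction h with
    | refl => exact ⟨fun _ _ => rfl, .refl⟩
    | tail _ h ih =>
      obtain ⟨h₁, h₂⟩ := body_sound w _ _ h
      refine ⟨fun l hl => (h₁ l hl).trans (ih.1 l hl), ih.2.tail ⟨fun i => Store.val_lt _ _, ?_⟩⟩
      convert h₂ using 1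
      funext v
      exact (ih.1 _ (hι v)).symm
  have body_complete : ∀ w (s : Store w) (y : Fin k → ℕ),
      Bounded w (E w fun v => s.val (ι v)) (fun i => s.val (K + i)) y →
      ∃ s', body.sem w s s' ∧ (fun i : Fin k => s'.val (K + i)) = y := by
    rintro w s y ⟨hy, hE⟩
    obtain ⟨s₁, h₁, z₁⟩ := exists_guesses s (K + k) k y hy
    have a₁ := guesses_frame h₁
    obtain ⟨s₂, h₂⟩ := hp.complete w s₁ (by
      convert hE using 1
      · funext v
        have := hι v
        rw [a₁ _ (by omega)]
      · funext i
        rw [a₁ _ (by omega)]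
      · funext i
        rw [z₁])
    have a₂ := hp.frame _ _ _ h₂
    obtain ⟨s₃, h₃, z₃⟩ := exists_guesses s₂ K k y hy
    have a₃ := guesses_frame h₃
    obtain ⟨s₄, h₄⟩ := hc.complete w s₃ (by
      intro i
      rw [z₃, a₃ _ (by omega), a₂ _ (by omega), z₁])
    have a₄ := hc.frame _ _ _ h₄
    refine ⟨s₄, ⟨s₁, h₁, s₂, h₂, s₃, h₃, h₄⟩, ?_⟩
    funext i
    rw [a₄ _ (by omega), z₃]
  have star_complete : ∀ w (s : Store w) (y : Fin k → ℕ),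
      ReflTransGen (Bounded w (E w fun v => s.val (ι v))) (fun i => s.val (K + i)) y →
      ∃ s', (star body).sem w s s' ∧ (fun i : Fin k => s'.val (K + i)) = y := by
    intro w s y h
    induction h with
    | refl => exact ⟨s, ReflTransGen.refl, rfl⟩
    | tail _ h ih =>
      obtain ⟨r, hr, hr'⟩ := ih
      have fr := (star_sound w s r hr).1
      rw [← hr'] at h
      obtain ⟨s', hs, hs'⟩ := body_complete w r _ (by
        convert h using 3
        exact fr _ (hι _))
      exact ⟨s', ReflTransGen.tail hr hs, hs'⟩
  refine ⟨seq (guesses K k) (seq ca (seq (star body) cb)), ?_, ?_, ?_⟩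
  · rintro w s s' ⟨s₁, h₁, s₂, h₂, s₃, h₃, h₄⟩
    have a₁ := guesses_frame h₁
    have a₂ := hca.frame _ _ _ h₂
    have b₂ := hca.sound _ _ _ h₂
    have b₄ := hcb.sound _ _ _ h₄
    obtain ⟨a₃, b₃⟩ := star_sound w _ _ h₃
    have fr : ∀ l < K, s₂.val l = s.val l := fun l hl => by
      rw [a₂ l (by omega), a₁ l (by omega)]
    convert b₃ using 1
    · simp only [fr _ (hι _)]
    · funext i
      rw [a₂ _ (by omega), b₂, a₁ _ (Or.inl (hι _))]
    · funext i
      rw [b₄, a₃ _ (hι _), fr _ (hι _)]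
  · rintro w s s' ⟨s₁, h₁, s₂, h₂, s₃, h₃, h₄⟩ l hl
    rw [hcb.frame _ _ _ h₄ l (by omega), (star_sound w _ _ h₃).1 l hl,
      hca.frame _ _ _ h₂ l (by omega), guesses_frame h₁ l (by omega)]
  · intro w s h
    obtain ⟨s₁, h₁, z₁⟩ := exists_guesses s K k (fun i => s.val (ι (a i))) fun i => s.val_lt _
    have a₁ := guesses_frame h₁
    obtain ⟨s₂, h₂⟩ := hca.complete w s₁ (by
      intro i
      rw [z₁, a₁ _ (Or.inl (hι _))])
    have a₂ := hca.frame _ _ _ h₂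
    have fr : ∀ l < K, s₂.val l = s.val l := fun l hl => by
      rw [a₂ l (by omega), a₁ l (by omega)]
    obtain ⟨s₃, h₃, z₃⟩ := star_complete w s₂ (fun i => s.val (ι (b i))) (by
      convert h using 1
      · simp only [fr _ (hι _)]
      · funext i
        rw [a₂ _ (by omega), z₁])
    obtain ⟨s₄, h₄⟩ := hcb.complete w s₃ (by
      intro i
      rw [(star_sound w _ _ h₃).1 _ (hι _), fr _ (hι _)]
      exact congrFun z₃ i)
    exact ⟨s₄, s₁, h₁, s₂, h₂, s₃, h₃, h₄⟩

end Checkable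

end Noninterference

namespace Noninterference

open Relation

/-! ### Inductive counting -/

/-- The results of counting the numbers `i < n` with `Q i`, if `Q' i` has to hold whenever `i` is
not counted. -/
inductive Tally (Q Q' : ℕ → Prop) : ℕ → ℕ → Prop
  | zero : Tally Q Q' 0 0
  | yes {n c : ℕ} : Tally Q Q' n c → Q n → Tally Q Q' (n + 1) (c + 1)
  | no {n c : ℕ} : Tally Q Q' n c → Q' n → Tally Q Q' (n + 1) c

theorem Tally.le {Q Q' : ℕ → Prop} {n c : ℕ} (h : Tally Q Q' n c) : c ≤ n := by
  induction h with
  | zero => exact le_rfl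
  | yes _ _ ih => omega
  | no _ _ ih => omega

open Classical in
-- If numbers may be skipped without proof, a tally certifies a lower bound only.
theorem tally_true_iff {Q : ℕ → Prop} {n c : ℕ} :
    Tally Q (fun _ => True) n c ↔ c ≤ Nat.count Q n := by
  constructor
  · intro h
    induction h with
    | zero => simp
    | yes _ hQ ih => rw [Nat.count_succ, if_pos hQ]; omega
    | no _ _ ih => rw [Nat.count_succ]; omega
  · induction n generalizing c with
    | zero =>
      intro h
      obtain rfl : c = 0 := by simpa using h
      exact .zero
    | succ n ih =>
      intro h
      rw [Nat.count_succ] at h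
      by_cases hc : c ≤ Nat.count Q n
      · exact .no (ih hc) trivial
      · split_ifs at h with hQ
        · obtain rfl : c = Nat.count Q n + 1 := by omega
          exact .yes (ih le_rfl) hQ
        · omega

open Classical in
-- If skipping requires a proof of the negation, the tally is exact.
theorem tally_not_iff {Q Q' : ℕ → Prop} (hQ : ∀ i, Q' i ↔ ¬ Q i) {n c : ℕ} :
    Tally Q Q' n c ↔ c = Nat.count Q n := by
  constructor
  · intro h
    induction h with
    | zero => simp
    | yes _ hi ih => rw [Nat.count_succ, if_pos hi, ih]
    | no _ hi ih => rw [Nat.count_succ, if_neg ((hQ _).1 hi), ih, add_zero]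
  · induction n generalizing c with
    | zero =>
      intro h
      obtain rfl : c = 0 := by simpa using h
      exact .zero
    | succ n ih =>
      rintro rfl
      rw [Nat.count_succ]
      split_ifs with hi
      · exact .yes (ih rfl) hi
      · exact .no (ih rfl) ((hQ _).2 hi)

/-- A subset of a finite set with at least as many elements is the whole set. This is how a count
proves that no node has been overlooked. -/
theorem of_count_le {P P' : ℕ → Prop} [DecidablePred P] [DecidablePred P'] {M : ℕ}
    (h : ∀ k, P' k → P k)
    (hc : Nat.count P M ≤ Nat.count P' M) {k : ℕ} (hk : k < M) (hP : P k) : P' k := by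
  rw [Nat.count_eq_card_filter_range, Nat.count_eq_card_filter_range] at hc
  have := Finset.eq_of_subset_of_card_le (Finset.monotone_filter_right _ fun k _ => h k) hc
  have hmem : k ∈ (Finset.range M).filter P := by simp [hk, hP]
  rw [← this] at hmem
  exact (Finset.mem_filter.1 hmem).2

section Counting

variable {α : Type} (q : ℕ → α) (M : ℕ) (E : α → α → Prop) (a : α)

/-- `x` can be reached from `a` in less than `j` steps. -/
def ReachIn : ℕ → α → Prop
  | 0, _ => False
  | j + 1, x => x = a ∨ ReachIn j x ∨ ∃ z, ReachIn j z ∧ E z x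

open Classical in
/-- The number of the nodes `q 0, …, q (M - 1)` that can be reached in less than `j` steps. -/
noncomputable def reachCount (j : ℕ) : ℕ := Nat.count (fun i => ReachIn E a j (q i)) M

open Classical in
/-- There are `c` nodes which can be reached in less than `j` steps, but are not `x` and have no
edge to `x`, and `x` is not `a`. -/
def Excluded (j c : ℕ) (x : α) : Prop :=
  x ≠ a ∧ c ≤ Nat.count (fun k => ReachIn E a j (q k) ∧ q k ≠ x ∧ ¬ E (q k) x) M

variable {q M E a}

theorem ReachIn.reflTransGen {j : ℕ} {x : α} (h : ReachIn E a j x) : ReflTransGen E a x := by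
  induction j generalizing x with
  | zero => exact h.elim
  | succ j ih =>
    rcases h with rfl | h | ⟨z, h, hz⟩
    exacts [.refl, ih h, (ih h).tail hz]

theorem ReachIn.exists_index (hq : ∀ x, (x = a ∨ ∃ z, E z x) → ∃ k < M, q k = x)
    {j : ℕ} {x : α} (h : ReachIn E a j x) : ∃ k < M, q k = x := by
  induction j with
  | zero => exact h.elim
  | succ j ih =>
    rcases h with h | h | ⟨z, -, h⟩
    exacts [hq x (.inl h), ih h, hq x (.inr ⟨z, h⟩)]

/-- The nodes found are as many as there are nodes reachable in less than `j` steps, so they are all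
of them. None being `x` or a predecessor of `x`, the node `x` is not reached one step later either.
By `hq`, all nodes that matter occur in the enumeration. -/
theorem excluded_iff (hq : ∀ x, (x = a ∨ ∃ z, E z x) → ∃ k < M, q k = x) {j : ℕ} {x : α} :
    Excluded q M E a j (reachCount q M E a j) x ↔ ¬ ReachIn E a (j + 1) x := by
  classical
  constructor
  · rintro ⟨h₁, h₂⟩ (h | h | ⟨z, hz, h⟩)
    · exact h₁ h
    · obtain ⟨k, hk, rfl⟩ := h.exists_index hq
      exact (of_count_le (fun _ h' => And.left h') h₂ hk h).2.1 rfl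
    · obtain ⟨k, hk, rfl⟩ := hz.exists_index hq
      exact (of_count_le (fun _ h' => And.left h') h₂ hk hz).2.2 h
  · intro h
    refine ⟨fun e => h (.inl e), Nat.count_mono_left fun k _ hr => ⟨hr, ?_, ?_⟩⟩
    · rintro rfl
      exact h (.inr (.inl hr))
    · exact fun e => h (.inr (.inr ⟨_, hr, e⟩))

/-- The induction step of the counting: the count for `j` makes non-membership at stage `j + 1`
certifiable, and so the count for `j + 1` is the only possible tally. -/
theorem tally_reachIn_iff (hq : ∀ x, (x = a ∨ ∃ z, E z x) → ∃ k < M, q k = x) {j c : ℕ} :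
    Tally (fun i => ReachIn E a (j + 1) (q i))
      (fun i => Excluded q M E a j (reachCount q M E a j) (q i)) M c ↔
      c = reachCount q M E a (j + 1) :=
  tally_not_iff fun _ => excluded_iff hq

theorem ReachIn.succ {j : ℕ} {x : α} (h : ReachIn E a j x) : ReachIn E a (j + 1) x := .inr (.inl h)

/-- The counts begin with 0, never decrease and are at most `M`, so two consecutive ones agree at
some `j ≤ M`. -/
theorem exists_of_not_reflTransGen {t : α} (h : ¬ ReflTransGen E a t) :
    ∃ j ≤ M, reachCount q M E a (j + 1) = reachCount q M E a j ∧ ¬ ReachIn E a (j + 1) t := by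
  classical
  by_contra! hne
  have grow : ∀ j ≤ M + 1, j ≤ reachCount q M E a j := by
    intro j
    induction j with
    | zero => simp
    | succ j ih =>
      intro hj
      have h₁ : reachCount q M E a j ≤ reachCount q M E a (j + 1) :=
        Nat.count_mono_left fun k _ hr => hr.succ
      have h₂ : reachCount q M E a (j + 1) ≠ reachCount q M E a j := fun e =>
        h (hne j (by omega) e).reflTransGen
      have := ih (by omega)
      omega
  have h₁ := grow (M + 1) le_rfl
  have h₂ : reachCount q M E a (M + 1) ≤ M := Nat.count_le _
  omega

/-- Equal counts of nested sets mean equal sets, so stage `j` is closed under edges and already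
contains everything reachable. -/
theorem not_reflTransGen_of_reachCount_eq (hq : ∀ x, (x = a ∨ ∃ z, E z x) → ∃ k < M, q k = x)
    {t : α} {j : ℕ} (hj : reachCount q M E a (j + 1) = reachCount q M E a j)
    (ht : ¬ ReachIn E a (j + 1) t) : ¬ ReflTransGen E a t := by
  classical
  intro h
  have closed : ∀ x, ReachIn E a (j + 1) x → ReachIn E a j x := by
    intro x hx
    obtain ⟨k, hk, rfl⟩ := hx.exists_index hq
    exact of_count_le (fun k hk => hk.succ) hj.le hk hx
  have all : ∀ x, ReflTransGen E a x → ReachIn E a (j + 1) x := by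
    intro x hx
    induction hx with
    | refl => exact .inl rfl
    | tail _ h ih => exact .inr (.inr ⟨_, closed _ ih, h⟩)
  exact ht (all t h)

end Counting

end Noninterference

namespace Noninterference

open Relation

/-! ### Checking reachability and non-reachability -/

namespace Checkable

variable {Λ V W : Type}

theorem le (x y : V) : Checkable fun (_ : List Λ) ρ => ρ x ≤ ρ y := by
  refine (reflTransGen (k := 1) (E := fun _ _ x y => y 0 = x 0 + 1) (succ _ _)
    (fun _ => x) (fun _ => y)).congr fun w ρ hρ => ?_
  constructor
  · intro h
    have key : ∀ z : Fin 1 → ℕ,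
        ReflTransGen (Bounded w fun x y : Fin 1 → ℕ => y 0 = x 0 + 1) (fun _ => ρ x) z →
        ρ x ≤ z 0 := by
      intro z hz
      induction hz with
      | refl => exact le_rfl
      | tail _ h ih => have := h.2; omega
    exact key _ h
  · intro h
    have hy := hρ y
    obtain ⟨d, hd⟩ := Nat.exists_eq_add_of_le h
    rw [hd] at hy ⊢
    clear hd h
    induction d with
    | zero => exact .refl
    | succ d ih => exact (ih (by omega)).tail ⟨fun _ => hy, rfl⟩

theorem lt (x y : V) : Checkable fun (_ : List Λ) ρ => ρ x < ρ y := by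
  refine (ex (P := fun _ ρ z => z = ρ x + 1 ∧ z ≤ ρ y) ((succ _ _).and (le _ _))).congr
    fun w ρ hρ => ⟨?_, fun h => ⟨ρ x + 1, lt_of_le_of_lt h (hρ y), rfl, h⟩⟩
  rintro ⟨z, -, rfl, h⟩
  exact h

/-- Checkable predicates need not be closed under negation, so inequality is obtained from the
order, which comes from repeated increments. -/
theorem ne (x y : V) : Checkable fun (_ : List Λ) ρ => ρ x ≠ ρ y :=
  ((lt x y).or (lt y x)).congr fun _ _ _ => by omega

theorem scan_eq_rightEnd_iff {w : List Λ} {h : ℕ} :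
    NTM.scan w h = .rightEnd ↔ w.length + 1 ≤ h := by
  unfold NTM.scan
  split_ifs with h0
  · simp [h0]
  · cases e : w[h - 1]?
    · rw [List.getElem?_eq_none_iff] at e
      simp; omega
    · have := (List.getElem?_eq_some_iff.1 e).1
      simp; omega

/-- The right end marker is at position `w.length + 1`, so the input tape has `w.length + 2`
positions. This number serves as the range of all bounded quantifiers and graph nodes. -/
theorem eq_size (x : V) : Checkable fun (w : List Λ) ρ => ρ x = w.length + 2 := by
  refine (ex (P := fun w ρ z => (z ≤ w.length + 1 ∧ NTM.scan w z = .rightEnd) ∧ ρ x = z + 1)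
    ((scan _ _).and (succ _ _))).congr fun w ρ hρ => ⟨?_, fun h => ⟨w.length + 1, ?_, ?_, h⟩⟩
  · rintro ⟨z, -, ⟨h₁, h₂⟩, h₃⟩
    rw [scan_eq_rightEnd_iff] at h₂
    omega
  · have := hρ x
    omega
  · exact ⟨le_rfl, scan_eq_rightEnd_iff.2 le_rfl⟩

theorem small (x : V) : Checkable fun (w : List Λ) ρ => ρ x < w.length + 2 := by
  refine (ex (P := fun w ρ z => z = w.length + 2 ∧ ρ x < z) ((eq_size _).and (lt _ _))).congr
    fun w ρ hρ => ⟨?_, fun h => ⟨_, add_two_lt_regBound _, rfl, h⟩⟩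
  rintro ⟨z, -, rfl, h⟩
  exact h

theorem not_small (x : V) : Checkable fun (w : List Λ) ρ => ¬ ρ x < w.length + 2 := by
  refine (ex (P := fun w ρ z => z = w.length + 2 ∧ z ≤ ρ x) ((eq_size _).and (le _ _))).congr
    fun w ρ hρ => ⟨?_, fun h => ⟨_, add_two_lt_regBound _, rfl, not_lt.1 h⟩⟩
  rintro ⟨z, -, rfl, h⟩
  exact not_lt.2 h

theorem succ_eq_size (x : V) : Checkable fun (w : List Λ) ρ => w.length + 2 = ρ x + 1 :=
  (scan x .rightEnd).congr fun w ρ _ => by rw [scan_eq_rightEnd_iff]; omega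

theorem subst₂ {Q : List Λ → (V → ℕ) → ℕ → ℕ → Prop}
    (hQ : Checkable fun w (ρ : Option (Option V) → ℕ) =>
      Q w (fun v => ρ (some (some v))) (ρ (some none)) (ρ none)) (f : V → W) (x y : W) :
    Checkable fun w ρ => Q w (fun v => ρ (f v)) (ρ x) (ρ y) :=
  hQ.subst fun v => v.elim y fun v => v.elim x f

theorem subst₄ {E : List Λ → (V → ℕ) → ℕ → ℕ → ℕ → ℕ → Prop}
    (hE : Checkable fun w (ρ : Option (Option (Option (Option V))) → ℕ) =>
      E w (fun v => ρ (some (some (some (some v))))) (ρ (some (some (some none))))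
        (ρ (some (some none))) (ρ (some none)) (ρ none)) (f : V → W) (x y x' y' : W) :
    Checkable fun w ρ => E w (fun v => ρ (f v)) (ρ x) (ρ y) (ρ x') (ρ y') :=
  hE.subst fun v => v.elim y' fun v => v.elim x' fun v => v.elim y fun v => v.elim x f

/-- One step of the enumeration of the pairs below `S`, with a counter. -/
def TallyStep (S : ℕ) (Q Q' : ℕ → ℕ → Prop) (x y : Fin 3 → ℕ) : Prop :=
  ((y 0 = x 0 ∧ y 1 = x 1 + 1 ∧ y 1 < S) ∨ (y 0 = x 0 + 1 ∧ S = x 1 + 1 ∧ y 1 = 0)) ∧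
    ((Q (x 0) (x 1) ∧ y 2 = x 2 + 1) ∨ (Q' (x 0) (x 1) ∧ y 2 = x 2))

/-- The first two entries are the quotient and the remainder modulo `S` of the index reached; a step
increments the index, with or without a carry. The third entry is the tally so far. -/
theorem tally_of_reflTransGen {w : List Λ} {S : ℕ} (hS : 0 < S) {Q Q' : ℕ → ℕ → Prop}
    {y : Fin 3 → ℕ} (h : ReflTransGen (Bounded w (TallyStep S Q Q')) (fun _ => 0) y) :
    y 1 < S ∧
      Tally (fun i => Q (i / S) (i % S)) (fun i => Q' (i / S) (i % S)) (y 0 * S + y 1) (y 2) := by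
  induction h with
  | refl => exact ⟨hS, by simpa using Tally.zero⟩
  | @tail x y _ h ih =>
    obtain ⟨-, h₁, h₂⟩ := h
    obtain ⟨h₃, ih⟩ := ih
    have e : (x 0 * S + x 1) / S = x 0 := by
      rw [mul_comm, Nat.mul_add_div hS, Nat.div_eq_of_lt h₃, add_zero]
    have e' : (x 0 * S + x 1) % S = x 1 := by
      rw [mul_comm, Nat.mul_add_mod, Nat.mod_eq_of_lt h₃]
    have hn : y 0 * S + y 1 = x 0 * S + x 1 + 1 := by
      rcases h₁ with ⟨h, h', -⟩ | ⟨h, h', h''⟩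
      · rw [h, h']; omega
      · rw [h, h'', add_one_mul]; omega
    refine ⟨by omega, ?_⟩
    rw [hn]
    rcases h₂ with ⟨h, h'⟩ | ⟨h, h'⟩
    · rw [h']
      exact .yes ih (by rwa [e, e'])
    · rw [h']
      exact .no ih (by rwa [e, e'])

theorem reflTransGen_of_tally {w : List Λ} {S : ℕ} (hS : S = w.length + 2) {Q Q' : ℕ → ℕ → Prop}
    {n c : ℕ} (hn : n ≤ S * S)
    (h : Tally (fun i => Q (i / S) (i % S)) (fun i => Q' (i / S) (i % S)) n c) :
    ReflTransGen (Bounded w (TallyStep S Q Q')) (fun _ => 0) ![n / S, n % S, c] := by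
  have hB := sq_add_two_lt_regBound w.length
  have hB' := add_two_lt_regBound w.length
  rw [← hS] at hB hB'
  have hS' : 0 < S := by omega
  -- The final index `S * S` is included: there the quotient is `S` itself, which still fits into a
  -- register.
  have bd : ∀ n c, c ≤ n → n ≤ S * S → ∀ i, ![n / S, n % S, c] i < regBound w.length := by
    intro n c hc hn i
    have h₁ : n / S ≤ S := Nat.div_le_of_le_mul hn
    have h₂ := Nat.mod_lt n hS'
    fin_cases i <;> simp <;> omega
  have step : ∀ n, ((n + 1) / S = n / S ∧ (n + 1) % S = n % S + 1 ∧ (n + 1) % S < S) ∨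
      ((n + 1) / S = n / S + 1 ∧ S = n % S + 1 ∧ (n + 1) % S = 0) := by
    intro n
    have h₁ := Nat.mod_lt n hS'
    have h₂ := Nat.div_add_mod n S
    rcases Nat.lt_or_ge (n % S + 1) S with h | h
    · refine .inl ?_
      have e : n + 1 = S * (n / S) + (n % S + 1) := by omega
      have h₃ : (n + 1) / S = n / S := by
        conv_lhs => rw [e]
        rw [Nat.mul_add_div hS', Nat.div_eq_of_lt h, add_zero]
      have h₄ : (n + 1) % S = n % S + 1 := by
        conv_lhs => rw [e]
        rw [Nat.mul_add_mod, Nat.mod_eq_of_lt h]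
      exact ⟨h₃, h₄, by omega⟩
    · refine .inr ?_
      have e : n + 1 = S * (n / S + 1) := by rw [mul_add]; omega
      refine ⟨?_, by omega, ?_⟩
      · conv_lhs => rw [e]
        rw [Nat.mul_div_cancel_left _ hS']
      · rw [e, Nat.mul_mod_right]
  induction h with
  | zero =>
    convert ReflTransGen.refl using 1
    funext i
    fin_cases i <;> simp
  | @yes n c h hQ ih =>
    refine (ih (by omega)).tail ⟨bd _ _ (Tally.yes h hQ).le hn, step n, .inl ⟨hQ, rfl⟩⟩
  | @no n c h hQ ih =>
    refine (ih (by omega)).tail ⟨bd _ _ (Tally.no h hQ).le hn, step n, .inr ⟨hQ, rfl⟩⟩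

/-- Indices up to `(w.length + 2) ^ 2` are run through as pairs of small numbers, from `(0, 0)` to
`(w.length + 2, 0)`. In this way `Q` and `Q'` receive the pair itself, and no division has to be
programmed. -/
theorem tally {Q Q' : List Λ → (V → ℕ) → ℕ → ℕ → Prop}
    (hQ : Checkable fun w (ρ : Option (Option V) → ℕ) =>
      Q w (fun v => ρ (some (some v))) (ρ (some none)) (ρ none))
    (hQ' : Checkable fun w (ρ : Option (Option V) → ℕ) =>
      Q' w (fun v => ρ (some (some v))) (ρ (some none)) (ρ none)) (c : V) :
    Checkable fun w ρ => Tally (fun i => Q w ρ (i / (w.length + 2)) (i % (w.length + 2)))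
      (fun i => Q' w ρ (i / (w.length + 2)) (i % (w.length + 2)))
      ((w.length + 2) * (w.length + 2)) (ρ c) := by
  have hstep : Checkable fun w (ρ : Option (Option V) ⊕ (Fin 3 ⊕ Fin 3) → ℕ) =>
      TallyStep (w.length + 2) (Q w fun v => ρ (.inl (some (some v))))
        (Q' w fun v => ρ (.inl (some (some v))))
        (fun i => ρ (.inr (.inl i))) (fun i => ρ (.inr (.inr i))) := by
    refine ((((eq _ _).and ((succ _ _).and (small _))).or
      ((succ _ _).and ((succ_eq_size _).and (zero _)))).and
        (((hQ.subst₂ (fun v => Sum.inl (some (some v))) _ _).and (succ _ _)).or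
          ((hQ'.subst₂ (fun v => Sum.inl (some (some v))) _ _).and (eq _ _))))
  refine (ex (P := fun w ρ s => s = w.length + 2 ∧ ∃ z, z < regBound w.length ∧ z = 0 ∧
    ReflTransGen (Bounded w (TallyStep (w.length + 2) (Q w ρ) (Q' w ρ)))
      (fun i => ![z, z, z] i) (fun i => ![s, z, ρ c] i))
    ((eq_size _).and (ex ((zero _).and ((reflTransGen
      (E := fun w ρ => TallyStep (w.length + 2) (Q w fun v => ρ (some (some v)))
        (Q' w fun v => ρ (some (some v)))) hstep ![none, none, none] ![some none, none, some (some c)]).congr ?_))))).congr ?_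
  · intro w ρ _
    apply iff_of_eq
    congr 1 <;> (funext i; fin_cases i <;> rfl)
  · intro w ρ _
    have hS : 0 < w.length + 2 := by omega
    constructor
    · rintro ⟨s, -, rfl, z, -, rfl, h⟩
      have h₀ : (fun i => ![0, 0, 0] i) = fun _ : Fin 3 => 0 := by
        funext i; fin_cases i <;> rfl
      rw [h₀] at h
      simpa using (tally_of_reflTransGen hS h).2
    · intro h
      refine ⟨_, add_two_lt_regBound _, rfl, 0, by have := add_two_lt_regBound w.length; omega,
        rfl, ?_⟩
      convert reflTransGen_of_tally rfl le_rfl h using 1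
      · funext i; fin_cases i <;> rfl
      · funext i; fin_cases i <;> simp

/-- The restriction of a relation between pairs to pairs of numbers less than `S`. -/
def Restrict (S : ℕ) (E : ℕ → ℕ → ℕ → ℕ → Prop) (x y : ℕ × ℕ) : Prop :=
  (x.1 < S ∧ x.2 < S ∧ y.1 < S ∧ y.2 < S) ∧ E x.1 x.2 y.1 y.2

section Graph

variable {E : List Λ → (V → ℕ) → ℕ → ℕ → ℕ → ℕ → Prop}

theorem restrict
    (hE : Checkable fun w (ρ : Option (Option (Option (Option V))) → ℕ) =>
      E w (fun v => ρ (some (some (some (some v))))) (ρ (some (some (some none))))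
        (ρ (some (some none))) (ρ (some none)) (ρ none)) (f : V → W) (x y x' y' : W) :
    Checkable fun w ρ => Restrict (w.length + 2) (E w fun v => ρ (f v)) (ρ x, ρ y) (ρ x', ρ y') :=
  ((small _).and ((small _).and ((small _).and (small _)))).and (hE.subst₄ f x y x' y')

theorem not_restrict
    (hE : Checkable fun w (ρ : Option (Option (Option (Option V))) → ℕ) =>
      ¬ E w (fun v => ρ (some (some (some (some v))))) (ρ (some (some (some none))))
        (ρ (some (some none))) (ρ (some none)) (ρ none)) (f : V → W) (x y x' y' : W) :
    Checkable fun w ρ =>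
      ¬ Restrict (w.length + 2) (E w fun v => ρ (f v)) (ρ x, ρ y) (ρ x', ρ y') :=
  (((not_small x).or ((not_small y).or ((not_small x').or (not_small y')))).or
    (hE.subst₄ (E := fun w ρ x y x' y' => ¬ E w ρ x y x' y') f x y x' y')).congr fun w ρ _ => by
      simp only [Restrict]; tauto

theorem reachable
    (hE : Checkable fun w (ρ : Option (Option (Option (Option V))) → ℕ) =>
      E w (fun v => ρ (some (some (some (some v))))) (ρ (some (some (some none))))
        (ρ (some (some none))) (ρ (some none)) (ρ none)) (x y x' y' : V) :
    Checkable fun w ρ => ReflTransGen (Restrict (w.length + 2) (E w ρ)) (ρ x, ρ y) (ρ x', ρ y') := by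
  refine (reflTransGen (k := 2) (E := fun w ρ x y => Restrict (w.length + 2) (E w ρ) (x 0, x 1)
    (y 0, y 1)) (restrict hE _ _ _ _ _) ![x, y] ![x', y']).congr fun w ρ hρ => ?_
  constructor
  · intro h
    exact h.lift (fun x : Fin 2 → ℕ => (x 0, x 1)) fun _ _ h => h.2
  · intro h
    have := h.lift (p := Bounded w fun x y => Restrict (w.length + 2) (E w ρ) (x 0, x 1) (y 0, y 1))
      (fun x : ℕ × ℕ => ![x.1, x.2]) fun a b h => ⟨fun i => ?_, h⟩
    · convert this using 1 <;> (funext i; fin_cases i <;> rfl)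
    · have := add_two_lt_regBound w.length
      have h₁ : a.1 < _ ∧ a.2 < _ ∧ b.1 < _ ∧ b.2 < _ := h.1
      fin_cases i <;> simp <;> omega

/-- One step of a search that counts its steps. -/
def SearchStep (E : ℕ × ℕ → ℕ × ℕ → Prop) (x y : Fin 3 → ℕ) : Prop :=
  y 0 = x 0 + 1 ∧ ((y 1 = x 1 ∧ y 2 = x 2) ∨ E (x 1, x 2) (y 1, y 2))

/-- A search with a step counter, which may also stay where it is because fewer steps are allowed.
The counter begins with 1: less than one step reaches the starting pair, and less than zero steps
reach nothing. -/
theorem reachIn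
    (hE : Checkable fun w (ρ : Option (Option (Option (Option V))) → ℕ) =>
      E w (fun v => ρ (some (some (some (some v))))) (ρ (some (some (some none))))
        (ρ (some (some none))) (ρ (some none)) (ρ none)) (f : V → W) (a b j x y : W) :
    Checkable fun w ρ => ReachIn (Restrict (w.length + 2) (E w fun v => ρ (f v))) (ρ a, ρ b) (ρ j)
      (ρ x, ρ y) := by
  have hstep : Checkable fun w (ρ : Option (Option W) ⊕ (Fin 3 ⊕ Fin 3) → ℕ) =>
      SearchStep (Restrict (w.length + 2) (E w fun v => ρ (.inl (some (some (f v))))))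
        (fun i => ρ (.inr (.inl i))) (fun i => ρ (.inr (.inr i))) :=
    (succ _ _).and (((eq _ _).and (eq _ _)).or
      (restrict hE (fun v => Sum.inl (some (some (f v)))) _ _ _ _))
  refine (ex (P := fun w ρ z => z = 0 ∧ ∃ o, o < regBound w.length ∧ o = z + 1 ∧
    ReflTransGen (Bounded w (SearchStep (Restrict (w.length + 2) (E w fun v => ρ (f v)))))
      (fun i => ![o, ρ a, ρ b] i) (fun i => ![ρ j, ρ x, ρ y] i))
    ((zero _).and (ex ((succ _ _).and ((reflTransGen
      (E := fun w ρ => SearchStep (Restrict (w.length + 2) (E w fun v => ρ (some (some (f v))))))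
      hstep ![none, some (some a), some (some b)]
      ![some (some j), some (some x), some (some y)]).congr ?_))))).congr ?_
  · intro w ρ _
    apply iff_of_eq
    congr 1 <;> (funext i; fin_cases i <;> rfl)
  · intro w ρ hρ
    have hB := add_two_lt_regBound w.length
    have h0 : ∀ (g : Fin 3 → ℕ), (fun i => g i) = g := fun _ => rfl
    simp only [h0]
    generalize hj' : ρ j = j'
    have hj := hρ j
    rw [hj'] at hj
    constructor
    · rintro ⟨z, -, rfl, o, -, rfl, h⟩
      have key : ∀ z, ReflTransGen (Bounded w (SearchStep (Restrict (w.length + 2)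
          (E w fun v => ρ (f v))))) ![0 + 1, ρ a, ρ b] z →
          ReachIn (Restrict (w.length + 2) (E w fun v => ρ (f v))) (ρ a, ρ b) (z 0)
            (z 1, z 2) := by
        intro z hz
        induction hz with
        | refl => exact .inl rfl
        | @tail u v _ h ih =>
          obtain ⟨-, h₁, h₂⟩ := h
          rw [h₁]
          rcases h₂ with ⟨h₂, h₃⟩ | h₂
          · rw [h₂, h₃]
            exact .inr (.inl ih)
          · exact .inr (.inr ⟨_, ih, h₂⟩)
      exact key _ h
    · intro h
      refine ⟨0, by omega, rfl, 1, by omega, rfl, ?_⟩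
      have key : ∀ j' p, j' < regBound w.length →
          ReachIn (Restrict (w.length + 2) (E w fun v => ρ (f v))) (ρ a, ρ b) j' p →
          (p.1 < regBound w.length ∧ p.2 < regBound w.length) ∧
          ReflTransGen (Bounded w (SearchStep (Restrict (w.length + 2) (E w fun v => ρ (f v)))))
            ![1, ρ a, ρ b] ![j', p.1, p.2] := by
        intro j'
        induction j' with
        | zero => exact fun _ _ h => h.elim
        | succ j' ih =>
          intro p hj' h
          have stay : ReachIn (Restrict (w.length + 2) (E w fun v => ρ (f v))) (ρ a, ρ b) j' p →
              (p.1 < regBound w.length ∧ p.2 < regBound w.length) ∧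
              ReflTransGen (Bounded w (SearchStep (Restrict (w.length + 2)
                (E w fun v => ρ (f v))))) ![1, ρ a, ρ b] ![j' + 1, p.1, p.2] := by
            intro h
            obtain ⟨hp, h⟩ := ih p (by omega) h
            refine ⟨hp, h.tail ⟨fun i => ?_, rfl, .inl ⟨rfl, rfl⟩⟩⟩
            fin_cases i <;> simp <;> omega
          -- The starting pair occurs at every positive stage; beyond the first stage it is reached
          -- by waiting.
          rcases h with rfl | h | ⟨z, h, hE⟩
          · cases j' with
            | zero => exact ⟨⟨hρ a, hρ b⟩, .refl⟩
            | succ j' => exact stay (.inl rfl)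
          · exact stay h
          · have hs := hE.1
            refine ⟨by omega, (ih z (by omega) h).2.tail ⟨fun i => ?_, rfl, .inr hE⟩⟩
            fin_cases i <;> simp <;> omega
      exact (key _ _ hj h).2

/-- The pair with the index `i` in the enumeration of the pairs of numbers less than `S`. -/
def pairAt (S i : ℕ) : ℕ × ℕ := (i / S, i % S)

theorem exists_pairAt {S : ℕ} {p : ℕ × ℕ} (h₁ : p.1 < S) (h₂ : p.2 < S) :
    ∃ k < S * S, pairAt S k = p := by
  refine ⟨S * p.1 + p.2, ?_, ?_⟩
  · calc S * p.1 + p.2 < S * p.1 + S := by omega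
      _ = S * (p.1 + 1) := by ring
      _ ≤ S * S := Nat.mul_le_mul_left _ h₁
  · rw [pairAt, Nat.mul_add_div (by omega), Nat.div_eq_of_lt h₂, add_zero, Nat.mul_add_mod,
      Nat.mod_eq_of_lt h₂]

variable
    (hE : Checkable fun w (ρ : Option (Option (Option (Option V))) → ℕ) =>
      E w (fun v => ρ (some (some (some (some v))))) (ρ (some (some (some none))))
        (ρ (some (some none))) (ρ (some none)) (ρ none))
    (hE' : Checkable fun w (ρ : Option (Option (Option (Option V))) → ℕ) =>
      ¬ E w (fun v => ρ (some (some (some (some v))))) (ρ (some (some (some none))))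
        (ρ (some (some none))) (ρ (some none)) (ρ none))

include hE hE' in
-- `Excluded` asks for a lower bound on a count only, so skipping is free. Membership in a stage is
-- needed in positive form alone, whereas missing edges require that the negation of `E` be
-- checkable.
theorem excluded (f : V → W) (a b j c x y : W) :
    Checkable fun w ρ => Excluded (pairAt (w.length + 2)) ((w.length + 2) * (w.length + 2))
      (Restrict (w.length + 2) (E w fun v => ρ (f v))) (ρ a, ρ b) (ρ j) (ρ c) (ρ x, ρ y) := by
  refine (((ne x a).or (ne y b)).and (tally
    (Q := fun w ρ z z' => ReachIn (Restrict (w.length + 2) (E w fun v => ρ (f v))) (ρ a, ρ b) (ρ j)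
      (z, z') ∧ (z ≠ ρ x ∨ z' ≠ ρ y) ∧
        ¬ Restrict (w.length + 2) (E w fun v => ρ (f v)) (z, z') (ρ x, ρ y))
    (Q' := fun _ _ _ _ => True)
    ((reachIn hE (fun v => some (some (f v))) (some (some a)) (some (some b)) (some (some j)) _
      _).and (((ne _ _).or (ne _ _)).and
        (not_restrict hE' (fun v => some (some (f v))) _ _ _ _))) const_true c)).congr ?_
  intro w ρ _
  rw [Excluded, tally_true_iff]
  refine and_congr ?_ (iff_of_eq ?_)
  · simp only [ne_eq, Prod.mk.injEq]; tauto
  · congr! 3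
    simp only [pairAt, ne_eq, Prod.mk.injEq]
    tauto

include hE hE' in
theorem nextCount (f : V → W) (a b j j' c c' : W) :
    Checkable fun w ρ =>
      Tally
        (fun i => ReachIn (Restrict (w.length + 2) (E w fun v => ρ (f v))) (ρ a, ρ b) (ρ j')
          (pairAt (w.length + 2) i))
        (fun i => Excluded (pairAt (w.length + 2)) ((w.length + 2) * (w.length + 2))
          (Restrict (w.length + 2) (E w fun v => ρ (f v))) (ρ a, ρ b) (ρ j) (ρ c)
          (pairAt (w.length + 2) i))
        ((w.length + 2) * (w.length + 2)) (ρ c') :=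
  tally
    (Q := fun w ρ z z' => ReachIn (Restrict (w.length + 2) (E w fun v => ρ (f v))) (ρ a, ρ b)
      (ρ j') (z, z'))
    (Q' := fun w ρ z z' => Excluded (pairAt (w.length + 2)) ((w.length + 2) * (w.length + 2))
      (Restrict (w.length + 2) (E w fun v => ρ (f v))) (ρ a, ρ b) (ρ j) (ρ c) (z, z'))
    (reachIn hE (fun v => some (some (f v))) (some (some a)) (some (some b)) (some (some j')) _ _)
    (excluded hE hE' (fun v => some (some (f v))) (some (some a)) (some (some b)) (some (some j))
      (some (some c)) _ _) c'

/-- One step of counting the pairs that can be reached in less than `j` steps. -/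
def CountStep (S : ℕ) (E : ℕ × ℕ → ℕ × ℕ → Prop) (a : ℕ × ℕ) (x y : Fin 2 → ℕ) : Prop :=
  y 0 = x 0 + 1 ∧ Tally (fun i => ReachIn E a (y 0) (pairAt S i))
    (fun i => Excluded (pairAt S) (S * S) E a (x 0) (x 1) (pairAt S i)) (S * S) (y 1)

/-- Nondeterminism cannot falsify the counter: if it is right at one stage, the only tally available
at the next stage is the right one. -/
theorem reflTransGen_countStep_iff {w : List Λ} {E : ℕ × ℕ → ℕ × ℕ → Prop} {a : ℕ × ℕ}
    (hq : ∀ x, (x = a ∨ ∃ z, E z x) →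
      ∃ k < (w.length + 2) * (w.length + 2), pairAt (w.length + 2) k = x)
    {j c : ℕ} (hj : j < regBound w.length) :
    ReflTransGen (Bounded w (CountStep (w.length + 2) E a)) (fun _ => 0) ![j, c] ↔
      c = reachCount (pairAt (w.length + 2)) ((w.length + 2) * (w.length + 2)) E a j := by
  classical
  have hB := sq_add_two_lt_regBound w.length
  have h0 : reachCount (pairAt (w.length + 2)) ((w.length + 2) * (w.length + 2)) E a 0 = 0 := by
    rw [reachCount, Nat.count_iff_forall_not]
    exact fun _ _ => id
  constructor
  · intro h
    have key : ∀ y, ReflTransGen (Bounded w (CountStep (w.length + 2) E a)) (fun _ => 0) y →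
        y 1 = reachCount (pairAt (w.length + 2)) ((w.length + 2) * (w.length + 2)) E a (y 0) := by
      intro y hy
      induction hy with
      | refl => exact h0.symm
      | tail _ h ih =>
        obtain ⟨-, h₁, h₂⟩ := h
        rw [ih, h₁, tally_reachIn_iff hq] at h₂
        rw [h₁, h₂]
    exact key _ h
  · rintro rfl
    induction j with
    | zero =>
      convert ReflTransGen.refl using 1
      funext i
      fin_cases i
      exacts [rfl, h0]
    | succ j ih =>
      refine (ih (by omega)).tail ⟨fun i => ?_, rfl, (tally_reachIn_iff hq).2 rfl⟩
      have : reachCount (pairAt (w.length + 2)) ((w.length + 2) * (w.length + 2)) E a (j + 1) ≤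
        (w.length + 2) * (w.length + 2) := Nat.count_le _
      fin_cases i <;> simp <;> omega

include hE hE' in
-- Guess a stage `j`, compute its count `c`, verify that the next stage has the same count, and
-- certify that the target is missing there. The start has to be small so that it is among the
-- enumerated pairs; the target may be arbitrary.
theorem not_reachable (x y x' y' : V) :
    Checkable fun w ρ => ρ x < w.length + 2 ∧ ρ y < w.length + 2 ∧
      ¬ ReflTransGen (Restrict (w.length + 2) (E w ρ)) (ρ x, ρ y) (ρ x', ρ y') := by
  have hstep : Checkable fun w (ρ : Option (Option (Option V)) ⊕ (Fin 2 ⊕ Fin 2) → ℕ) =>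
      CountStep (w.length + 2) (Restrict (w.length + 2)
        (E w fun v => ρ (.inl (some (some (some v))))))
        (ρ (.inl (some (some (some x)))), ρ (.inl (some (some (some y)))))
        (fun i => ρ (.inr (.inl i))) (fun i => ρ (.inr (.inr i))) :=
    (succ _ _).and (nextCount hE hE' (fun v => Sum.inl (some (some (some v)))) _ _ _ _ _ _)
  refine ((small x).and ((small y).and (ex (P := fun w ρ z => z = 0 ∧
    ∃ j, j < regBound w.length ∧ ∃ c, c < regBound w.length ∧
    ReflTransGen (Bounded w (CountStep (w.length + 2) (Restrict (w.length + 2) (E w ρ))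
      (ρ x, ρ y))) (fun i => ![z, z] i) (fun i => ![j, c] i) ∧
    ∃ j', j' < regBound w.length ∧ j' = j + 1 ∧
      Tally (fun i => ReachIn (Restrict (w.length + 2) (E w ρ)) (ρ x, ρ y) j'
          (pairAt (w.length + 2) i))
        (fun i => Excluded (pairAt (w.length + 2)) ((w.length + 2) * (w.length + 2))
          (Restrict (w.length + 2) (E w ρ)) (ρ x, ρ y) j c (pairAt (w.length + 2) i))
        ((w.length + 2) * (w.length + 2)) c ∧
      Excluded (pairAt (w.length + 2)) ((w.length + 2) * (w.length + 2))
          (Restrict (w.length + 2) (E w ρ)) (ρ x, ρ y) j c (ρ x', ρ y'))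
    ((zero _).and (ex (ex ((((reflTransGen
      (E := fun w ρ => CountStep (w.length + 2)
        (Restrict (w.length + 2) (E w fun v => ρ (some (some (some v)))))
        (ρ (some (some (some x))), ρ (some (some (some y))))) hstep
      ![some (some none), some (some none)] ![some none, none]).congr ?_)).and
      (ex ((succ _ _).and ((nextCount hE hE' (fun v => some (some (some (some v)))) _ _ _ _ _ _).and
        (excluded hE hE' (fun v => some (some (some (some v)))) _ _ _ _ _ _))))))))))).congr ?_
  · intro w ρ _
    apply iff_of_eq
    congr 1 <;> (funext i; fin_cases i <;> rfl)
  · intro w ρ hρ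
    classical
    refine and_congr_right fun hx => and_congr_right fun hy => ?_
    have hB := sq_add_two_lt_regBound w.length
    have hq : ∀ p, (p = (ρ x, ρ y) ∨ ∃ z, Restrict (w.length + 2) (E w ρ) z p) →
        ∃ k < (w.length + 2) * (w.length + 2), pairAt (w.length + 2) k = p := by
      rintro p (rfl | ⟨z, hz⟩)
      exacts [exists_pairAt hx hy, exists_pairAt hz.1.2.2.1 hz.1.2.2.2]
    have hz : (fun i => ![0, 0] i) = fun _ : Fin 2 => 0 := by
      funext i; fin_cases i <;> rfl
    constructor
    · rintro ⟨z, -, rfl, j, hj, c, -, h₁, j', -, rfl, h₂, h₃⟩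
      rw [hz] at h₁
      have hc := (reflTransGen_countStep_iff hq hj).1 h₁
      rw [hc] at h₂ h₃
      exact not_reflTransGen_of_reachCount_eq hq ((tally_reachIn_iff hq).1 h₂).symm
        ((excluded_iff hq).1 h₃)
    · intro h
      -- The stage satisfies `j ≤ (w.length + 2) ^ 2`, so that `j` and `j + 1` fit into registers.
      obtain ⟨j, hj, h₁, h₂⟩ := exists_of_not_reflTransGen
        (q := pairAt (w.length + 2)) (M := (w.length + 2) * (w.length + 2)) h
      have hc : reachCount (pairAt (w.length + 2)) ((w.length + 2) * (w.length + 2))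
          (Restrict (w.length + 2) (E w ρ)) (ρ x, ρ y) j ≤
            (w.length + 2) * (w.length + 2) := Nat.count_le _
      refine ⟨0, by omega, rfl, j, by omega, _, by omega, ?_, j + 1, by omega, rfl,
        (tally_reachIn_iff hq).2 h₁.symm, (excluded_iff hq).2 h₂⟩
      rw [hz]
      exact (reflTransGen_countStep_iff hq (by omega)).2 rfl

end Graph

end Checkable

/-! ### Predicates that are checkable together with their negations -/

/-- Both `P` and its negation are checkable. -/
structure Definable {Λ V : Type} (P : List Λ → (V → ℕ) → Prop) : Prop where
  pos : Checkable P
  neg : Checkable fun w ρ => ¬ P w ρ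

namespace Definable

open Checkable

variable {Λ V W : Type}

theorem congr {P Q : List Λ → (V → ℕ) → Prop} (hP : Definable P)
    (h : ∀ w ρ, (∀ v, ρ v < regBound w.length) → (P w ρ ↔ Q w ρ)) : Definable Q :=
  ⟨hP.pos.congr h, hP.neg.congr fun w ρ hρ => not_congr (h w ρ hρ)⟩

theorem subst {P : List Λ → (V → ℕ) → Prop} (hP : Definable P) (f : V → W) :
    Definable fun w (ρ : W → ℕ) => P w fun v => ρ (f v) :=
  ⟨hP.pos.subst f, hP.neg.subst f⟩

theorem not {P : List Λ → (V → ℕ) → Prop} (hP : Definable P) : Definable fun w ρ => ¬ P w ρ :=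
  ⟨hP.neg, hP.pos.congr fun _ _ _ => not_not.symm⟩

theorem and {P Q : List Λ → (V → ℕ) → Prop} (hP : Definable P) (hQ : Definable Q) :
    Definable fun w ρ => P w ρ ∧ Q w ρ :=
  ⟨hP.pos.and hQ.pos, (hP.neg.or hQ.neg).congr fun _ _ _ => not_and_or.symm⟩

theorem or {P Q : List Λ → (V → ℕ) → Prop} (hP : Definable P) (hQ : Definable Q) :
    Definable fun w ρ => P w ρ ∨ Q w ρ :=
  ⟨hP.pos.or hQ.pos, (hP.neg.and hQ.neg).congr fun _ _ _ => not_or.symm⟩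

theorem imp {P Q : List Λ → (V → ℕ) → Prop} (hP : Definable P) (hQ : Definable Q) :
    Definable fun w ρ => P w ρ → Q w ρ :=
  (hP.not.or hQ).congr fun _ _ _ => imp_iff_not_or.symm

theorem iff {P Q : List Λ → (V → ℕ) → Prop} (hP : Definable P) (hQ : Definable Q) :
    Definable fun w ρ => (P w ρ ↔ Q w ρ) :=
  ((hP.imp hQ).and (hQ.imp hP)).congr fun _ _ _ => iff_iff_implies_and_implies.symm

theorem le (x y : V) : Definable fun (_ : List Λ) ρ => ρ x ≤ ρ y :=
  ⟨.le x y, (Checkable.lt y x).congr fun _ _ _ => not_le.symm⟩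

theorem lt (x y : V) : Definable fun (_ : List Λ) ρ => ρ x < ρ y :=
  (le y x).not.congr fun _ _ _ => not_le

theorem eq (x y : V) : Definable fun (_ : List Λ) ρ => ρ x = ρ y := ⟨.eq x y, .ne x y⟩

theorem small (x : V) : Definable fun (w : List Λ) ρ => ρ x < w.length + 2 :=
  ⟨.small x, .not_small x⟩

end Definable
end Noninterference

/-! ### Bounded quantifiers, arithmetic and input letters -/

namespace Noninterference

open Relation

/-- A bounded universal quantifier is a loop: a counter goes from 0 to `w.length + 2` and may leave
a value only if `P` has been checked there. -/
theorem Checkable.forall_small {Λ V : Type} {P : List Λ → (V → ℕ) → ℕ → Prop}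
    (h : Checkable fun w (ρ : Option V → ℕ) => P w (fun v => ρ (some v)) (ρ none)) :
    Checkable fun w ρ => ∀ x, x < w.length + 2 → P w ρ x := by
  have hstep : Checkable fun w (ρ : Option (Option V) ⊕ (Fin 1 ⊕ Fin 1) → ℕ) =>
      ρ (.inr (.inr 0)) = ρ (.inr (.inl 0)) + 1 ∧
        P w (fun v => ρ (.inl (some (some v)))) (ρ (.inr (.inl 0))) :=
    (succ _ _).and (h.subst fun v => v.elim (Sum.inr (Sum.inl 0)) fun v => Sum.inl (some (some v)))
  refine (ex (P := fun w ρ z => z = 0 ∧ ∃ s, s < regBound w.length ∧ s = w.length + 2 ∧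
    ReflTransGen (Bounded w fun x y : Fin 1 → ℕ => y 0 = x 0 + 1 ∧ P w ρ (x 0)) (fun _ => z)
      (fun _ => s))
    ((zero _).and (ex ((eq_size _).and (reflTransGen
      (E := fun w ρ x y => y 0 = x 0 + 1 ∧ P w (fun v => ρ (some (some v))) (x 0)) hstep
      (fun _ => some none) (fun _ => none)))))).congr fun w ρ _ => ?_
  have hB := add_two_lt_regBound w.length
  constructor
  · rintro ⟨z, -, rfl, s, -, rfl, h⟩
    have key : ∀ z : Fin 1 → ℕ, ReflTransGen (Bounded w fun x y : Fin 1 → ℕ =>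
        y 0 = x 0 + 1 ∧ P w ρ (x 0)) (fun _ => 0) z → ∀ x, x < z 0 → P w ρ x := by
      intro z hz
      induction hz with
      | refl => exact fun x hx => absurd hx (Nat.not_lt_zero x)
      | tail _ h ih =>
        intro x hx
        rw [h.2.1] at hx
        rcases Nat.lt_succ_iff_lt_or_eq.1 hx with hx | rfl
        exacts [ih x hx, h.2.2]
    exact key _ h
  · intro h
    refine ⟨0, by omega, rfl, _, hB, rfl, ?_⟩
    have key : ∀ n ≤ w.length + 2, ReflTransGen (Bounded w fun x y : Fin 1 → ℕ =>
        y 0 = x 0 + 1 ∧ P w ρ (x 0)) (fun _ => 0) (fun _ => n) := by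
      intro n
      induction n with
      | zero => exact fun _ => .refl
      | succ n ih =>
        intro hn
        exact (ih (by omega)).tail ⟨fun _ => lt_of_le_of_lt hn hB, rfl, h n (by omega)⟩
    exact key _ le_rfl

/-- The variable `x` is there to express falsity, as `ρ x ≠ ρ x`. -/
theorem Checkable.const {Λ V : Type} (p : Prop) (x : V) :
    Checkable fun (_ : List Λ) (_ : V → ℕ) => p := by
  by_cases hp : p
  · exact const_true.congr fun _ _ _ => by simp [hp]
  · exact (ne x x).congr fun _ _ _ => by simp [hp]

namespace Definable

open Checkable

variable {Λ V W : Type}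

theorem ex {P : List Λ → (V → ℕ) → ℕ → Prop}
    (h : Definable fun w (ρ : Option V → ℕ) => P w (fun v => ρ (some v)) (ρ none)) :
    Definable fun w ρ => ∃ x, x < w.length + 2 ∧ P w ρ x := by
  refine ⟨?_, (forall_small (P := fun w ρ x => ¬ P w ρ x) h.neg).congr fun w ρ _ => ?_⟩
  · refine (Checkable.ex (P := fun w ρ x => x < w.length + 2 ∧ P w ρ x)
      ((Checkable.small _).and h.pos)).congr fun w ρ _ => ?_
    have := add_two_lt_regBound w.length
    exact ⟨fun ⟨x, _, h⟩ => ⟨x, h⟩, fun ⟨x, h⟩ => ⟨x, by omega, h⟩⟩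
  · push Not
    exact Iff.rfl

theorem all {P : List Λ → (V → ℕ) → ℕ → Prop}
    (h : Definable fun w (ρ : Option V → ℕ) => P w (fun v => ρ (some v)) (ρ none)) :
    Definable fun w ρ => ∀ x, x < w.length + 2 → P w ρ x :=
  (ex (P := fun w ρ x => ¬ P w ρ x) h.not).not.congr fun _ _ _ => by push Not; exact Iff.rfl

theorem zero (x : V) : Definable fun (_ : List Λ) ρ => ρ x = 0 := by
  refine ⟨.zero x, (Checkable.ex (P := fun _ ρ z => z = 0 ∧ z < ρ x)
    ((Checkable.zero _).and (.lt _ _))).congr fun w ρ hρ => ⟨?_, fun h => ⟨0, ?_, rfl, ?_⟩⟩⟩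
  · rintro ⟨z, -, rfl, h⟩; omega
  · have := hρ x; omega
  · omega

theorem succ (x y : V) : Definable fun (_ : List Λ) ρ => ρ y = ρ x + 1 := by
  refine ⟨.succ x y, ((Checkable.le y x).or (Checkable.ex (P := fun _ ρ z => ρ x < z ∧ z < ρ y)
    ((Checkable.lt _ _).and (.lt _ _)))).congr fun w ρ hρ => ⟨?_, fun h => ?_⟩⟩
  · rintro (h | ⟨z, -, h₁, h₂⟩) <;> omega
  · rcases Nat.lt_or_ge (ρ x) (ρ y) with h' | h'
    · have := hρ y
      exact .inr ⟨ρ x + 1, by omega, by omega, by omega⟩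
    · exact .inl h'

/-- The bounds on the start belong to the predicate because the certificate of non-reachability is
available for small starts only; for other starts the negation is immediate. -/
theorem reachable {E : List Λ → (V → ℕ) → ℕ → ℕ → ℕ → ℕ → Prop}
    (hE : Definable fun w (ρ : Option (Option (Option (Option V))) → ℕ) =>
      E w (fun v => ρ (some (some (some (some v))))) (ρ (some (some (some none))))
        (ρ (some (some none))) (ρ (some none)) (ρ none)) (x y x' y' : V) :
    Definable fun w ρ => (ρ x < w.length + 2 ∧ ρ y < w.length + 2) ∧
      ReflTransGen (Restrict (w.length + 2) (E w ρ)) (ρ x, ρ y) (ρ x', ρ y') := by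
  refine ⟨((Checkable.small x).and (.small y)).and (.reachable hE.pos x y x' y'),
    (((not_small x).or (not_small y)).or (not_reachable hE.pos hE.neg x y x' y')).congr
      fun w ρ _ => ?_⟩
  tauto

/-- Addition is reachability on pairs, from `(0, ρ y)` by incrementing both components. This form
yields the negation as well. -/
theorem add (x y z : V) : Definable fun (w : List Λ) ρ =>
    ρ x < w.length + 2 ∧ ρ y < w.length + 2 ∧ ρ z < w.length + 2 ∧ ρ z = ρ x + ρ y := by
  refine (ex (P := fun w ρ o => o = 0 ∧ (o < w.length + 2 ∧ ρ y < w.length + 2) ∧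
    ReflTransGen (Restrict (w.length + 2) fun x y x' y' => x' = x + 1 ∧ y' = y + 1) (o, ρ y)
      (ρ x, ρ z))
    ((zero _).and (reachable (E := fun _ _ x y x' y' => x' = x + 1 ∧ y' = y + 1)
      ((succ _ _).and (succ _ _)) _ _ _ _))).congr fun w ρ _ => ?_
  constructor
  · rintro ⟨o, -, rfl, ⟨-, hy⟩, h⟩
    have key : ∀ p, ReflTransGen (Restrict (w.length + 2) fun x y x' y' => x' = x + 1 ∧ y' = y + 1)
        (0, ρ y) p → p.1 < w.length + 2 ∧ p.2 < w.length + 2 ∧ p.2 = p.1 + ρ y := by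
      intro p hp
      induction hp with
      | refl => exact ⟨by omega, hy, by simp⟩
      | tail _ h ih =>
        obtain ⟨h₁, h₂, h₃⟩ := h
        omega
    have := key _ h
    exact ⟨this.1, hy, this.2⟩
  · rintro ⟨hx, hy, hz, e⟩
    refine ⟨0, by omega, rfl, ⟨by omega, hy⟩, ?_⟩
    rw [e] at hz ⊢
    clear e
    generalize ρ x = n at *
    induction n with
    | zero => simpa using ReflTransGen.refl
    | succ n ih =>
      refine (ih (by omega) (by omega)).tail ⟨?_, rfl, ?_⟩
      · simp only; omega
      · simp only; omega

/-- A function which, as long as its values are small, has a definable graph. -/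
def Fun (f : List Λ → (V → ℕ) → ℕ) : Prop :=
  Definable fun w (ρ : Option V → ℕ) => ρ none < w.length + 2 ∧ ρ none = f w fun v => ρ (some v)

theorem Fun.var (x : V) : Fun fun (_ : List Λ) ρ => ρ x := (small _).and (eq _ _)

/-- As `P` holds at small values only, the value of `f` can be named by a bounded quantifier; a
large value makes both sides false. -/
theorem apply {P : List Λ → (V → ℕ) → ℕ → Prop}
    (h : Definable fun w (ρ : Option V → ℕ) => P w (fun v => ρ (some v)) (ρ none))
    (hP : ∀ w ρ x, P w ρ x → x < w.length + 2) {f : List Λ → (V → ℕ) → ℕ} (hf : Fun f) :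
    Definable fun w ρ => P w ρ (f w ρ) := by
  refine (ex (P := fun w ρ y => (y < w.length + 2 ∧ y = f w ρ) ∧ P w ρ y)
    (Definable.and hf h)).congr fun w ρ _ => ⟨?_, fun h => ⟨_, hP _ _ _ h, ⟨hP _ _ _ h, rfl⟩, h⟩⟩
  rintro ⟨y, -, ⟨-, rfl⟩, h⟩
  exact h

theorem Fun.add {f g : List Λ → (V → ℕ) → ℕ} (hf : Fun f) (hg : Fun g) :
    Fun fun w ρ => f w ρ + g w ρ := by
  refine (ex (P := fun w (ρ : Option V → ℕ) x => (x < w.length + 2 ∧ x = f w fun v => ρ (some v)) ∧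
    ∃ y, y < w.length + 2 ∧ (y < w.length + 2 ∧ y = g w fun v => ρ (some v)) ∧
      (x < w.length + 2 ∧ y < w.length + 2 ∧ ρ none < w.length + 2 ∧ ρ none = x + y))
    ((Definable.subst hf fun v => v.elim none fun v => some (some v)).and
      (ex ((Definable.subst hg fun v => v.elim none fun v => some (some (some v))).and
        (Definable.add _ _ _))))).congr fun w ρ _ => ?_
  beta_reduce
  constructor
  · rintro ⟨x, -, ⟨-, rfl⟩, y, -, ⟨-, rfl⟩, -, -, h⟩
    exact h
  · rintro ⟨h, h'⟩
    exact ⟨f w fun v => ρ (some v), by omega, ⟨by omega, rfl⟩, g w fun v => ρ (some v), by omega,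
      ⟨by omega, rfl⟩, by omega, by omega, h, h'⟩

theorem Fun.const (n : ℕ) : Fun fun (_ : List Λ) (_ : V → ℕ) => n := by
  induction n with
  | zero => exact (small _).and (Definable.zero _)
  | succ n ih =>
    refine ih.add ((ex (P := fun _ (ρ : Option V → ℕ) z => z = 0 ∧ ρ none = z + 1)
      ((Definable.zero _).and (succ _ _))).congr fun w ρ _ => ?_)
    constructor
    · rintro ⟨z, -, rfl, h⟩
      exact ⟨by omega, h⟩
    · exact fun h => ⟨0, by omega, rfl, h.2⟩

/-- Repeated addition, as reachability between pairs of a counter and a partial product. -/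
theorem Fun.mul (x y : V) : Fun fun (_ : List Λ) ρ => ρ x * ρ y := by
  have hE : Definable fun (w : List Λ)
      (ρ : Option (Option (Option (Option (Option (Option V))))) → ℕ) =>
      ρ (some none) = ρ (some (some (some none))) + 1 ∧
      (ρ (some (some none)) < w.length + 2 ∧
        ρ (some (some (some (some (some (some y)))))) < w.length + 2 ∧ ρ none < w.length + 2 ∧
        ρ none = ρ (some (some none)) + ρ (some (some (some (some (some (some y))))))) :=
    (succ _ _).and (Definable.add _ _ _)
  refine ((((Definable.zero (some y)).and (Definable.zero none)).or (ex
    (P := fun w (ρ : Option V → ℕ) o => o = 0 ∧ (o < w.length + 2 ∧ o < w.length + 2) ∧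
      ReflTransGen (Restrict (w.length + 2) fun i a i' a' => i' = i + 1 ∧
        (a < w.length + 2 ∧ ρ (some y) < w.length + 2 ∧ a' < w.length + 2 ∧ a' = a + ρ (some y)))
        (o, o) (ρ (some x), ρ none))
    ((Definable.zero _).and (reachable
      (E := fun w ρ i a i' a' => i' = i + 1 ∧
        (a < w.length + 2 ∧ ρ (some (some y)) < w.length + 2 ∧ a' < w.length + 2 ∧
          a' = a + ρ (some (some y)))) hE _ _ _ _)))).and
      (small none)).congr fun w ρ _ => ?_
  beta_reduce
  constructor
  · rintro ⟨⟨h₁, h₂⟩ | ⟨o, -, rfl, -, h⟩, hs⟩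
    · exact ⟨hs, by rw [h₁, h₂, mul_zero]⟩
    · refine ⟨hs, ?_⟩
      generalize ρ (some y) = k at h
      have key : ∀ p, ReflTransGen (Restrict (w.length + 2) fun i a i' a' => i' = i + 1 ∧
          (a < w.length + 2 ∧ k < w.length + 2 ∧ a' < w.length + 2 ∧ a' = a + k)) (0, 0) p →
          p.2 = p.1 * k := by
        intro p hp
        induction hp with
        | refl => simp
        | tail _ h ih =>
          obtain ⟨-, h₁, -, -, -, h₂⟩ := h
          rw [h₂, h₁, ih]; ring
      exact key _ h
  · rintro ⟨hs, h⟩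
    refine ⟨?_, hs⟩
    -- A zero factor `ρ (some y)` needs its own case: the product is then small even if `ρ (some x)`
    -- is too large for the counter. Otherwise the counter never exceeds the partial product.
    rcases Nat.eq_zero_or_pos (ρ (some y)) with h0 | h0
    · exact .inl ⟨h0, by rw [h, h0, mul_zero]⟩
    · refine .inr ⟨0, by omega, rfl, ⟨by omega, by omega⟩, ?_⟩
      rw [h] at hs ⊢
      generalize ρ (some y) = k at *
      generalize ρ (some x) = n at *
      clear h
      induction n with
      | zero => simpa using ReflTransGen.refl
      | succ n ih =>
        have e : (n + 1) * k = n * k + k := by ring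
        have hn : n ≤ n * k := Nat.le_mul_of_pos_right n h0
        rw [e] at hs ⊢
        refine (ih (by omega)).tail ⟨?_, rfl, ?_⟩
        · simp only; omega
        · exact ⟨by simp only; omega, by omega, hs, rfl⟩

theorem letter_none (x : V) : Checkable fun (w : List Λ) ρ => w[ρ x]? = none := by
  -- Here `z` is `w.length + 1`, and the condition says that it is at most `ρ x + 1`.
  refine (Checkable.ex (P := fun w ρ z => w.length + 2 = z + 1 ∧ (z ≤ ρ x ∨ z = ρ x + 1))
    ((succ_eq_size _).and ((Checkable.le _ _).or (.succ _ _)))).congr fun w ρ _ => ?_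
  rw [List.getElem?_eq_none_iff]
  have := add_two_lt_regBound w.length
  constructor
  · rintro ⟨z, -, h₁, h₂⟩; omega
  · exact fun h => ⟨w.length + 1, by omega, rfl, by omega⟩

theorem letter_some (x : V) (c : Λ) : Checkable fun (w : List Λ) ρ => w[ρ x]? = some c := by
  refine (Checkable.ex (P := fun w ρ z => z = ρ x + 1 ∧ z ≤ w.length + 1 ∧
    NTM.scan w z = .letter c) ((Checkable.succ _ _).and (.scan _ _))).congr fun w ρ _ => ?_
  have hs : NTM.scan w (ρ x + 1) = .letter c ↔ w[ρ x]? = some c := by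
    simp only [NTM.scan, Nat.add_eq_zero_iff, one_ne_zero, and_false, if_false,
      Nat.add_sub_cancel]
    cases w[ρ x]? <;> simp
  rw [← hs]
  constructor
  · rintro ⟨z, -, rfl, -, h⟩; exact h
  · intro h
    have := (List.getElem?_eq_some_iff.1 (hs.1 h)).1
    have := add_two_lt_regBound w.length
    exact ⟨_, by omega, rfl, by omega, h⟩

/-- Over a finite alphabet, the absence of a letter is positive information: another letter is
present, or the position is beyond the word. -/
theorem letter (x : V) (c : Letter) : Definable fun (w : List Letter) ρ => w[ρ x]? = some c := by
  refine ⟨letter_some x c, ((letter_none x).or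
    (((letter_some x .zero).and (const (Letter.zero ≠ c) x)).or
    (((letter_some x .one).and (const (Letter.one ≠ c) x)).or
    ((letter_some x .sep).and (const (Letter.sep ≠ c) x))))).congr fun w ρ _ => ?_⟩
  rcases w[ρ x]? with _ | c'
  · simp
  · cases c' <;> simp

end Definable
end Noninterference

namespace Noninterference

open Relation

/-! ### Words as sequences of blocks -/

/-- The block with number `j` begins at the position `x`. -/
inductive BlockStart (w : List Letter) : ℕ → ℕ → Prop
  | zero : BlockStart w 0 0
  | succ {j x y : ℕ} : BlockStart w j x → x ≤ y → w[y]? = some .sep →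
      (∀ z, x ≤ z → z < y → w[z]? ≠ some .sep) → BlockStart w (j + 1) (y + 1)

/-- The entry with number `i` of the block with number `j` is `c`. The separator counts as an
entry. -/
def Entry (w : List Letter) (j i : ℕ) (c : Letter) : Prop :=
  ∃ x, BlockStart w j x ∧ w[x + i]? = some c ∧ ∀ z, x ≤ z → z < x + i → w[z]? ≠ some .sep

theorem BlockStart.le {w : List Letter} {j x : ℕ} (h : BlockStart w j x) :
    j ≤ x ∧ x ≤ w.length := by
  induction h with
  | zero => exact ⟨le_rfl, Nat.zero_le _⟩
  | succ _ h₁ h₂ _ ih =>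
    have := (List.getElem?_eq_some_iff.1 h₂).1
    omega

theorem Entry.lt {w : List Letter} {j i : ℕ} {c : Letter} (h : Entry w j i c) :
    j < w.length + 2 ∧ i < w.length + 2 := by
  obtain ⟨x, h₁, h₂, -⟩ := h
  have := h₁.le
  have := (List.getElem?_eq_some_iff.1 h₂).1
  omega

section Join

/-- The word that consists of the given blocks. -/
def joinBlocks (bs : List (List Letter)) : List Letter := bs.flatMap fun b => b ++ [.sep]

/-- No block contains a separator. -/
def SepFree (bs : List (List Letter)) : Prop := ∀ b ∈ bs, Letter.sep ∉ b

theorem joinBlocks_append (bs cs : List (List Letter)) :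
    joinBlocks (bs ++ cs) = joinBlocks bs ++ joinBlocks cs := List.flatMap_append

variable {bs : List (List Letter)}

theorem getElem?_joinBlocks {j : ℕ} {b : List Letter} (hj : bs[j]? = some b) :
    ∃ rest, ∀ i, (joinBlocks bs)[(joinBlocks (bs.take j)).length + i]? =
      (b ++ .sep :: rest)[i]? := by
  refine ⟨joinBlocks (bs.drop (j + 1)), fun i => ?_⟩
  obtain ⟨hlt, hb⟩ := List.getElem?_eq_some_iff.1 hj
  have e : bs = bs.take j ++ (b :: bs.drop (j + 1)) := by
    rw [← hb, List.cons_getElem_drop_succ, List.take_append_drop]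
  conv_lhs => rw [e]
  rw [joinBlocks_append, List.take_left' (by simp; omega), List.getElem?_append_right (by omega),
    Nat.add_sub_cancel_left]
  simp [joinBlocks]

theorem length_joinBlocks_take_succ {j : ℕ} {b : List Letter} (hj : bs[j]? = some b) :
    (joinBlocks (bs.take (j + 1))).length = (joinBlocks (bs.take j)).length + b.length + 1 := by
  obtain ⟨hlt, hb⟩ := List.getElem?_eq_some_iff.1 hj
  rw [List.take_succ_eq_append_getElem hlt, joinBlocks_append, hb]
  simp [joinBlocks]
  omega

theorem noSep_iff (hbs : SepFree bs) {j : ℕ} {b : List Letter} (hj : bs[j]? = some b) {i : ℕ} :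
    (∀ z, (joinBlocks (bs.take j)).length ≤ z → z < (joinBlocks (bs.take j)).length + i →
      (joinBlocks bs)[z]? ≠ some .sep) ↔ i ≤ b.length := by
  obtain ⟨rest, hr⟩ := getElem?_joinBlocks hj
  constructor
  · intro h
    by_contra! hi
    refine h ((joinBlocks (bs.take j)).length + b.length) (by omega) (by omega) ?_
    rw [hr]
    simp
  · intro hi z h₁ h₂ hz
    obtain ⟨k, rfl⟩ := Nat.exists_eq_add_of_le h₁
    rw [hr, List.getElem?_append_left (by omega)] at hz
    exact hbs b (List.mem_of_getElem? hj) (List.mem_of_getElem? hz)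

theorem blockStart_joinBlocks_iff (hbs : SepFree bs) {j x : ℕ} :
    BlockStart (joinBlocks bs) j x ↔ j ≤ bs.length ∧ x = (joinBlocks (bs.take j)).length := by
  constructor
  · intro h
    induction h with
    | zero => exact ⟨Nat.zero_le _, rfl⟩
    | @succ j x y _ h₁ h₂ h₃ ih =>
      obtain ⟨hj, rfl⟩ := ih
      have hlt : j < bs.length := by
        by_contra hn
        rw [List.take_of_length_le (by omega)] at h₁
        have := (List.getElem?_eq_some_iff.1 h₂).1
        omega
      have hjb : bs[j]? = some bs[j] := List.getElem?_eq_getElem hlt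
      obtain ⟨i, rfl⟩ := Nat.exists_eq_add_of_le h₁
      have hi := (noSep_iff hbs hjb).1 h₃
      obtain ⟨rest, hr⟩ := getElem?_joinBlocks hjb
      have hi' : i = bs[j].length := by
        refine le_antisymm hi ?_
        by_contra! hlt'
        rw [hr, List.getElem?_append_left hlt'] at h₂
        exact hbs _ (List.getElem_mem hlt) (List.mem_of_getElem? h₂)
      exact ⟨hlt, by rw [length_joinBlocks_take_succ hjb, hi']⟩
  · rintro ⟨hj, rfl⟩
    induction j with
    | zero => simpa [joinBlocks] using BlockStart.zero
    | succ j ih =>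
      have hjb : bs[j]? = some bs[j] := List.getElem?_eq_getElem (by omega)
      rw [length_joinBlocks_take_succ hjb]
      obtain ⟨rest, hr⟩ := getElem?_joinBlocks hjb
      refine .succ (ih (by omega)) (by omega) ?_ ((noSep_iff hbs hjb).2 le_rfl)
      rw [hr]
      simp

theorem entry_joinBlocks_iff (hbs : SepFree bs) {j i : ℕ} {c : Letter} :
    Entry (joinBlocks bs) j i c ↔ ∃ b, bs[j]? = some b ∧ (b ++ [.sep])[i]? = some c := by
  constructor
  · rintro ⟨x, h₁, h₂, h₃⟩
    obtain ⟨hj, rfl⟩ := (blockStart_joinBlocks_iff hbs).1 h₁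
    have hlt : j < bs.length := by
      by_contra hn
      rw [List.take_of_length_le (by omega)] at h₂
      have := (List.getElem?_eq_some_iff.1 h₂).1
      omega
    have hjb : bs[j]? = some bs[j] := List.getElem?_eq_getElem hlt
    have hi := (noSep_iff hbs hjb).1 h₃
    obtain ⟨rest, hr⟩ := getElem?_joinBlocks hjb
    refine ⟨_, hjb, ?_⟩
    rw [hr] at h₂
    rw [← h₂]
    rcases hi.lt_or_eq with h | rfl
    · rw [List.getElem?_append_left h, List.getElem?_append_left h]
    · simp
  · rintro ⟨b, hjb, hc⟩
    have hlt := (List.getElem?_eq_some_iff.1 hjb).1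
    have hi := (List.getElem?_eq_some_iff.1 hc).1
    obtain ⟨rest, hr⟩ := getElem?_joinBlocks hjb
    refine ⟨_, (blockStart_joinBlocks_iff hbs).2 ⟨hlt.le, rfl⟩, ?_,
      (noSep_iff hbs hjb).2 (by simpa [Nat.lt_succ_iff] using hi)⟩
    rw [hr, ← hc]
    simp only [List.length_append, List.length_singleton] at hi
    rcases (Nat.lt_succ_iff.1 hi).lt_or_eq with h | rfl
    · rw [List.getElem?_append_left h, List.getElem?_append_left h]
    · simp

/-- Any prefix that ends where a block begins can be cut into blocks. Applied to the whole word,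
this recovers blocks from a word not known to be an encoding. -/
theorem BlockStart.exists_joinBlocks {w : List Letter} {j x : ℕ} (h : BlockStart w j x) :
    ∃ bs, SepFree bs ∧ bs.length = j ∧ w.take x = joinBlocks bs := by
  induction h with
  | zero => exact ⟨[], by simp [SepFree], rfl, by simp [joinBlocks]⟩
  | @succ j x y h h₁ h₂ h₃ ih =>
    obtain ⟨bs, hbs, hl, hw⟩ := ih
    obtain ⟨hy, hy'⟩ := List.getElem?_eq_some_iff.1 h₂
    refine ⟨bs ++ [(w.take y).drop x], ?_, by simp [hl], ?_⟩
    · intro b hb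
      rcases List.mem_append.1 hb with hb | hb
      · exact hbs b hb
      · rw [List.mem_singleton] at hb
        subst hb
        intro hmem
        obtain ⟨i, hi, hi'⟩ := List.mem_iff_getElem.1 hmem
        rw [List.length_drop, List.length_take] at hi
        refine h₃ (x + i) (by omega) (by omega) ?_
        rw [List.getElem_drop, List.getElem_take] at hi'
        rw [← hi']
        exact List.getElem?_eq_getElem _
    · rw [joinBlocks_append, ← hw, List.take_succ_eq_append_getElem hy, hy']
      have : w.take x ++ (w.take y).drop x = w.take y := by
        conv_rhs => rw [← List.take_append_drop x (w.take y)]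
        rw [List.take_take, min_eq_left h₁]
      conv_lhs => rw [← this]
      simp [joinBlocks]

end Join

namespace Definable

open Checkable (Restrict)

variable {V : Type}

/-- Passing from one block to the next is an edge between pairs of a block number and a position, so
parsing is reachability. -/
theorem blockStart (j x : V) : Definable fun w ρ => BlockStart w (ρ j) (ρ x) := by
  refine (ex (P := fun w ρ o => o = 0 ∧ (o < w.length + 2 ∧ o < w.length + 2) ∧
    ReflTransGen (Restrict (w.length + 2) fun j x j' x' => j' = j + 1 ∧ ∃ y, y < w.length + 2 ∧
      x' = y + 1 ∧ x ≤ y ∧ w[y]? = some Letter.sep ∧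
      ∀ z, z < w.length + 2 → x ≤ z → z < y → ¬ w[z]? = some Letter.sep) (o, o) (ρ j, ρ x))
    ((zero _).and (reachable (E := fun w _ j x j' x' => j' = j + 1 ∧ ∃ y, y < w.length + 2 ∧
      x' = y + 1 ∧ x ≤ y ∧ w[y]? = some Letter.sep ∧
      ∀ z, z < w.length + 2 → x ≤ z → z < y → ¬ w[z]? = some Letter.sep)
      ((succ _ _).and (ex ((succ _ _).and ((le _ _).and ((letter _ _).and
        (all ((le _ _).imp ((lt _ _).imp (letter _ _).not)))))))) _ _ _ _))).congr
    fun w ρ _ => ?_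
  constructor
  · rintro ⟨o, -, rfl, -, h⟩
    generalize hp : (ρ j, ρ x) = p at h
    have key : BlockStart w p.1 p.2 := by
      clear hp
      induction h with
      | refl => exact .zero
      | tail _ h ih =>
        obtain ⟨-, h₁, y, hy, h₂, h₃, h₄, h₅⟩ := h
        rw [h₁, h₂]
        exact .succ ih h₃ h₄ fun z hz hz' => h₅ z (by omega) hz hz'
    rw [← hp] at key
    exact key
  · intro h
    refine ⟨0, by omega, rfl, ⟨by omega, by omega⟩, ?_⟩
    generalize ρ j = j' at *
    generalize ρ x = x' at *
    induction h with
    | zero => exact .refl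
    | succ h h₁ h₂ h₃ ih =>
      have hy := (List.getElem?_eq_some_iff.1 h₂).1
      have hj := h.le
      exact ih.tail ⟨by simp only; omega, rfl, _, by omega, rfl, h₁, h₂, fun z _ => h₃ z⟩

theorem entry_var (j i : V) (c : Letter) : Definable fun w ρ => Entry w (ρ j) (ρ i) c := by
  refine (ex (P := fun w ρ x => ∃ y, y < w.length + 2 ∧ BlockStart w (ρ j) x ∧
    (x < w.length + 2 ∧ ρ i < w.length + 2 ∧ y < w.length + 2 ∧ y = x + ρ i) ∧
    w[y]? = some c ∧ ∀ z, z < w.length + 2 → x ≤ z → z < y → ¬ w[z]? = some Letter.sep)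
    (ex ((blockStart _ _).and ((add _ _ _).and ((letter _ _).and
      (all ((le _ _).imp ((lt _ _).imp (letter _ _).not)))))))).congr fun w ρ _ => ?_
  constructor
  · rintro ⟨x, -, y, hy, h₁, ⟨-, -, -, rfl⟩, h₂, h₃⟩
    exact ⟨x, h₁, h₂, fun z hz hz' => h₃ z (by omega) hz hz'⟩
  · rintro ⟨x, h₁, h₂, h₃⟩
    have := (List.getElem?_eq_some_iff.1 h₂).1
    exact ⟨x, by omega, x + ρ i, by omega, h₁, ⟨by omega, by omega, by omega, rfl⟩, h₂,
      fun z _ => h₃ z⟩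

theorem entry {f : List Letter → (V → ℕ) → ℕ} (hf : Fun f) (i : V) (c : Letter) :
    Definable fun w ρ => Entry w (f w ρ) (ρ i) c :=
  apply (P := fun w ρ j => Entry w j (ρ i) c) (entry_var _ _ _) (fun _ _ _ h => h.lt.1) hf

end Definable

/-- The block with number `j` consists of `v` ones. -/
def Unary (w : List Letter) (j v : ℕ) : Prop :=
  Entry w j v .sep ∧ ∀ i, i < w.length + 2 → i < v → Entry w j i .one

theorem unary_joinBlocks_iff {bs : List (List Letter)} (hbs : SepFree bs) {j v : ℕ} :
    Unary (joinBlocks bs) j v ↔ bs[j]? = some (List.replicate v .one) := by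
  constructor
  · rintro ⟨h₁, h₂⟩
    have hv := h₁.lt.2
    obtain ⟨b, hb, hv'⟩ := (entry_joinBlocks_iff hbs).1 h₁
    have hvl := (List.getElem?_eq_some_iff.1 hv').1
    rw [List.length_append, List.length_singleton] at hvl
    have hlen : v = b.length := by
      by_contra hne
      rw [List.getElem?_append_left (by omega)] at hv'
      exact hbs b (List.mem_of_getElem? hb) (List.mem_of_getElem? hv')
    rw [hb, hlen]
    congr 1
    refine List.ext_getElem (by simp) fun i hi _ => ?_
    obtain ⟨b', hb', hi'⟩ := (entry_joinBlocks_iff hbs).1 (h₂ i (by omega) (by omega))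
    rw [hb] at hb'
    cases hb'
    rw [List.getElem?_append_left hi, List.getElem?_eq_getElem hi] at hi'
    simpa using hi'
  · intro h
    refine ⟨(entry_joinBlocks_iff hbs).2 ⟨_, h, by simp⟩, fun i _ hi =>
      (entry_joinBlocks_iff hbs).2 ⟨_, h, ?_⟩⟩
    rw [List.getElem?_append_left (by simpa using hi)]
    simp [hi]

theorem Definable.unary {V : Type} {f : List Letter → (V → ℕ) → ℕ} (hf : Definable.Fun f) (v : V) :
    Definable fun w ρ => Unary w (f w ρ) (ρ v) :=
  apply (P := fun w ρ j => Unary w j (ρ v))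
    ((entry_var _ _ _).and (all ((lt _ _).imp (entry_var _ _ _)))) (fun _ _ _ h => h.1.lt.1) hf

end Noninterference

namespace Noninterference

open Relation

open Checkable (Restrict)

/-! ### The verification problem as a definable predicate -/

section Tables

theorem length_table {α : Type} {n m : ℕ} (f : Fin n → Fin m → α) :
    ((List.finRange n).flatMap fun s => (List.finRange m).map (f s)).length = n * m := by
  simp [List.length_flatMap]

theorem getElem?_table {α : Type} {n m : ℕ} (f : Fin n → Fin m → α) (s : Fin n) (a : Fin m) :
    ((List.finRange n).flatMap fun s => (List.finRange m).map (f s))[(s : ℕ) * m + a]? =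
      some (f s a) := by
  induction n with
  | zero => exact s.elim0
  | succ n ih =>
    rw [List.finRange_succ, List.flatMap_cons, List.flatMap_map]
    refine Fin.cases ?_ (fun s => ?_) s
    · rw [List.getElem?_append_left (by simp)]
      simp
    · have e : (s.succ : ℕ) * m + a = m + (s * m + a) := by rw [Fin.val_succ]; ring
      rw [e, List.getElem?_append_right (by simp), List.length_map, List.length_finRange,
        Nat.add_sub_cancel_left]
      exact ih (fun s => f s.succ) s

/-- The number of the block that describes the step from the state `s` with the action `a`. -/
def stepIdx (m s a : ℕ) : ℕ := 4 + m + (s * m + a)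

/-- The number of the block that describes the observation of the agent `u` in the state `s`. -/
def obsIdx (n m d s u : ℕ) : ℕ := 4 + m + n * m + (s * d + u)

/-- The number of the block that describes the agents with which `u` may interfere. -/
def polIdx (n m d u : ℕ) : ℕ := 4 + m + n * m + n * d + u

variable {n m d : ℕ}

/-- `bs` are the blocks of the description of `M` with the policy `pol`. -/
structure Describes (bs : List (List Letter)) (M : System (Fin n) (Fin m) (Fin d) (List Bool))
    (pol : Fin d → Fin d → Bool) : Prop where
  length : bs.length = polIdx n m d d
  states : bs[0]? = some (List.replicate n .one)
  actions : bs[1]? = some (List.replicate m .one)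
  agents : bs[2]? = some (List.replicate d .one)
  start : bs[3]? = some (List.replicate M.start .one)
  dom : ∀ a : Fin m, bs[4 + (a : ℕ)]? = some (List.replicate (M.dom a) .one)
  step : ∀ (s : Fin n) (a : Fin m), bs[stepIdx m s a]? = some (List.replicate (M.step s a) .one)
  obs : ∀ (s : Fin n) (u : Fin d), bs[obsIdx n m d s u]? = some ((M.obs s u).map encodeBool)
  pol : ∀ u : Fin d, bs[polIdx n m d u]? =
    some (((List.finRange d).map (pol u)).map encodeBool)

variable (M : System (Fin n) (Fin m) (Fin d) (List Bool)) (pol : Fin d → Fin d → Bool)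

/-- The blocks of the description of `M` with the policy `pol`. -/
def blocksOf : List (List Letter) :=
  [List.replicate n .one, List.replicate m .one, List.replicate d .one,
    List.replicate M.start .one] ++
  ((List.finRange m).map (fun a => List.replicate (M.dom a) .one) ++
  ((List.finRange n).flatMap (fun s =>
    (List.finRange m).map fun a => List.replicate (M.step s a) .one) ++
  ((List.finRange n).flatMap (fun s =>
    (List.finRange d).map fun u => (M.obs s u).map encodeBool) ++
  (List.finRange d).map (fun u => ((List.finRange d).map (pol u)).map encodeBool))))

theorem encode_eq_joinBlocks : encode M pol = joinBlocks (blocksOf M pol) := by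
  simp [encode, blocksOf, joinBlocks, encodeNat, encodeBits, List.flatMap_map,
    List.flatMap_assoc, Function.comp_def]

theorem getElem?_append_of_length {α : Type} {l₁ l₂ : List α} {k : ℕ} (h : l₁.length = k)
    (i : ℕ) : (l₁ ++ l₂)[k + i]? = l₂[i]? := by
  rw [← h, List.getElem?_append_right (by omega), Nat.add_sub_cancel_left]

theorem describes_blocksOf : Describes (blocksOf M pol) M pol where
  length := by
    simp only [blocksOf, List.length_append, length_table, List.length_map, List.length_finRange,
      List.length_cons, List.length_nil, polIdx]
    omega
  states := rfl
  actions := rfl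
  agents := rfl
  start := rfl
  dom a := by
    rw [blocksOf, getElem?_append_of_length (k := 4) rfl, List.getElem?_append_left (by simp)]
    simp
  step s a := by
    have h : (s : ℕ) * m + a < n * m :=
      calc (s : ℕ) * m + a < s * m + m := by omega
        _ = (s + 1) * m := by ring
        _ ≤ n * m := Nat.mul_le_mul_right _ s.2
    rw [blocksOf, stepIdx, add_assoc, getElem?_append_of_length (k := 4) rfl,
      getElem?_append_of_length (by simp), List.getElem?_append_left (by rwa [length_table]),
      getElem?_table]
  obs s u := by
    have h : (s : ℕ) * d + u < n * d :=
      calc (s : ℕ) * d + u < s * d + d := by omega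
        _ = (s + 1) * d := by ring
        _ ≤ n * d := Nat.mul_le_mul_right _ s.2
    rw [blocksOf, obsIdx, add_assoc, add_assoc, getElem?_append_of_length (k := 4) rfl,
      getElem?_append_of_length (by simp), getElem?_append_of_length (length_table _),
      List.getElem?_append_left (by rwa [length_table]), getElem?_table]
  pol u := by
    rw [blocksOf, polIdx, add_assoc, add_assoc, add_assoc, getElem?_append_of_length (k := 4) rfl,
      getElem?_append_of_length (by simp), getElem?_append_of_length (length_table _),
      getElem?_append_of_length (length_table _)]
    simp

variable {M pol}

/-- The index ranges of the tables exhaust all block numbers and do not leave gaps. This is what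
identifies a well-formed word with the encoding of the system that is read off from it. -/
theorem Describes.unique {bs bs' : List (List Letter)} (h : Describes bs M pol)
    (h' : Describes bs' M pol) : bs = bs' := by
  have split : ∀ {k p q : ℕ}, k < p * q → ∃ (s : Fin p) (a : Fin q), k = s * q + a := by
    intro k p q hk
    have hq : 0 < q := Nat.pos_of_ne_zero fun h0 => by simp [h0] at hk
    refine ⟨⟨k / q, Nat.div_lt_of_lt_mul (by rwa [mul_comm])⟩, ⟨k % q, Nat.mod_lt _ hq⟩, ?_⟩
    rw [mul_comm]
    exact (Nat.div_add_mod k q).symm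
  refine List.ext_getElem? fun i => ?_
  by_cases h0 : i < 4
  · interval_cases i
    exacts [h.states.trans h'.states.symm, h.actions.trans h'.actions.symm,
      h.agents.trans h'.agents.symm, h.start.trans h'.start.symm]
  obtain ⟨i, rfl⟩ := Nat.exists_eq_add_of_le (not_lt.1 h0)
  by_cases h1 : i < m
  · exact (h.dom ⟨i, h1⟩).trans (h'.dom ⟨i, h1⟩).symm
  obtain ⟨i, rfl⟩ := Nat.exists_eq_add_of_le (not_lt.1 h1)
  by_cases h2 : i < n * m
  · obtain ⟨s, a, rfl⟩ := split h2
    have e : 4 + (m + (s * m + a)) = stepIdx m s a := by rw [stepIdx, add_assoc]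
    rw [e, h.step, h'.step]
  obtain ⟨i, rfl⟩ := Nat.exists_eq_add_of_le (not_lt.1 h2)
  by_cases h3 : i < n * d
  · obtain ⟨s, u, rfl⟩ := split h3
    have e : 4 + (m + (n * m + (s * d + u))) = obsIdx n m d s u := by rw [obsIdx]; omega
    rw [e, h.obs, h'.obs]
  obtain ⟨i, rfl⟩ := Nat.exists_eq_add_of_le (not_lt.1 h3)
  have e : 4 + (m + (n * m + (n * d + i))) = polIdx n m d i := by rw [polIdx]; omega
  rw [e]
  by_cases h4 : i < d
  · exact (h.pol ⟨i, h4⟩).trans (h'.pol ⟨i, h4⟩).symm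
  · have l : polIdx n m d d ≤ polIdx n m d i := by simp only [polIdx]; omega
    rw [List.getElem?_eq_none (by rw [h.length]; exact l),
      List.getElem?_eq_none (by rw [h'.length]; exact l)]

theorem encodeBool_ne_sep (b : Bool) : encodeBool b ≠ .sep := by cases b <;> simp [encodeBool]

theorem sepFree_blocksOf : SepFree (blocksOf M pol) := by
  intro b hb
  have h₁ : ∀ k, Letter.sep ∉ List.replicate k Letter.one := fun k => by simp
  have h₂ : ∀ l : List Bool, Letter.sep ∉ l.map encodeBool := fun l hl => by
    obtain ⟨b, -, h⟩ := List.mem_map.1 hl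
    exact encodeBool_ne_sep b h
  simp only [blocksOf, List.mem_append, List.mem_cons, List.mem_flatMap, List.mem_map,
    List.not_mem_nil, or_false] at hb
  rcases hb with (rfl | rfl | rfl | rfl) | ⟨a, -, rfl⟩ | ⟨s, -, a, -, rfl⟩ | ⟨s, -, u, -, rfl⟩ |
    ⟨u, -, rfl⟩
  exacts [h₁ _, h₁ _, h₁ _, h₁ _, h₁ _, h₁ _, h₂ _, h₂ _]

end Tables

section Formula

variable (w : List Letter) (n m d : ℕ)

/-- `w` describes a system with `n` states, `m` actions and `d` agents and a reflexive policy. -/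
def WellFormed (st : ℕ) : Prop :=
  (Unary w 0 n ∧ Unary w 1 m ∧ Unary w 2 d ∧ Unary w 3 st ∧ st < n) ∧
  BlockStart w (polIdx n m d d) w.length ∧
  (∀ a, a < w.length + 2 → a < m → ∃ v, v < w.length + 2 ∧ v < d ∧ Unary w (4 + a) v) ∧
  (∀ s, s < w.length + 2 → s < n → ∀ a, a < w.length + 2 → a < m →
    ∃ t, t < w.length + 2 ∧ t < n ∧ Unary w (stepIdx m s a) t) ∧
  (∀ u, u < w.length + 2 → u < d →
    Entry w (polIdx n m d u) d .sep ∧ Entry w (polIdx n m d u) u .one)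

/-- An action of an agent with which `v` may not interfere leads from the states `x` and `y` to
the states `x'` and `y'`. -/
def PairStep (v x y x' y' : ℕ) : Prop :=
  ∃ b, b < w.length + 2 ∧ b < m ∧ (∃ u, u < w.length + 2 ∧ Unary w (4 + b) u ∧
    ¬ Entry w (polIdx n m d v) u .one) ∧
    Unary w (stepIdx m x b) x' ∧ Unary w (stepIdx m y b) y'

/-- The blocks `j` and `j'` have the same letters. -/
def SameBlock (j j' : ℕ) : Prop :=
  ∀ i, i < w.length + 2 → (Entry w j i .zero ↔ Entry w j' i .zero) ∧
    (Entry w j i .one ↔ Entry w j' i .one)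

/-- The system described by `w` is locally secure. -/
def SecureDescription : Prop :=
  ∀ s, s < w.length + 2 → s < n → ∀ a, a < w.length + 2 → a < m →
  ∀ u, u < w.length + 2 → u < d → ∀ v, v < w.length + 2 → Unary w (4 + a) v →
    ¬ Entry w (polIdx n m d v) u .one → ∀ t, t < w.length + 2 → Unary w (stepIdx m s a) t →
  ∀ s', s' < w.length + 2 → ∀ t', t' < w.length + 2 →
    ((s < w.length + 2 ∧ t < w.length + 2) ∧
      ReflTransGen (Restrict (w.length + 2) (PairStep w n m d v)) (s, t) (s', t')) →
    SameBlock w (obsIdx n m d s' u) (obsIdx n m d t' u)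

end Formula

namespace Definable

variable {V : Type}

theorem Fun.stepIdx (m s a : V) :
    Fun fun (_ : List Letter) ρ => stepIdx (ρ m) (ρ s) (ρ a) :=
  ((Fun.const 4).add (.var m)).add ((Fun.mul s m).add (.var a))

theorem Fun.obsIdx (n m d s u : V) :
    Fun fun (_ : List Letter) ρ => obsIdx (ρ n) (ρ m) (ρ d) (ρ s) (ρ u) :=
  (((Fun.const 4).add (.var m)).add (.mul n m)).add ((Fun.mul s d).add (.var u))

theorem Fun.polIdx (n m d u : V) :
    Fun fun (_ : List Letter) ρ => polIdx (ρ n) (ρ m) (ρ d) (ρ u) :=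
  ((((Fun.const 4).add (.var m)).add (.mul n m)).add (.mul n d)).add (.var u)

theorem Fun.domIdx (a : V) : Fun fun (_ : List Letter) ρ => 4 + ρ a := (Fun.const 4).add (.var a)

theorem wellFormed (n m d st : V) :
    Definable fun w ρ => WellFormed w (ρ n) (ρ m) (ρ d) (ρ st) := by
  have hend : Definable fun w ρ => BlockStart w (polIdx (ρ n) (ρ m) (ρ d) (ρ d)) w.length := by
    -- The length of `w` is described as the start of a block at which no letter stands.
    refine (ex (P := fun w ρ x => BlockStart w (Noninterference.polIdx (ρ n) (ρ m) (ρ d) (ρ d)) x ∧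
      (¬ w[x]? = some .zero ∧ ¬ w[x]? = some .one ∧ ¬ w[x]? = some .sep))
      ((apply (P := fun w ρ j => BlockStart w j (ρ none)) (blockStart _ _)
        (fun w ρ x h => by have := h.le; omega)
        (Fun.polIdx (some n) (some m) (some d) (some d))).and
        ((letter _ _).not.and ((letter _ _).not.and (letter _ _).not)))).congr fun w ρ _ => ?_
    constructor
    · rintro ⟨x, -, h, h₁, h₂, h₃⟩
      have hx := h.le.2
      obtain hlt | rfl := hx.lt_or_eq
      · rw [List.getElem?_eq_getElem hlt] at h₁ h₂ h₃
        cases hw : w[x] <;> simp [hw] at h₁ h₂ h₃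
      · exact h
    · intro h
      exact ⟨_, by omega, h, by simp, by simp, by simp⟩
  exact ((unary (.const 0) _).and ((unary (.const 1) _).and ((unary (.const 2) _).and
    ((unary (.const 3) _).and (lt _ _))))).and (hend.and
    ((all ((lt _ _).imp (ex ((lt _ _).and (unary (.domIdx _) _))))).and
    ((all ((lt _ _).imp (all ((lt _ _).imp (ex ((lt _ _).and (unary (.stepIdx _ _ _) _))))))).and
    (all ((lt _ _).imp ((entry (.polIdx _ _ _ _) _ _).and (entry (.polIdx _ _ _ _) _ _)))))))

theorem pairStep (n m d v x y x' y' : V) :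
    Definable fun w ρ => PairStep w (ρ n) (ρ m) (ρ d) (ρ v) (ρ x) (ρ y) (ρ x') (ρ y') :=
  ex ((lt _ _).and ((ex ((unary (.domIdx _) _).and (entry (.polIdx _ _ _ _) _ _).not)).and
    ((unary (.stepIdx _ _ _) _).and (unary (.stepIdx _ _ _) _))))

/-- Reachability occurs as the premise of an implication, under universal quantifiers. Its negation
has to be checked here, and this is the use made of inductive counting. -/
theorem secureDescription (n m d : V) :
    Definable fun w ρ => SecureDescription w (ρ n) (ρ m) (ρ d) :=
  all ((lt _ _).imp (all ((lt _ _).imp (all ((lt _ _).imp (all ((unary (.domIdx _) _).imp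
    ((entry (.polIdx _ _ _ _) _ _).not.imp (all ((unary (.stepIdx _ _ _) _).imp (all (all
      ((reachable (pairStep _ _ _ _ _ _ _ _) _ _ _ _).imp
        (all (((entry (.obsIdx _ _ _ _ _) _ _).iff (entry (.obsIdx _ _ _ _ _) _ _)).and
          ((entry (.obsIdx _ _ _ _ _) _ _).iff (entry (.obsIdx _ _ _ _ _) _ _)))))))))))))))))

end Definable

end Noninterference

/-! ### Correctness of the formula for encoded systems -/

namespace Noninterference

open Relation

open Checkable (Restrict)

namespace Describes

variable {n m d : ℕ} {bs : List (List Letter)} {M : System (Fin n) (Fin m) (Fin d) (List Bool)}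
  {pol : Fin d → Fin d → Bool}

theorem unary_dom (h : Describes bs M pol) (hbs : SepFree bs) (a : Fin m) {v : ℕ} :
    Unary (joinBlocks bs) (4 + a) v ↔ v = M.dom a := by
  rw [unary_joinBlocks_iff hbs, h.dom]
  simp [eq_comm]

theorem unary_step (h : Describes bs M pol) (hbs : SepFree bs) (s : Fin n) (a : Fin m) {t : ℕ} :
    Unary (joinBlocks bs) (stepIdx m s a) t ↔ t = M.step s a := by
  rw [unary_joinBlocks_iff hbs, h.step]
  simp [eq_comm]

theorem entry_pol (h : Describes bs M pol) (hbs : SepFree bs) (u v : Fin d) :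
    Entry (joinBlocks bs) (polIdx n m d u) v .one ↔ pol u v = true := by
  rw [entry_joinBlocks_iff hbs, h.pol]
  simp only [Option.some.injEq, exists_eq_left']
  rw [List.getElem?_append_left (by simp)]
  cases hp : pol u v <;> simp [encodeBool, hp]

theorem sameBlock_obs (h : Describes bs M pol) (hbs : SepFree bs) (s t : Fin n) (u : Fin d) :
    SameBlock (joinBlocks bs) (obsIdx n m d s u) (obsIdx n m d t u) ↔ M.obs s u = M.obs t u := by
  have key : ∀ (s : Fin n) (i : ℕ) (b : Bool),
      Entry (joinBlocks bs) (obsIdx n m d s u) i (encodeBool b) ↔ (M.obs s u)[i]? = some b := by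
    intro s i b
    rw [entry_joinBlocks_iff hbs, h.obs]
    simp only [Option.some.injEq, exists_eq_left']
    rcases Nat.lt_or_ge i (M.obs s u).length with hi | hi
    · rw [List.getElem?_append_left (by simpa using hi), List.getElem?_map,
        List.getElem?_eq_getElem hi]
      cases b <;> cases (M.obs s u)[i] <;> simp [encodeBool]
    · rw [List.getElem?_append_right (by simpa using hi), List.getElem?_eq_none hi]
      simp only [reduceCtorEq, iff_false]
      intro h'
      have := List.mem_of_getElem? h'
      rw [List.mem_singleton] at this
      exact encodeBool_ne_sep b this
  constructor
  · intro hsame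
    have both : ∀ (i : ℕ) (b : Bool), (M.obs s u)[i]? = some b ↔ (M.obs t u)[i]? = some b := by
      intro i b
      rw [← key, ← key]
      by_cases hi : i < (joinBlocks bs).length + 2
      · cases b
        exacts [(hsame i hi).1, (hsame i hi).2]
      -- Beyond the range of the quantifier in `SameBlock` neither block has an entry.
      · exact ⟨fun h => absurd h.lt.2 hi, fun h => absurd h.lt.2 hi⟩
    exact List.ext_getElem? fun i => Option.ext fun b => by simpa using both i b
  · intro e i _
    have key₀ := fun s => key s i false
    have key₁ := fun s => key s i true
    simp only [encodeBool, Bool.false_eq_true, if_false, if_true] at key₀ key₁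
    rw [key₀, key₀, key₁, key₁, e]
    exact ⟨Iff.rfl, Iff.rfl⟩

theorem wellFormed (h : Describes bs M pol) (hbs : SepFree bs) (hrefl : ∀ u, pol u u = true) :
    WellFormed (joinBlocks bs) n m d M.start := by
  refine ⟨⟨(unary_joinBlocks_iff hbs).2 h.states, (unary_joinBlocks_iff hbs).2 h.actions,
    (unary_joinBlocks_iff hbs).2 h.agents, (unary_joinBlocks_iff hbs).2 h.start, M.start.2⟩, ?_,
    fun a _ ha => ?_, fun s _ hs a _ ha => ?_, fun u _ hu => ⟨?_, ?_⟩⟩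
  · rw [blockStart_joinBlocks_iff hbs, ← h.length, List.take_length]
    exact ⟨le_rfl, rfl⟩
  · have := (h.unary_dom hbs ⟨a, ha⟩).2 rfl
    exact ⟨_, this.1.lt.2, Fin.is_lt _, this⟩
  · have := (h.unary_step hbs ⟨s, hs⟩ ⟨a, ha⟩).2 rfl
    exact ⟨_, this.1.lt.2, Fin.is_lt _, this⟩
  · exact (entry_joinBlocks_iff hbs).2 ⟨_, h.pol ⟨u, hu⟩, by simp⟩
  · exact (h.entry_pol hbs ⟨u, hu⟩ ⟨u, hu⟩).2 (hrefl _)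

/-- The action `b` may be performed without the agent `v` interfering. -/
theorem pairStep_iff (h : Describes bs M pol) (hbs : SepFree bs) (v : Fin d) (x y : Fin n)
    {x' y' : ℕ} : PairStep (joinBlocks bs) n m d v x y x' y' ↔
      ∃ b : Fin m, ¬ pol v (M.dom b) = true ∧ x' = M.step x b ∧ y' = M.step y b := by
  constructor
  · rintro ⟨b, -, hb, ⟨u, -, hu, hp⟩, hx, hy⟩
    obtain rfl := (h.unary_dom hbs ⟨b, hb⟩).1 hu
    rw [h.entry_pol hbs] at hp
    exact ⟨⟨b, hb⟩, hp, (h.unary_step hbs _ ⟨b, hb⟩).1 hx, (h.unary_step hbs _ ⟨b, hb⟩).1 hy⟩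
  · rintro ⟨b, hp, rfl, rfl⟩
    have hd := (h.unary_dom hbs b).2 rfl
    have hb : (b : ℕ) < (joinBlocks bs).length + 2 := by
      have := hd.1.lt.1
      omega
    refine ⟨b, hb, b.2, ⟨_, hd.1.lt.2, hd, ?_⟩, (h.unary_step hbs _ _).2 rfl,
      (h.unary_step hbs _ _).2 rfl⟩
    rwa [h.entry_pol hbs]

/-- Paths from `(s, s · a)` in the pair graph correspond to words `γ` performed from both states,
with exactly the restriction on agents that occurs in local security. -/
theorem secureDescription_iff (h : Describes bs M pol) (hbs : SepFree bs) :
    SecureDescription (joinBlocks bs) n m d ↔ M.LocallySecure fun u v => pol u v = true := by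
  have hn : n < (joinBlocks bs).length + 2 := ((unary_joinBlocks_iff hbs).2 h.states).1.lt.2
  have hm : m < (joinBlocks bs).length + 2 := ((unary_joinBlocks_iff hbs).2 h.actions).1.lt.2
  have hd : d < (joinBlocks bs).length + 2 := ((unary_joinBlocks_iff hbs).2 h.agents).1.lt.2
  constructor
  · intro hsec s a u hau γ hγ
    have reach : ∀ (γ : List (Fin m)), (∀ b ∈ γ, ¬ pol (M.dom a) (M.dom b) = true) →
        ∀ x y : Fin n, ReflTransGen (Restrict ((joinBlocks bs).length + 2)
          (PairStep (joinBlocks bs) n m d (M.dom a))) ((x : ℕ), (y : ℕ))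
          ((M.run x γ : ℕ), (M.run y γ : ℕ)) := by
      intro γ
      induction γ with
      | nil => exact fun _ _ _ => .refl
      | cons b γ ih =>
        intro hγ x y
        refine .head ⟨⟨x.2.trans hn, y.2.trans hn, (M.step x b).2.trans hn,
          (M.step y b).2.trans hn⟩, ?_⟩ (ih (fun c hc => hγ c (List.mem_cons_of_mem _ hc)) _ _)
        exact (h.pairStep_iff hbs _ x y).2 ⟨b, hγ b List.mem_cons_self, rfl, rfl⟩
    rw [← h.sameBlock_obs hbs]
    refine hsec s (s.2.trans hn) s.2 a (a.2.trans hm) a.2 u (u.2.trans hd) u.2 (M.dom a)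
      ((M.dom a).2.trans hd) ((h.unary_dom hbs a).2 rfl) ?_ (M.step s a)
      ((M.step s a).2.trans hn) ((h.unary_step hbs s a).2 rfl) _ ((M.run s γ).2.trans hn) _
      ((M.run _ γ).2.trans hn) ⟨⟨s.2.trans hn, (M.step s a).2.trans hn⟩, reach γ hγ s _⟩
    rwa [h.entry_pol hbs]
  · intro hloc s _ hs a _ ha u _ hu v _ hv hvu t _ ht s' _ t' _ hr
    obtain rfl := (h.unary_dom hbs ⟨a, ha⟩).1 hv
    obtain rfl := (h.unary_step hbs ⟨s, hs⟩ ⟨a, ha⟩).1 ht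
    have hau := hvu
    rw [h.entry_pol hbs _ ⟨u, hu⟩] at hau
    have key : ∀ p, ReflTransGen (Restrict ((joinBlocks bs).length + 2)
        (PairStep (joinBlocks bs) n m d (M.dom ⟨a, ha⟩)))
        (s, (M.step ⟨s, hs⟩ ⟨a, ha⟩ : ℕ)) p →
        ∃ γ : List (Fin m), (∀ b ∈ γ, ¬ pol (M.dom ⟨a, ha⟩) (M.dom b) = true) ∧
          p = ((M.run ⟨s, hs⟩ γ : ℕ), (M.run (M.step ⟨s, hs⟩ ⟨a, ha⟩) γ : ℕ)) := by
      intro p hp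
      induction hp with
      | refl => exact ⟨[], by simp, rfl⟩
      | tail _ hstep ih =>
        obtain ⟨γ, hγ, rfl⟩ := ih
        obtain ⟨b, hb, h₁, h₂⟩ := (h.pairStep_iff hbs _ _ _).1 hstep.2
        refine ⟨γ ++ [b], ?_, ?_⟩
        · intro c hc
          rcases List.mem_append.1 hc with hc | hc
          · exact hγ c hc
          · rw [List.mem_singleton] at hc
            rwa [hc]
        · refine Prod.ext ?_ ?_
          · rw [h₁]; simp [System.run]
          · rw [h₂]; simp [System.run]
    obtain ⟨γ, hγ, e⟩ := key _ hr.2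
    simp only [Prod.mk.injEq] at e
    obtain ⟨rfl, rfl⟩ := e
    exact (h.sameBlock_obs hbs _ _ ⟨u, hu⟩).2 (hloc ⟨s, hs⟩ ⟨a, ha⟩ ⟨u, hu⟩ hau γ hγ)

end Describes

/-- The system is read off from the blocks: the tables supply `dom` and `step`, and the remaining
blocks are bit strings because they contain no separator. -/
theorem WellFormed.exists_describes {w : List Letter} {n m d st : ℕ}
    (hw : WellFormed w n m d st) :
    ∃ (M : System (Fin n) (Fin m) (Fin d) (List Bool)) (pol : Fin d → Fin d → Bool)
      (bs : List (List Letter)), (∀ u, pol u u = true) ∧ Describes bs M pol ∧ SepFree bs ∧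
        w = joinBlocks bs := by
  obtain ⟨⟨h₀, h₁, h₂, h₃, hst⟩, hend, hdom, hstep, hpol⟩ := hw
  obtain ⟨bs, hbs, hlen, hjoin⟩ := hend.exists_joinBlocks
  rw [List.take_length] at hjoin
  subst hjoin
  have hn := h₀.1.lt.2
  have hm := h₁.1.lt.2
  have hd := h₂.1.lt.2
  have bits : ∀ b ∈ bs, ∃ l : List Bool, b = l.map encodeBool := by
    intro b hb
    refine ⟨b.map fun c => decide (c = .one), ?_⟩
    rw [List.map_map]
    conv_lhs => rw [← List.map_id b]
    refine List.map_congr_left fun c hc => ?_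
    have := hbs b hb
    cases c
    · rfl
    · rfl
    · exact absurd hc this
  choose! f hf using bits
  choose dom hdom₁ hdom₂ hdom₃ using fun a : Fin m => hdom a (a.2.trans hm) a.2
  choose step hstep₁ hstep₂ hstep₃ using fun (s : Fin n) (a : Fin m) =>
    hstep s (s.2.trans hn) s.2 a (a.2.trans hm) a.2
  have hobs : ∀ (s : Fin n) (u : Fin d), ∃ l : List Bool,
      bs[obsIdx n m d s u]? = some (l.map encodeBool) := by
    intro s u
    have hlt : obsIdx n m d s u < bs.length := by
      have : (s : ℕ) * d + u < n * d :=
        calc (s : ℕ) * d + u < s * d + d := by omega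
          _ = (s + 1) * d := by ring
          _ ≤ n * d := Nat.mul_le_mul_right _ s.2
      rw [hlen]
      simp only [obsIdx, polIdx]
      omega
    refine ⟨f bs[obsIdx n m d s u], ?_⟩
    rw [List.getElem?_eq_getElem hlt, ← hf _ (List.getElem_mem hlt)]
  choose obs hobs using hobs
  have hpol' : ∀ u : Fin d, ∃ l : List Bool, l.length = d ∧
      bs[polIdx n m d u]? = some (l.map encodeBool) := by
    intro u
    obtain ⟨b, hb, hb'⟩ := (entry_joinBlocks_iff hbs).1 (hpol u (u.2.trans hd) u.2).1
    have hmem := List.mem_of_getElem? hb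
    -- A block without separators shows its separator only behind its last letter, so the entry at
    -- `d` fixes the length of the row.
    have hbl : b.length = d := by
      have hle := (List.getElem?_eq_some_iff.1 hb').1
      rw [List.length_append, List.length_singleton] at hle
      by_contra hne
      rw [List.getElem?_append_left (by omega)] at hb'
      exact hbs b hmem (List.mem_of_getElem? hb')
    refine ⟨f b, ?_, by rw [hb, ← hf b hmem]⟩
    rw [← hbl]
    conv_rhs => rw [hf b hmem]
    simp
  choose row hrow₁ hrow₂ using hpol'
  have hdesc : Describes bs
      { start := ⟨st, hst⟩
        step := fun s a => ⟨step s a, hstep₂ s a⟩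
        obs := obs
        dom := fun a => ⟨dom a, hdom₂ a⟩ }
      fun u v => (row u)[v]'(by rw [hrow₁]; exact v.2) :=
    { length := hlen
      states := (unary_joinBlocks_iff hbs).1 h₀
      actions := (unary_joinBlocks_iff hbs).1 h₁
      agents := (unary_joinBlocks_iff hbs).1 h₂
      start := (unary_joinBlocks_iff hbs).1 h₃
      dom := fun a => (unary_joinBlocks_iff hbs).1 (hdom₃ a)
      step := fun s a => (unary_joinBlocks_iff hbs).1 (hstep₃ s a)
      obs := hobs
      pol := fun u => by
        rw [hrow₂]
        congr 2
        refine List.ext_getElem (by simp [hrow₁]) fun i _ _ => ?_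
        simp }
  refine ⟨_, _, bs, fun u => ?_, hdesc, hbs, rfl⟩
  exact (hdesc.entry_pol hbs u u).1 (hpol u (u.2.trans hd) u.2).2

theorem mem_ipSecurityProblem_iff (w : List Letter) :
    w ∈ ipSecurityProblem ↔ ∃ n, n < w.length + 2 ∧ ∃ m, m < w.length + 2 ∧
      ∃ d, d < w.length + 2 ∧ ∃ st, st < w.length + 2 ∧
        WellFormed w n m d st ∧ SecureDescription w n m d := by
  constructor
  · rintro ⟨n, m, d, M, pol, hrefl, hsec, rfl⟩
    have h := describes_blocksOf M pol
    have hbs : SepFree (blocksOf M pol) := sepFree_blocksOf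
    have hw := h.wellFormed hbs hrefl
    rw [encode_eq_joinBlocks]
    refine ⟨n, hw.1.1.1.lt.2, m, hw.1.2.1.1.lt.2, d, hw.1.2.2.1.1.lt.2, M.start,
      hw.1.2.2.2.1.1.lt.2, hw, ?_⟩
    rw [h.secureDescription_iff hbs]
    exact (System.ipSecure_iff_locallySecure hrefl).1 hsec
  · rintro ⟨n, -, m, -, d, -, st, -, hw, hsec⟩
    obtain ⟨M, pol, bs, hrefl, h, hbs, rfl⟩ := hw.exists_describes
    refine ⟨n, m, d, M, pol, hrefl, ?_, ?_⟩
    · rw [h.secureDescription_iff hbs] at hsec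
      exact (System.ipSecure_iff_locallySecure hrefl).2 hsec
    · rw [encode_eq_joinBlocks, h.unique (describes_blocksOf M pol)]

theorem definable_ipSecurityProblem :
    Definable fun w (_ : Empty → ℕ) => w ∈ ipSecurityProblem :=
  Definable.congr (.ex (.ex (.ex (.ex ((Definable.wellFormed _ _ _ _).and
    (Definable.secureDescription _ _ _))))))
    fun w _ _ => (mem_ipSecurityProblem_iff w).symm

end Noninterference

namespace Noninterference

open Relation

variable {Λ : Type}

/-! ### Programs as finite automata -/

/-- A finite automaton whose edges are labelled by instructions on the registers below `k`. -/
structure Automaton (Λ : Type) where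
  P : Type
  finiteP : Finite P
  start : P
  accepting : Set P
  k : ℕ
  edge : P → Option (Instr Λ) → P → Prop
  lt_of_edge : ∀ p m i p', edge p (some (.reg m i)) p' → i < k

/-- The steps of an automaton. -/
inductive Automaton.Step (A : Automaton Λ) (w : List Λ) : A.P × Store w → A.P × Store w → Prop
  | silent {p p' : A.P} {s : Store w} : A.edge p none p' → A.Step w (p, s) (p', s)
  | instr {p p' : A.P} {s s' : Store w} {a : Instr Λ} : A.edge p (some a) p' → a.sem w s s' →
      A.Step w (p, s) (p', s')

namespace Prog

/-- The steps between lists of programs that remain to be executed. -/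
inductive Edge : List (Prog Λ) → Option (Instr Λ) → List (Prog Λ) → Prop
  | skip {K} : Edge (skip :: K) none K
  | atom {a K} : Edge (atom a :: K) (some a) K
  | seq {p q K} : Edge (seq p q :: K) none (p :: q :: K)
  | altLeft {p q K} : Edge (alt p q :: K) none (p :: K)
  | altRight {p q K} : Edge (alt p q :: K) none (q :: K)
  | exit {p K} : Edge (star p :: K) none K
  | loop {p K} : Edge (star p :: K) none (p :: star p :: K)

/-- The lists of programs that occur in the execution of `p`, if `K` remains to be executed
afterwards. -/
def continuations : Prog Λ → List (Prog Λ) → Set (List (Prog Λ))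
  | skip, K => {skip :: K}
  | atom a, K => {atom a :: K}
  | seq p q, K => {seq p q :: K} ∪ (continuations p (q :: K) ∪ continuations q K)
  | alt p q, K => {alt p q :: K} ∪ (continuations p K ∪ continuations q K)
  | star p, K => {star p :: K} ∪ continuations p (star p :: K)

/-- The body of `star p` is always followed by the same list `star p :: K`, so unrolling a loop does
not produce ever longer lists. -/
theorem finite_continuations (p : Prog Λ) (K : List (Prog Λ)) : (continuations p K).Finite := by
  induction p generalizing K with
  | skip => exact Set.finite_singleton _
  | atom a => exact Set.finite_singleton _
  | seq p q ihp ihq => exact (Set.finite_singleton _).union ((ihp _).union (ihq _))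
  | alt p q ihp ihq => exact (Set.finite_singleton _).union ((ihp _).union (ihq _))
  | star p ih => exact (Set.finite_singleton _).union (ih _)

theorem mem_continuations (p : Prog Λ) (K : List (Prog Λ)) : p :: K ∈ continuations p K := by
  cases p <;> simp [continuations]

theorem mem_continuations_of_edge {p : Prog Λ} {K k k' : List (Prog Λ)} {o : Option (Instr Λ)}
    (hk : k ∈ continuations p K) (h : Edge k o k') : k' ∈ continuations p K ∨ k' = K := by
  induction p generalizing K with
  | skip =>
    obtain rfl := hk
    cases h
    exact .inr rfl
  | atom a =>
    obtain rfl := hk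
    cases h
    exact .inr rfl
  | seq p q ihp ihq =>
    rcases hk with rfl | hk | hk
    · cases h
      exact .inl (.inr (.inl (mem_continuations _ _)))
    · rcases ihp hk with h | rfl
      · exact .inl (.inr (.inl h))
      · exact .inl (.inr (.inr (mem_continuations _ _)))
    · rcases ihq hk with h | rfl
      · exact .inl (.inr (.inr h))
      · exact .inr rfl
  | alt p q ihp ihq =>
    rcases hk with rfl | hk | hk
    · cases h
      · exact .inl (.inr (.inl (mem_continuations _ _)))
      · exact .inl (.inr (.inr (mem_continuations _ _)))
    · rcases ihp hk with h | rfl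
      · exact .inl (.inr (.inl h))
      · exact .inr rfl
    · rcases ihq hk with h | rfl
      · exact .inl (.inr (.inr h))
      · exact .inr rfl
  | star p ih =>
    rcases hk with rfl | hk
    · cases h
      · exact .inr rfl
      · exact .inl (.inr (mem_continuations _ _))
    · rcases ih hk with h | rfl
      · exact .inl (.inr h)
      · exact .inl (.inl rfl)

/-- The lists of programs that occur in the execution of `p`. -/
def control (p : Prog Λ) : Set (List (Prog Λ)) := insert [] (continuations p [])

theorem mem_control_of_edge {p : Prog Λ} {k k' : List (Prog Λ)} {o : Option (Instr Λ)}
    (hk : k ∈ control p) (h : Edge k o k') : k' ∈ control p := by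
  rcases hk with rfl | hk
  · cases h
  · rcases mem_continuations_of_edge hk h with h | rfl
    exacts [.inr h, .inl rfl]

/-- The register used by the first program of a list. -/
def headRegister : List (Prog Λ) → ℕ
  | atom (.reg _ i) :: _ => i
  | _ => 0

theorem exists_register_bound (p : Prog Λ) : ∃ k, ∀ c ∈ control p, headRegister c < k := by
  have hfin : (control p).Finite := (finite_continuations p []).insert _
  obtain ⟨k, hk⟩ := (hfin.image headRegister).bddAbove
  exact ⟨k + 1, fun c hc => Nat.lt_succ_of_le (hk (Set.mem_image_of_mem _ hc))⟩

/-- The automaton of a program. -/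
noncomputable def automaton (p : Prog Λ) : Automaton Λ where
  P := control p
  finiteP := ((finite_continuations p []).insert _).to_subtype
  start := ⟨[p], .inr (mem_continuations _ _)⟩
  accepting := {c | c.1 = []}
  k := (exists_register_bound p).choose
  edge c o c' := Edge c.1 o c'.1
  lt_of_edge := by
    rintro ⟨c, hc⟩ m i c' h
    have := (exists_register_bound p).choose_spec c hc
    generalize c'.1 = k at h
    cases h
    exact this

/-- The input-output relation of a list of programs. -/
def semList (w : List Λ) : List (Prog Λ) → Store w → Store w → Prop
  | [], s, t => s = t
  | p :: K, s, t => ∃ r, p.sem w s r ∧ semList w K r t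

theorem semList_of_edge {w : List Λ} {k k' : List (Prog Λ)} {s t : Store w} (h : Edge k none k')
    (ht : semList w k' s t) : semList w k s t := by
  cases h with
  | skip => exact ⟨_, rfl, ht⟩
  | seq =>
    obtain ⟨r, h₁, r', h₂, h₃⟩ := ht
    exact ⟨r', ⟨r, h₁, h₂⟩, h₃⟩
  | altLeft =>
    obtain ⟨r, h₁, h₂⟩ := ht
    exact ⟨r, .inl h₁, h₂⟩
  | altRight =>
    obtain ⟨r, h₁, h₂⟩ := ht
    exact ⟨r, .inr h₁, h₂⟩
  | exit => exact ⟨_, ReflTransGen.refl, ht⟩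
  | loop =>
    obtain ⟨r, h₁, r', h₂, h₃⟩ := ht
    exact ⟨r', ReflTransGen.head h₁ h₂, h₃⟩

theorem semList_of_edge_instr {w : List Λ} {k k' : List (Prog Λ)} {s r t : Store w} {a : Instr Λ}
    (h : Edge k (some a) k') (hr : a.sem w s r) (ht : semList w k' r t) : semList w k s t := by
  cases h
  exact ⟨r, hr, ht⟩

theorem semList_of_step {p : Prog Λ} {w : List Λ} {c d : p.automaton.P × Store w}
    (h : p.automaton.Step w c d) {t : Store w} (ht : semList w d.1.1 d.2 t) :
    semList w c.1.1 c.2 t := by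
  cases h with
  | silent h => exact semList_of_edge h ht
  | instr h hs => exact semList_of_edge_instr h hs ht

theorem semList_of_reflTransGen {p : Prog Λ} {w : List Λ} {c c' : p.automaton.P × Store w}
    (h : ReflTransGen (p.automaton.Step w) c c') (hc : c'.1.1 = []) :
    semList w c.1.1 c.2 c'.2 := by
  induction h using ReflTransGen.head_induction_on with
  | refl => rw [hc]; exact rfl
  | head h _ ih => exact semList_of_step h ih

theorem step_of_edge {p : Prog Λ} {w : List Λ} {k k' : List (Prog Λ)} (hk : k ∈ control p)
    (h : Edge k none k') (s : Store w) :
    p.automaton.Step w (⟨k, hk⟩, s) (⟨k', mem_control_of_edge hk h⟩, s) :=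
  .silent (A := p.automaton) (p := ⟨k, hk⟩) (p' := ⟨k', mem_control_of_edge hk h⟩) h

/-- What follows `q` is a parameter of the induction: executing `q` leads from `q :: K` to `K`, and
for a loop this is applied to the body with the loop itself in front of `K`. -/
theorem reflTransGen_of_sem {p q : Prog Λ} {w : List Λ} {s s' : Store w} (h : q.sem w s s')
    {K : List (Prog Λ)} (hq : q :: K ∈ control p) : ∃ hK : K ∈ control p,
      ReflTransGen (p.automaton.Step w) (⟨q :: K, hq⟩, s) (⟨K, hK⟩, s') := by
  induction q generalizing s s' K with
  | skip =>
    cases h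
    exact ⟨mem_control_of_edge hq .skip, .single (step_of_edge hq .skip s)⟩
  | atom a => exact ⟨mem_control_of_edge hq .atom, .single (.instr .atom h)⟩
  | seq q q' ih ih' =>
    obtain ⟨r, h₁, h₂⟩ := h
    obtain ⟨h₃, h₄⟩ := ih h₁ (mem_control_of_edge hq .seq)
    obtain ⟨h₅, h₆⟩ := ih' h₂ h₃
    exact ⟨h₅, .head (step_of_edge hq .seq s) (h₄.trans h₆)⟩
  | alt q q' ih ih' =>
    rcases h with h | h
    · obtain ⟨h₃, h₄⟩ := ih h (mem_control_of_edge hq .altLeft)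
      exact ⟨h₃, .head (step_of_edge hq .altLeft s) h₄⟩
    · obtain ⟨h₃, h₄⟩ := ih' h (mem_control_of_edge hq .altRight)
      exact ⟨h₃, .head (step_of_edge hq .altRight s) h₄⟩
  | star q ih =>
    refine ⟨mem_control_of_edge hq .exit, ?_⟩
    change ReflTransGen _ s s' at h
    induction h using ReflTransGen.head_induction_on with
    | refl => exact .single (step_of_edge hq .exit _)
    | head h _ ih' =>
      obtain ⟨h₃, h₄⟩ := ih h (mem_control_of_edge hq .loop)
      exact .head (step_of_edge hq .loop _) (h₄.trans ih')

theorem exists_sem_iff (p : Prog Λ) {w : List Λ} (s : Store w) : (∃ s', p.sem w s s') ↔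
    ∃ c ∈ p.automaton.accepting, ∃ s',
      ReflTransGen (p.automaton.Step w) (p.automaton.start, s) (c, s') := by
  constructor
  · rintro ⟨s', h⟩
    obtain ⟨h₁, h₂⟩ := reflTransGen_of_sem (p := p) h (.inr (mem_continuations p []))
    exact ⟨⟨[], h₁⟩, rfl, s', h₂⟩
  · rintro ⟨c, hc, s', h⟩
    obtain ⟨r, hr, -⟩ := semList_of_reflTransGen h hc
    exact ⟨r, hr⟩

end Prog

end Noninterference

namespace Noninterference

open Relation

variable {Λ : Type}

/-! ### Digit lists -/

/-- The number with the given digits to the base `16`, the least significant one first. -/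
def digitValue : List (Fin 16) → ℕ
  | [] => 0
  | d :: l => d + 16 * digitValue l

theorem digitValue_lt (l : List (Fin 16)) : digitValue l < 16 ^ l.length := by
  induction l with
  | nil => exact Nat.one_pos
  | cons d l ih =>
    have := d.2
    rw [digitValue, List.length_cons, pow_succ]
    omega

theorem exists_digitValue (n v : ℕ) (h : v < 16 ^ n) :
    ∃ l : List (Fin 16), l.length = n ∧ digitValue l = v := by
  induction n generalizing v with
  | zero => exact ⟨[], rfl, by simp at h; exact h.symm⟩
  | succ n ih =>
    obtain ⟨l, hl, hv⟩ := ih (v / 16) (by rw [pow_succ] at h; omega)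
    refine ⟨⟨v % 16, Nat.mod_lt _ (by norm_num)⟩ :: l, by simp [hl], ?_⟩
    rw [digitValue, hv]
    exact Nat.mod_add_div v 16

theorem digitValue_injective {l l' : List (Fin 16)} (h : l.length = l'.length)
    (hv : digitValue l = digitValue l') : l = l' := by
  induction l generalizing l' with
  | nil => exact (List.length_eq_zero_iff.1 h.symm).symm
  | cons d l ih =>
    obtain _ | ⟨d', l'⟩ := l'
    · simp at h
    · have h₁ := d.2
      have h₂ := d'.2
      rw [digitValue, digitValue] at hv
      rw [ih (by simpa using h) (by omega), Fin.ext (by omega : (d : ℕ) = d')]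

instance : Finite Mode :=
  Finite.of_surjective (fun i : Fin 3 => ![Mode.inc, .dec, .zero] i) fun x => by
    cases x
    exacts [⟨0, rfl⟩, ⟨1, rfl⟩, ⟨2, rfl⟩]

/-- What an operation writes instead of a digit, and whether it goes on to the next digit. The
operation `none` counts in binary, on a list that grows as necessary. -/
def onDigit : Option Mode → Fin 16 → Option (Fin 16 × Bool)
  | none, x => if x = 1 then some (0, true) else some (1, false)
  | some .inc, x => if x = 15 then some (0, true) else some (x + 1, false)
  | some .dec, x => if x = 0 then some (15, true) else some (x - 1, false)
  | some .zero, x => if x = 0 then some (0, true) else none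

/-- What an operation writes behind the last digit, unless it blocks. -/
def onEnd : Option Mode → Option (Option (Fin 16))
  | none => some (some 1)
  | some .inc => none
  | some .dec => none
  | some .zero => some none

/-- The effect of an operation on a list of digits. -/
def runDigits (op : Option Mode) : List (Fin 16) → Option (List (Fin 16))
  | [] => (onEnd op).map Option.toList
  | x :: l =>
    match onDigit op x with
    | none => none
    | some (d, true) => (runDigits op l).map (d :: ·)
    | some (d, false) => some (d :: l)

/-- Lists keep their length, so arithmetic takes place below a power of 16. A carry or borrow past
the last digit blocks, just as the register operation does, and a list of given length is determined
by its value. -/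
theorem runDigits_eq_some_iff (m : Mode) (l l' : List (Fin 16)) :
    runDigits (some m) l = some l' ↔
      l'.length = l.length ∧ m.Rel (digitValue l) (digitValue l') := by
  induction l generalizing l' with
  | nil =>
    cases m <;> cases l' <;> simp [runDigits, onEnd, Mode.Rel, digitValue]
  | cons x l ih =>
    obtain _ | ⟨y, l'⟩ := l'
    · have : runDigits (some m) (x :: l) ≠ some [] := by
        rw [runDigits]
        split <;> simp
      simp [this]
    · have hx := x.2
      have hy := y.2
      have same : l' = l ↔ l'.length = l.length ∧ digitValue l' = digitValue l :=
        ⟨fun h => h ▸ ⟨rfl, rfl⟩, fun h => digitValue_injective h.1 h.2⟩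
      cases m with
      | inc =>
        by_cases h : x = 15
        · subst h
          simp only [runDigits, onDigit, if_true, Option.map_eq_some_iff, List.cons.injEq,
            Mode.Rel, digitValue, List.length_cons] at ih ⊢
          constructor
          · rintro ⟨r, hr, rfl, rfl⟩
            have := (ih _).1 hr
            refine ⟨by omega, ?_⟩
            rw [this.2]; simp; omega
          · rintro ⟨h₁, h₂⟩
            have h15 : ((15 : Fin 16) : ℕ) = 15 := rfl
            exact ⟨l', (ih _).2 ⟨by omega, by omega⟩, Fin.ext (by simp; omega), rfl⟩
        · have hx' : (x : ℕ) ≠ 15 := fun e => h (Fin.ext e)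
          have e : ((x + 1 : Fin 16) : ℕ) = x + 1 := by
            rw [Fin.val_add]; simp; omega
          have hr : runDigits (some .inc) (x :: l) = some ((x + 1) :: l) := by
            simp only [runDigits, onDigit, if_neg h]
          rw [hr, Option.some.injEq, List.cons.injEq, eq_comm (a := l), same, Fin.ext_iff, e]
          simp only [Mode.Rel, digitValue, List.length_cons]
          omega
      | dec =>
        by_cases h : x = 0
        · subst h
          simp only [runDigits, onDigit, if_true, Option.map_eq_some_iff, List.cons.injEq,
            Mode.Rel, digitValue, List.length_cons] at ih ⊢
          have h15 : ((15 : Fin 16) : ℕ) = 15 := rfl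
          have h0 : ((0 : Fin 16) : ℕ) = 0 := rfl
          constructor
          · rintro ⟨r, hr, rfl, rfl⟩
            have := (ih _).1 hr
            omega
          · rintro ⟨h₁, h₂⟩
            exact ⟨l', (ih _).2 ⟨by omega, by omega⟩, Fin.ext (by omega), rfl⟩
        · have hx' : (x : ℕ) ≠ 0 := fun e => h (Fin.ext e)
          have e : ((x - 1 : Fin 16) : ℕ) = x - 1 := by
            rw [Fin.val_sub]; simp; omega
          have hr : runDigits (some .dec) (x :: l) = some ((x - 1) :: l) := by
            simp only [runDigits, onDigit, if_neg h]
          rw [hr, Option.some.injEq, List.cons.injEq, eq_comm (a := l), same, Fin.ext_iff, e]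
          simp only [Mode.Rel, digitValue, List.length_cons]
          omega
      | zero =>
        have h0 : ((0 : Fin 16) : ℕ) = 0 := rfl
        by_cases h : x = 0
        · subst h
          simp only [runDigits, onDigit, if_true, Option.map_eq_some_iff, List.cons.injEq,
            Mode.Rel, digitValue, List.length_cons] at ih ⊢
          constructor
          · rintro ⟨r, hr, rfl, rfl⟩
            have := (ih _).1 hr
            omega
          · rintro ⟨h₁, h₂⟩
            exact ⟨l', (ih _).2 ⟨by omega, by omega⟩, Fin.ext (by omega), rfl⟩
        · have hx' : (x : ℕ) ≠ 0 := fun e => h (Fin.ext e)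
          simp only [runDigits, onDigit, if_neg h, Mode.Rel, digitValue]
          simp [hx']

/-- The binary digits of a number. -/
def binaryDigits (n : ℕ) : List (Fin 16) := n.bits.map fun b => if b then 1 else 0

theorem length_binaryDigits (n : ℕ) : (binaryDigits n).length = Nat.size n := by
  rw [binaryDigits, List.length_map, Nat.size_eq_bits_len]

/-- Binary increment: trailing ones become zeros until a zero, or the end of the list, receives a
one. Growth at the end is allowed here because the length is not yet known. -/
theorem runDigits_binaryDigits (n : ℕ) :
    runDigits none (binaryDigits n) = some (binaryDigits (n + 1)) := by
  induction n using Nat.binaryRec' with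
  | zero => simp [binaryDigits, runDigits, onEnd]
  | bit b n h ih =>
    cases b with
    | false =>
      have e : Nat.bit false n + 1 = Nat.bit true n := by simp [Nat.bit]
      -- Binary digits have no leading zero, so a last bit 0 cannot stand alone.
      have hn : n ≠ 0 := fun e => by simpa using h e
      rw [e, binaryDigits, binaryDigits, Nat.bits_append_bit _ _ h,
        Nat.bits_append_bit _ _ (by simp)]
      simp [runDigits, onDigit]
    | true =>
      have e : Nat.bit true n + 1 = Nat.bit false (n + 1) := by simp [Nat.bit]; ring
      rw [e, binaryDigits, binaryDigits, Nat.bits_append_bit _ _ h,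
        Nat.bits_append_bit _ _ (by simp)]
      simp only [List.map_cons, if_true, runDigits, onDigit]
      change Option.map _ (runDigits none (binaryDigits n)) = _
      rw [ih]
      simp [binaryDigits]

/-! ### Tapes -/

/-- The tape with the given digits in the cells `1, 2, …`. -/
def tapeOf (l : List (Fin 16)) : ℕ → Option (Fin 16)
  | 0 => none
  | n + 1 => l[n]?

/-- Cell 0 always stays blank; this is how a returning head recognises the left end. -/
theorem update_tapeOf_zero (l : List (Fin 16)) : Function.update (tapeOf l) 0 none = tapeOf l :=
  Function.update_eq_self (f := tapeOf l) 0

theorem tapeOf_append (l l' : List (Fin 16)) : tapeOf (l ++ l') (l.length + 1) = l'.head? := by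
  rw [tapeOf, List.getElem?_append_right le_rfl, Nat.sub_self, List.head?_eq_getElem?]

theorem update_tapeOf_append_cons (l l' : List (Fin 16)) (x d : Fin 16) :
    Function.update (tapeOf (l ++ x :: l')) (l.length + 1) (some d) = tapeOf (l ++ d :: l') := by
  funext n
  obtain _ | n := n
  · rfl
  · by_cases h : n = l.length
    · subst h
      simp [tapeOf]
    · rw [Function.update_of_ne (by omega), tapeOf, tapeOf, List.getElem?_append,
        List.getElem?_append]
      split_ifs with h'
      · rfl
      · obtain ⟨k, hk⟩ : ∃ k, n - l.length = k + 1 := ⟨n - l.length - 1, by omega⟩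
        rw [hk, List.getElem?_cons_succ, List.getElem?_cons_succ]

theorem update_tapeOf_length (l : List (Fin 16)) (b : Option (Fin 16)) :
    Function.update (tapeOf l) (l.length + 1) b = tapeOf (l ++ b.toList) := by
  funext n
  obtain _ | n := n
  · rfl
  · by_cases h : n = l.length
    · subst h
      cases b <;> simp [tapeOf]
    · rw [Function.update_of_ne (by omega), tapeOf, tapeOf, List.getElem?_append]
      split_ifs with h'
      · rfl
      · rw [List.getElem?_eq_none (by omega), List.getElem?_eq_none]
        cases b with
        | none => simp
        | some => simp; omega

end Noninterference

namespace Noninterference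

open Relation

variable {Λ : Type}

/-! ### Finite automata as Turing machines -/

namespace Automaton

variable (A : Automaton Λ)

/-- The work tapes: one for every register, and at least one. -/
abbrev Tape : Type := Fin (A.k + 1)

/-- The control states of the Turing machine that simulates `A`. The first component is the state
of `A`, or `none` as long as the machine measures its input. The second component is `none`
between two steps of `A`; otherwise it names the tapes that are in use and the operation that is
performed on them, or `none` while the heads return. -/
abbrev Control : Type := Option A.P × Option (Option (Option Mode) × Set A.Tape)

/-- `A.Act c x g c' d I b m`: the machine may go from the control state `c` to `c'`, with the move
`d` of the input head, if `x` and `g` are scanned; it writes `b` and moves by `m` on the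
tapes in `I`. -/
inductive Act : A.Control → Scan Λ → (A.Tape → Option (Fin 16)) → A.Control → Move → Set A.Tape →
    Option (Fin 16) → Move → Prop
  | load {x g} : x ≠ .rightEnd →
      Act (none, none) x g (none, some (some none, Set.univ)) .right Set.univ none .right
  | ready {g} : Act (none, none) .rightEnd g (some A.start, none) .stay ∅ none .stay
  | silent {p p' x g} : A.edge p none p' →
      Act (some p, none) x g (some p', none) .stay ∅ none .stay
  | left {p p' x g} : A.edge p (some .left) p' → x ≠ .leftEnd →
      Act (some p, none) x g (some p', none) .left ∅ none .stay
  | right {p p' x g} : A.edge p (some .right) p' → x ≠ .rightEnd →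
      Act (some p, none) x g (some p', none) .right ∅ none .stay
  | look {p p' x g} : A.edge p (some (.look x)) p' →
      Act (some p, none) x g (some p', none) .stay ∅ none .stay
  | reg {p p' x g m} {i : A.Tape} : A.edge p (some (.reg m i)) p' →
      Act (some p, none) x g (some p', some (some (some m), {i})) .stay {i} none .right
  | next {q x g op I j y d} : j ∈ I → g j = some y → onDigit op y = some (d, true) →
      Act (q, some (some op, I)) x g (q, some (some op, I)) .stay I (some d) .right
  | last {q x g op I j y d} : j ∈ I → g j = some y → onDigit op y = some (d, false) →
      Act (q, some (some op, I)) x g (q, some (none, I)) .stay I (some d) .left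
  | append {q x g op I j b} : j ∈ I → g j = none → onEnd op = some b →
      Act (q, some (some op, I)) x g (q, some (none, I)) .stay I b .left
  | back {q x g I j d} : j ∈ I → g j = some d →
      Act (q, some (none, I)) x g (q, some (none, I)) .stay I (some d) .left
  | home {q x g I j} : j ∈ I → g j = none →
      Act (q, some (none, I)) x g (q, none) .stay ∅ none .stay

open Classical in
/-- Write `b` and move by `m` on the tapes in `I`. -/
noncomputable def touch (I : Set A.Tape) (b : Option (Fin 16)) (m : Move)
    (g : A.Tape → Option (Fin 16)) (j : A.Tape) : Option (Fin 16) × Move :=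
  if j ∈ I then (b, m) else (g j, .stay)

/-- The Turing machine that simulates `A`. -/
noncomputable def machine : NTM Λ where
  k := A.k + 1
  Q := A.Control
  Γ := Option (Fin 16)
  finiteQ := have := A.finiteP; inferInstance
  finiteΓ := inferInstance
  blank := none
  start := (none, none)
  accepting := {c | ∃ p ∈ A.accepting, c = (some p, none)}
  trans c x g := {y | ∃ I b m, A.Act c x g y.1 y.2.1 I b m ∧ y.2.2 = A.touch I b m g}

variable {A}

open Classical in
/-- The configuration in which the tapes in `I` hold the digits `a` and have their heads at `t`,
and the other tapes hold the digits `l` and have their heads at `0`. -/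
noncomputable def conf (c : A.Control) (h : ℕ) (I : Set A.Tape) (a : List (Fin 16)) (t : ℕ)
    (l : A.Tape → List (Fin 16)) : A.machine.Cfg where
  state := c
  inPos := h
  tape j := if j ∈ I then tapeOf a else tapeOf (l j)
  head j := if j ∈ I then t else 0

open Classical in
/-- The lists `l`, replaced by `a` on the tapes in `I`. -/
noncomputable def patch (I : Set A.Tape) (a : List (Fin 16)) (l : A.Tape → List (Fin 16))
    (j : A.Tape) : List (Fin 16) :=
  if j ∈ I then a else l j

theorem cfg_ext {c c' : A.machine.Cfg} (h₁ : c.state = c'.state) (h₂ : c.inPos = c'.inPos)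
    (h₃ : ∀ j : A.Tape, c.tape j = c'.tape j) (h₄ : ∀ j : A.Tape, c.head j = c'.head j) :
    c = c' := by
  cases c
  cases c'
  obtain rfl := h₁
  obtain rfl := h₂
  obtain rfl := funext h₃
  obtain rfl := funext h₄
  rfl

section

variable {c : A.Control} {h : ℕ} {I : Set A.Tape} {a : List (Fin 16)} {t : ℕ}
  {l : A.Tape → List (Fin 16)} {j : A.Tape}

theorem conf_tape_of_mem (hj : j ∈ I) : (conf c h I a t l).tape j = tapeOf a := if_pos hj

theorem conf_tape_of_notMem (hj : j ∉ I) : (conf c h I a t l).tape j = tapeOf (l j) := if_neg hj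

theorem conf_head_of_mem (hj : j ∈ I) : (conf c h I a t l).head j = t := if_pos hj

theorem conf_head_of_notMem (hj : j ∉ I) : (conf c h I a t l).head j = 0 := if_neg hj

theorem conf_head_zero : (conf c h I a 0 l).head j = 0 := ite_self _

theorem conf_head_le : (conf c h I a t l).head j ≤ t := by
  by_cases hj : j ∈ I
  · exact (conf_head_of_mem hj).le
  · exact (conf_head_of_notMem hj).trans_le (Nat.zero_le _)

/-- With all heads at 0 it no longer matters which tapes were in use. This passes between the two
views at the beginning and the end of an operation. -/
theorem conf_zero : conf c h I a 0 l = conf c h ∅ [] 0 (patch I a l) := by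
  refine cfg_ext rfl rfl (fun j => ?_) fun j => conf_head_zero.trans conf_head_zero.symm
  rw [conf_tape_of_notMem (Set.notMem_empty j), patch]
  split_ifs with hj
  · exact conf_tape_of_mem hj
  · exact conf_tape_of_notMem hj

end

theorem patch_self (i : A.Tape) (l : A.Tape → List (Fin 16)) : patch {i} (l i) l = l := by
  funext j
  unfold patch
  split_ifs with h
  · rw [Set.mem_singleton_iff.1 h]
  · rfl

theorem patch_univ (a : List (Fin 16)) (l : A.Tape → List (Fin 16)) :
    patch Set.univ a l = fun _ => a := by
  funext j
  exact if_pos (Set.mem_univ j)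

/-- The symbols that are scanned on the work tapes. -/
def reads (c : A.machine.Cfg) (j : A.Tape) : Option (Fin 16) := c.tape j (c.head j)

theorem reads_conf {c : A.Control} {h : ℕ} {I : Set A.Tape} {a : List (Fin 16)} {t : ℕ}
    {l : A.Tape → List (Fin 16)} {j : A.Tape} (hj : j ∈ I) :
    reads (conf c h I a t l) j = tapeOf a t := by
  rw [reads, conf_tape_of_mem hj, conf_head_of_mem hj]

/-- The configuration after a step that performs the given actions. -/
noncomputable def nextCfg (w : List Λ) (c : A.machine.Cfg) (q : A.Control) (d : Move)
    (I : Set A.Tape) (b : Option (Fin 16)) (m : Move) : A.machine.Cfg where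
  state := q
  inPos := min (NTM.moveHead d c.inPos) (w.length + 1)
  tape j := Function.update (c.tape j) (c.head j) (A.touch I b m (reads c) j).1
  head j := NTM.moveHead (A.touch I b m (reads c) j).2 (c.head j)

theorem step_iff {w : List Λ} {c c' : A.machine.Cfg} : A.machine.Step w c c' ↔
    ∃ q d I b m, A.Act c.state (NTM.scan w c.inPos) (reads c) q d I b m ∧
      c' = nextCfg w c q d I b m := by
  constructor
  · rintro ⟨q, d, act, ⟨I, b, m, h, rfl⟩, rfl⟩
    exact ⟨q, d, I, b, m, h, rfl⟩
  · rintro ⟨q, d, I, b, m, h, rfl⟩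
    exact ⟨q, d, _, ⟨I, b, m, h, rfl⟩, rfl⟩

section

variable {w : List Λ} {C : A.machine.Cfg} {q : A.Control} {d m : Move} {I : Set A.Tape}
  {b : Option (Fin 16)} {j : A.Tape}

theorem nextCfg_tape_of_mem (hj : j ∈ I) :
    (nextCfg w C q d I b m).tape j = Function.update (C.tape j) (C.head j) b := by
  have : (A.touch I b m (reads C) j).1 = b := by rw [touch, if_pos hj]
  exact congrArg (Function.update (C.tape j) (C.head j)) this

theorem nextCfg_tape_of_notMem (hj : j ∉ I) : (nextCfg w C q d I b m).tape j = C.tape j := by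
  have : (A.touch I b m (reads C) j).1 = C.tape j (C.head j) := by rw [touch, if_neg hj, reads]
  exact (congrArg (Function.update (C.tape j) (C.head j)) this).trans
    (Function.update_eq_self _ _)

theorem nextCfg_head_of_mem (hj : j ∈ I) :
    (nextCfg w C q d I b m).head j = NTM.moveHead m (C.head j) := by
  have : (A.touch I b m (reads C) j).2 = m := by rw [touch, if_pos hj]
  exact congrArg (NTM.moveHead · (C.head j)) this

theorem nextCfg_head_of_notMem (hj : j ∉ I) : (nextCfg w C q d I b m).head j = C.head j := by
  have : (A.touch I b m (reads C) j).2 = .stay := by rw [touch, if_neg hj]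
  exact congrArg (NTM.moveHead · (C.head j)) this

end

/-- The tapes in use have equal contents and head positions, so one update describes the action on
all of them. -/
theorem nextCfg_conf {w : List Λ} {c q : A.Control} {h : ℕ} {I : Set A.Tape}
    {a a' : List (Fin 16)} {t : ℕ} {l : A.Tape → List (Fin 16)} {d m : Move} {b : Option (Fin 16)}
    (ha : Function.update (tapeOf a) t b = tapeOf a') :
    nextCfg w (conf c h I a t l) q d I b m =
      conf q (min (NTM.moveHead d h) (w.length + 1)) I a' (NTM.moveHead m t) l := by
  refine cfg_ext rfl rfl (fun j => ?_) fun j => ?_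
  · by_cases hj : j ∈ I
    · rw [nextCfg_tape_of_mem hj, conf_tape_of_mem hj, conf_tape_of_mem hj, conf_head_of_mem hj]
      exact ha
    · rw [nextCfg_tape_of_notMem hj, conf_tape_of_notMem hj, conf_tape_of_notMem hj]
  · by_cases hj : j ∈ I
    · rw [nextCfg_head_of_mem hj, conf_head_of_mem hj, conf_head_of_mem hj]
    · rw [nextCfg_head_of_notMem hj, conf_head_of_notMem hj, conf_head_of_notMem hj]

theorem nextCfg_idle {w : List Λ} {c q : A.Control} {h : ℕ} {I : Set A.Tape} {a : List (Fin 16)}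
    {t : ℕ} {l : A.Tape → List (Fin 16)} {d m : Move} {b : Option (Fin 16)} :
    nextCfg w (conf c h I a t l) q d ∅ b m =
      conf q (min (NTM.moveHead d h) (w.length + 1)) I a t l :=
  cfg_ext rfl rfl (fun _ => nextCfg_tape_of_notMem (Set.notMem_empty _)) fun _ =>
    nextCfg_head_of_notMem (Set.notMem_empty _)

/-! ### Soundness of the simulation -/

/-- The store at the beginning of a simulation on the input `w`. -/
def initStore (w : List Λ) : Store w where
  reg _ := ⟨digitValue (binaryDigits (w.length + 1)), by
    have := digitValue_lt (binaryDigits (w.length + 1))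
    rwa [length_binaryDigits] at this⟩
  head := w.length + 1

/-- The store `s` is represented by the position `h` of the input head and the tapes `l`. -/
structure Represents {w : List Λ} (h : ℕ) (l : A.Tape → List (Fin 16)) (s : Store w) : Prop where
  head : s.head = h
  length : ∀ j, (l j).length = Nat.size (w.length + 1)
  val : ∀ j : A.Tape, s.val j = digitValue (l j)

/-- The position `h` of the input head and the tapes `l` may occur between two steps of `A`. -/
def Good (w : List Λ) (h : ℕ) (l : A.Tape → List (Fin 16)) : Option A.P → Prop
  | none => l = fun _ => binaryDigits h
  | some p => ∃ s : Store w, ReflTransGen (A.Step w) (A.start, initStore w) (p, s) ∧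
      Represents h l s

/-- The invariant of the simulation. -/
inductive Inv (w : List Λ) : A.machine.Cfg → Prop
  | main {q h l} : h ≤ w.length + 1 → Good w h l q → Inv w (conf (q, none) h ∅ [] 0 l)
  | up {q h op I pre rest l} : h ≤ w.length + 1 →
      pre.length + rest.length ≤ Nat.size (w.length + 1) →
      (∀ r, runDigits op rest = some r → Good w h (patch I (pre ++ r) l) q) →
      Inv w (conf (q, some (some op, I)) h I (pre ++ rest) (pre.length + 1) l)
  | back {q h I t a l} : h ≤ w.length + 1 → t ≤ a.length →
      a.length ≤ Nat.size (w.length + 1) → Good w h (patch I a l) q →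
      Inv w (conf (q, some (none, I)) h I a t l)

theorem Good.length_le {w : List Λ} {h : ℕ} (hh : h ≤ w.length + 1) {l : A.Tape → List (Fin 16)}
    {q : Option A.P} (hg : Good w h l q) (j : A.Tape) :
    (l j).length ≤ Nat.size (w.length + 1) := by
  cases q with
  | none =>
    obtain rfl := hg
    rw [length_binaryDigits]
    exact Nat.size_le_size hh
  | some p =>
    obtain ⟨s, -, h₂⟩ := hg
    exact (h₂.length j).le

theorem Inv.head_le {w : List Λ} {c : A.machine.Cfg} (h : Inv w c) (j : A.Tape) :
    c.head j ≤ Nat.size (w.length + 1) + 1 := by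
  cases h with
  | main => exact conf_head_zero.trans_le (Nat.zero_le _)
  | up => exact conf_head_le.trans (by omega)
  | back => exact conf_head_le.trans (by omega)

theorem initCfg_eq : A.machine.initCfg = conf (none, none) 0 ∅ [] 0 fun _ => binaryDigits 0 := by
  refine cfg_ext rfl rfl (fun j => ?_) fun j => conf_head_zero.symm
  rw [conf_tape_of_notMem (Set.notMem_empty j)]
  funext n
  cases n <;> simp [tapeOf, binaryDigits, NTM.initCfg, machine]

theorem inv_initCfg (w : List Λ) : Inv w A.machine.initCfg := by
  rw [initCfg_eq]
  exact .main (Nat.zero_le _) rfl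

theorem Inv.of_conf_zero {w : List Λ} {q : Option A.P} {h : ℕ} {I : Set A.Tape}
    {a : List (Fin 16)} {l : A.Tape → List (Fin 16)} (hh : h ≤ w.length + 1)
    (hg : Good w h (patch I a l) q) : Inv w (conf (q, none) h I a 0 l) := by
  rw [conf_zero]
  exact .main hh hg

theorem Represents.exists_of_rel {w : List Λ} {h : ℕ} {l : A.Tape → List (Fin 16)} {s : Store w}
    (hs : Represents h l s) {m : Mode} {i : A.Tape} {r : List (Fin 16)}
    (hr : runDigits (some m) (l i) = some r) :
    ∃ s', Instr.sem w (.reg m i) s s' ∧ Represents h (patch {i} r l) s' := by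
  obtain ⟨h₁, h₂⟩ := (runDigits_eq_some_iff m _ _).1 hr
  have h₃ := digitValue_lt r
  rw [h₁, hs.length] at h₃
  rw [← hs.val] at h₂
  obtain ⟨s', ⟨h₄, h₅, h₆⟩, h₇⟩ := Prog.exists_reg s m i h₃ h₂
  refine ⟨s', ⟨h₄, h₅, h₆⟩, h₆.trans hs.head, fun j => ?_, fun j => ?_⟩
  · unfold patch
    split_ifs
    · rw [h₁, hs.length]
    · exact hs.length j
  · unfold patch
    split_ifs with hj
    · rw [Set.mem_singleton_iff.1 hj, h₇]
    · rw [h₅ j fun e => hj (Fin.ext e), hs.val]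

theorem Good.silent {w : List Λ} {h h' : ℕ} {l : A.Tape → List (Fin 16)} {p p' : A.P}
    (hg : Good w h l (some p)) (hp : ∀ s : Store w, s.head = h → ∃ s' : Store w,
      A.Step w (p, s) (p', s') ∧ s'.reg = s.reg ∧ s'.head = h') : Good w h' l (some p') := by
  obtain ⟨s, h₁, h₂⟩ := hg
  obtain ⟨s', h₃, h₄, h₅⟩ := hp s h₂.head
  refine ⟨s', h₁.tail h₃, h₅, h₂.length, fun j => ?_⟩
  rw [Store.val, h₄]
  exact h₂.val j

theorem Inv.of_idle {w : List Λ} {c : A.Control} {q : Option A.P} {h : ℕ}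
    {l : A.Tape → List (Fin 16)} {d m : Move} {b : Option (Fin 16)}
    (hg : Good w (min (NTM.moveHead d h) (w.length + 1)) l q) :
    Inv w (nextCfg w (conf c h ∅ [] 0 l) (q, none) d ∅ b m) := by
  rw [nextCfg_idle]
  exact .main (min_le_right _ _) hg

/-- The counter that measured the input is reread to the base 16. Its value is irrelevant; what
counts is that every tape now has `Nat.size (w.length + 1)` digits. -/
theorem represents_initStore (w : List Λ) :
    Represents (A := A) (w.length + 1) (fun _ => binaryDigits (w.length + 1)) (initStore w) :=
  ⟨rfl, fun _ => length_binaryDigits _, fun _ => rfl⟩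

theorem inv_step_main {w : List Λ} {q : Option A.P} {h : ℕ} {l : A.Tape → List (Fin 16)}
    (hh : h ≤ w.length + 1) (hg : Good w h l q) {g : A.Tape → Option (Fin 16)} {q' : A.Control}
    {d m : Move} {I : Set A.Tape} {b : Option (Fin 16)}
    (hact : A.Act (q, none) (NTM.scan w h) g q' d I b m) :
    Inv w (nextCfg w (conf (q, none) h ∅ [] 0 l) q' d I b m) := by
  generalize hx : NTM.scan w h = x at hact
  cases hact with
  | load hx' =>
    have hlt : h < w.length + 1 := by
      by_contra hcon
      exact hx' (hx ▸ Checkable.scan_eq_rightEnd_iff.2 (not_lt.1 hcon))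
    obtain rfl : l = fun _ => binaryDigits h := hg
    rw [← patch_univ (A := A) (binaryDigits h) fun _ => [], ← conf_zero,
      nextCfg_conf (update_tapeOf_zero _), NTM.moveHead, min_eq_left (by omega)]
    refine .up (pre := []) (rest := binaryDigits h) (by omega) ?_ fun r hr => ?_
    · rw [length_binaryDigits]
      simpa using Nat.size_le_size (by omega)
    · rw [runDigits_binaryDigits] at hr
      obtain rfl := Option.some.inj hr
      exact patch_univ _ _
  | ready =>
    obtain rfl : h = w.length + 1 := le_antisymm hh (Checkable.scan_eq_rightEnd_iff.1 hx)
    obtain rfl : l = fun _ => binaryDigits (w.length + 1) := hg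
    refine .of_idle ?_
    rw [NTM.moveHead, min_self]
    exact ⟨_, .refl, represents_initStore w⟩
  | silent e =>
    refine .of_idle (hg.silent fun s hs => ⟨s, .silent e, rfl, ?_⟩)
    rw [NTM.moveHead, min_eq_left hh, hs]
  | left e hx' =>
    have h0 : h ≠ 0 := fun h0 => hx' (hx ▸ Checkable.scan_eq_leftEnd_iff.2 h0)
    refine .of_idle (hg.silent fun s hs => ⟨⟨s.reg, h - 1⟩, .instr e ⟨?_, rfl⟩, rfl, ?_⟩)
    · rw [hs]
      exact (Nat.sub_add_cancel (Nat.pos_of_ne_zero h0)).symm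
    · rw [NTM.moveHead, min_eq_left (by omega)]
  | right e hx' =>
    have hlt : h < w.length + 1 := by
      by_contra hcon
      exact hx' (hx ▸ Checkable.scan_eq_rightEnd_iff.2 (not_lt.1 hcon))
    refine .of_idle (hg.silent fun s hs => ⟨⟨s.reg, h + 1⟩, .instr e ⟨?_, ?_, rfl⟩, rfl, ?_⟩)
    · omega
    · rw [hs]
    · rw [NTM.moveHead, min_eq_left (by omega)]
  | look e =>
    refine .of_idle (hg.silent fun s hs => ⟨s, .instr e ⟨?_, rfl⟩, rfl, ?_⟩)
    · rw [hs, hx]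
    · rw [NTM.moveHead, min_eq_left hh, hs]
  | @reg p p' _ _ m i e =>
    have hlen := hg.length_le hh i
    obtain ⟨s, h₁, h₂⟩ := hg
    rw [← patch_self i l, ← conf_zero, nextCfg_conf (update_tapeOf_zero _), NTM.moveHead,
      min_eq_left hh]
    refine .up (pre := []) hh (by simpa using hlen) fun r hr => ?_
    obtain ⟨s', h₃, h₄⟩ := h₂.exists_of_rel hr
    exact ⟨s', h₁.tail (.instr e h₃), h₄⟩

/-- While an operation is under way, the invariant carries a promise: whatever result the remaining
digits give, it will represent a legitimate state of the automaton. Each step consumes a digit and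
passes the promise on; a blocked operation has nothing to fulfil. -/
theorem inv_step {w : List Λ} {c c' : A.machine.Cfg} (hc : Inv w c)
    (hs : A.machine.Step w c c') : Inv w c' := by
  obtain ⟨q', d, J, b, m, hact, rfl⟩ := step_iff.1 hs
  clear hs
  cases hc with
  | @main q h l hh hg => exact inv_step_main hh hg hact
  | @up q h op I pre rest l hh hlen hg =>
    have hmin : min (NTM.moveHead .stay h) (w.length + 1) = h := min_eq_left hh
    change A.Act (q, some (some op, I)) (NTM.scan w h) _ q' d J b m at hact
    cases hact with
    | @next _ _ _ _ _ j y d hj hy hd =>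
      rw [reads_conf hj, tapeOf_append] at hy
      obtain ⟨rest, rfl⟩ : ∃ r, rest = y :: r := List.head?_eq_some_iff.1 hy
      rw [nextCfg_conf (update_tapeOf_append_cons _ _ _ d), hmin]
      rw [List.length_cons] at hlen
      have := Inv.up (w := w) (q := q) (op := op) (I := J) (pre := pre ++ [d]) (rest := rest)
        (l := l) hh (by simp; omega) fun r hr => by
          rw [List.append_assoc]
          refine hg _ ?_
          simp [runDigits, hd, hr]
      simpa [NTM.moveHead] using this
    | @last _ _ _ _ _ j y d hj hy hd =>
      rw [reads_conf hj, tapeOf_append] at hy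
      obtain ⟨rest, rfl⟩ : ∃ r, rest = y :: r := List.head?_eq_some_iff.1 hy
      rw [nextCfg_conf (update_tapeOf_append_cons _ _ _ d), hmin]
      rw [List.length_cons] at hlen
      refine .back hh (by simp [NTM.moveHead]) (by simp; omega) (hg _ ?_)
      simp [runDigits, hd]
    | @append _ _ _ _ _ j b hj hy hb =>
      rw [reads_conf hj, tapeOf_append] at hy
      obtain rfl := List.head?_eq_none_iff.1 hy
      rw [List.append_nil, nextCfg_conf (update_tapeOf_length _ b), hmin]
      -- The list may have grown, so its length is bounded through the finished result: the binary
      -- digits of a head position, or a register of fixed length.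
      have hg' := hg b.toList (by simp [runDigits, hb])
      have hlen' := hg'.length_le hh j
      rw [patch, if_pos hj] at hlen'
      exact .back hh (by simp [NTM.moveHead]) hlen' hg'
  | @back q h I t a l hh ht ha hg =>
    have hmin : min (NTM.moveHead .stay h) (w.length + 1) = h := min_eq_left hh
    change A.Act (q, some (none, I)) (NTM.scan w h) _ q' d J b m at hact
    cases hact with
    | @back _ _ _ _ j d hj hd =>
      rw [reads_conf hj] at hd
      have e : Function.update (tapeOf a) t (some d) = tapeOf a := by
        rw [← hd]
        exact Function.update_eq_self _ _
      rw [nextCfg_conf e, hmin]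
      exact .back hh ((Nat.sub_le _ _).trans ht) ha hg
    | @home _ _ _ _ j hj hd =>
      rw [reads_conf hj] at hd
      rw [nextCfg_idle, hmin]
      obtain _ | t := t
      · exact .of_conf_zero hh hg
      · rw [tapeOf, List.getElem?_eq_none_iff] at hd
        omega

theorem inv_of_reaches {w : List Λ} {c : A.machine.Cfg} (h : A.machine.Reaches w c) : Inv w c := by
  induction h with
  | refl => exact inv_initCfg w
  | tail _ h ih => exact inv_step ih h

theorem logSpace_machine (A : Automaton Λ) : A.machine.LogSpace := by
  -- Heads stay within `Nat.size (w.length + 1) + 1`, which is at most `Nat.log 2 w.length + 3`.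
  refine ⟨3, fun w c h i => ((inv_of_reaches h).head_le i).trans ?_⟩
  have h₁ : Nat.size (w.length + 1) ≤ Nat.log 2 w.length + 2 := by
    rw [Nat.size_le, pow_succ]
    have := Nat.lt_pow_succ_log_self (b := 2) (by norm_num) w.length
    rw [Nat.succ_eq_add_one] at this
    omega
  omega

/-! ### Completeness of the simulation -/

theorem step_of_act {w : List Λ} {c q : A.Control} {h : ℕ} {I J : Set A.Tape}
    {a : List (Fin 16)} {t : ℕ} {l : A.Tape → List (Fin 16)} {d m : Move} {b : Option (Fin 16)}
    (hact : A.Act c (NTM.scan w h) (reads (conf c h I a t l)) q d J b m) :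
    A.machine.Step w (conf c h I a t l) (nextCfg w (conf c h I a t l) q d J b m) :=
  step_iff.2 ⟨_, _, _, _, _, hact, rfl⟩

section

variable {w : List Λ} {q : Option A.P} {h : ℕ} {I : Set A.Tape} {a : List (Fin 16)} {t : ℕ}
  {l : A.Tape → List (Fin 16)}

theorem reaches_home (hI : I.Nonempty) (hh : h ≤ w.length + 1) (ht : t ≤ a.length) :
    ReflTransGen (A.machine.Step w) (conf (q, some (none, I)) h I a t l)
      (conf (q, none) h ∅ [] 0 (patch I a l)) := by
  obtain ⟨j, hj⟩ := hI
  have hmin : min (NTM.moveHead .stay h) (w.length + 1) = h := min_eq_left hh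
  induction t with
  | zero =>
    have := step_of_act (w := w) (c := (q, some (none, I))) (h := h) (a := a) (t := 0) (l := l)
      (.home hj (reads_conf hj))
    rw [nextCfg_idle, hmin] at this
    rw [← conf_zero]
    exact .single this
  | succ t ih =>
    have e : tapeOf a (t + 1) = some a[t] := List.getElem?_eq_getElem _
    have := step_of_act (w := w) (c := (q, some (none, I))) (h := h) (a := a) (t := t + 1) (l := l)
      (.back hj ((reads_conf hj).trans e))
    rw [← e, nextCfg_conf (Function.update_eq_self _ _), hmin] at this
    exact .head this (ih (by omega))

theorem reaches_of_runDigits (hI : I.Nonempty) (hh : h ≤ w.length + 1) {op : Option Mode}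
    {rest r : List (Fin 16)} (hr : runDigits op rest = some r) (pre : List (Fin 16)) :
    ReflTransGen (A.machine.Step w)
      (conf (q, some (some op, I)) h I (pre ++ rest) (pre.length + 1) l)
      (conf (q, none) h ∅ [] 0 (patch I (pre ++ r) l)) := by
  obtain ⟨j, hj⟩ := id hI
  have hmin : min (NTM.moveHead .stay h) (w.length + 1) = h := min_eq_left hh
  induction rest generalizing pre r with
  | nil =>
    rw [runDigits, Option.map_eq_some_iff] at hr
    obtain ⟨b, hb, rfl⟩ := hr
    have := step_of_act (w := w) (c := (q, some (some op, I))) (h := h) (a := pre ++ [])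
      (t := pre.length + 1) (l := l) (.append hj ((reads_conf hj).trans (tapeOf_append _ _)) hb)
    rw [List.append_nil, nextCfg_conf (update_tapeOf_length _ b), hmin] at this
    rw [List.append_nil]
    exact .head this (reaches_home hI hh (by simp [NTM.moveHead]))
  | cons y rest ih =>
    have e : reads (conf (A := A) (q, some (some op, I)) h I (pre ++ y :: rest) (pre.length + 1) l)
      j = some y := (reads_conf hj).trans (tapeOf_append _ _)
    rw [runDigits] at hr
    split at hr
    · cases hr
    · rename_i d hd
      obtain ⟨r', hr', rfl⟩ := Option.map_eq_some_iff.1 hr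
      have := step_of_act (w := w) (.next hj e hd)
      rw [nextCfg_conf (update_tapeOf_append_cons _ _ _ d), hmin] at this
      have ih := ih hr' (pre ++ [d])
      simp only [List.append_assoc, List.singleton_append, List.length_append,
        List.length_singleton] at ih
      exact .head this ih
    · rename_i d hd
      cases hr
      have := step_of_act (w := w) (.last hj e hd)
      rw [nextCfg_conf (update_tapeOf_append_cons _ _ _ d), hmin] at this
      exact .head this (reaches_home hI hh (by simp [NTM.moveHead]))

end

/-- In the measuring phase every tape holds the head position in binary, and each move to the right
is accompanied by an increment on all tapes at once. -/
theorem reaches_main (w : List Λ) {h : ℕ} (hh : h ≤ w.length + 1) : A.machine.Reaches w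
    (conf (none, none) h ∅ [] 0 fun _ => binaryDigits h) := by
  induction h with
  | zero => rw [NTM.Reaches, initCfg_eq]
  | succ h ih =>
    refine (ih (by omega)).trans ?_
    have hx : NTM.scan w h ≠ .rightEnd := fun hx => by
      have := Checkable.scan_eq_rightEnd_iff.1 hx
      omega
    rw [← patch_univ (A := A) (binaryDigits h) fun _ => [], ← conf_zero]
    have := step_of_act (A := A) (w := w) (c := (none, none)) (h := h) (I := Set.univ)
      (a := binaryDigits h) (t := 0) (l := fun _ => []) (.load hx)
    rw [nextCfg_conf (update_tapeOf_zero _), NTM.moveHead, min_eq_left hh] at this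
    refine .head this ?_
    rw [← patch_univ (A := A) (binaryDigits (h + 1)) fun _ => []]
    exact reaches_of_runDigits Set.univ_nonempty hh (runDigits_binaryDigits h) []

theorem reaches_start (w : List Λ) : A.machine.Reaches w
    (conf (some A.start, none) (w.length + 1) ∅ [] 0 fun _ => binaryDigits (w.length + 1)) := by
  refine (reaches_main w le_rfl).tail ?_
  have hx : NTM.scan w (w.length + 1) = .rightEnd := Checkable.scan_eq_rightEnd_iff.2 le_rfl
  have := step_of_act (A := A) (w := w) (c := (none, none)) (h := w.length + 1) (I := ∅)
      (a := []) (t := 0) (l := fun _ => binaryDigits (w.length + 1)) (by rw [hx]; exact .ready)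
  rwa [nextCfg_idle, NTM.moveHead, min_self] at this

theorem reaches_of_step {w : List Λ} {p p' : A.P} {s s' : Store w}
    (hs : A.Step w (p, s) (p', s')) (hh : s.head ≤ w.length + 1) {l : A.Tape → List (Fin 16)}
    (hl : Represents s.head l s) : s'.head ≤ w.length + 1 ∧ ∃ l', Represents s'.head l' s' ∧
      ReflTransGen (A.machine.Step w) (conf (some p, none) s.head ∅ [] 0 l)
        (conf (some p', none) s'.head ∅ [] 0 l') := by
  have idle : ∀ d, s'.head = NTM.moveHead d s.head → s'.reg = s.reg → s'.head ≤ w.length + 1 →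
      (∀ g, A.Act (some p, none) (NTM.scan w s.head) g (some p', none) d ∅ none .stay) →
      s'.head ≤ w.length + 1 ∧ ∃ l', Represents s'.head l' s' ∧
        ReflTransGen (A.machine.Step w) (conf (some p, none) s.head ∅ [] 0 l)
          (conf (some p', none) s'.head ∅ [] 0 l') := by
    intro d h₁ h₂ h₃ h₄
    refine ⟨h₃, l, ⟨rfl, hl.length, fun j => ?_⟩, .single ?_⟩
    · rw [Store.val, h₂]
      exact hl.val j
    · have := step_of_act (A := A) (w := w) (I := ∅) (a := []) (t := 0) (l := l) (h₄ _)
      rwa [nextCfg_idle, ← h₁, min_eq_left h₃] at this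
  cases hs with
  | silent e => exact idle .stay rfl rfl hh fun _ => .silent e
  | @instr _ _ _ _ a e hs =>
    cases a with
    | left =>
      obtain ⟨h₁, h₂⟩ := hs
      refine idle .left (by rw [NTM.moveHead]; omega) h₂ (by omega) fun _ => .left e fun hx => ?_
      have := Checkable.scan_eq_leftEnd_iff.1 hx
      omega
    | right =>
      obtain ⟨h₁, h₂, h₃⟩ := hs
      refine idle .right h₂ h₃ (by omega) fun _ => .right e fun hx => ?_
      have := Checkable.scan_eq_rightEnd_iff.1 hx
      omega
    | look c =>
      obtain ⟨rfl, rfl⟩ := hs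
      exact idle .stay rfl rfl hh fun _ => .look e
    | reg m i =>
      obtain ⟨h₁, h₂, h₃⟩ := hs
      obtain ⟨i, rfl⟩ : ∃ j : A.Tape, i = j :=
        ⟨⟨i, (A.lt_of_edge _ _ _ _ e).trans (Nat.lt_succ_self _)⟩, rfl⟩
      -- The new digits are dictated by the value of the register after the instruction; that they
      -- are what the digit operation computes follows from `runDigits_eq_some_iff`.
      obtain ⟨r, hr₁, hr₂⟩ := exists_digitValue _ _ (s'.val_lt i)
      have hr : runDigits (some m) (l i) = some r := by
        rw [runDigits_eq_some_iff, hr₂, ← hl.val, hl.length]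
        exact ⟨hr₁, h₁⟩
      refine ⟨h₃ ▸ hh, patch {i} r l, ⟨rfl, fun j => ?_, fun j => ?_⟩, ?_⟩
      · unfold patch
        split_ifs
        exacts [hr₁, hl.length j]
      · unfold patch
        split_ifs with hj
        · rw [Set.mem_singleton_iff.1 hj, hr₂]
        · rw [h₂ j fun e => hj (Fin.ext e), hl.val]
      · have := step_of_act (A := A) (w := w) (h := s.head) (I := {i}) (a := l i) (t := 0) (l := l)
          (.reg e)
        rw [nextCfg_conf (update_tapeOf_zero _), NTM.moveHead, NTM.moveHead, min_eq_left hh,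
          conf_zero, patch_self] at this
        rw [h₃]
        exact .head this (reaches_of_runDigits (Set.singleton_nonempty i) hh hr [])

theorem reaches_of_reflTransGen {w : List Λ} {c : A.P × Store w}
    (h : ReflTransGen (A.Step w) (A.start, initStore w) c) : c.2.head ≤ w.length + 1 ∧
      ∃ l, Represents c.2.head l c.2 ∧
        A.machine.Reaches w (conf (some c.1, none) c.2.head ∅ [] 0 l) := by
  induction h with
  | refl => exact ⟨le_rfl, _, represents_initStore w, reaches_start w⟩
  | tail _ h ih =>
    obtain ⟨h₁, l, h₂, h₃⟩ := ih
    obtain ⟨h₄, l', h₅, h₆⟩ := reaches_of_step h h₁ h₂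
    exact ⟨h₄, l', h₅, h₃.trans h₆⟩

theorem accepts_machine_iff (A : Automaton Λ) (w : List Λ) : A.machine.Accepts w ↔
    ∃ p ∈ A.accepting, ∃ s, ReflTransGen (A.Step w) (A.start, initStore w) (p, s) := by
  constructor
  · rintro ⟨c, h, p, hp, hc⟩
    cases inv_of_reaches h with
    | @main q _ _ _ hg =>
      obtain rfl : q = some p := congrArg Prod.fst hc
      obtain ⟨s, hs, -⟩ := hg
      exact ⟨p, hp, s, hs⟩
    -- An accepting control state is never in the middle of an operation.
    | up => cases congrArg Prod.snd hc
    | back => cases congrArg Prod.snd hc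
  · rintro ⟨p, hp, s, h⟩
    obtain ⟨-, l, -, h⟩ := reaches_of_reflTransGen h
    exact ⟨_, h, p, hp, rfl⟩

end Automaton

/-- Checkable properties of words are decidable in nondeterministic logarithmic space. -/
theorem Checkable.inNL [Finite Λ] {L : Language Λ}
    (h : Checkable fun w (_ : Empty → ℕ) => w ∈ L) : InNL L := by
  -- There are no variables, so no register holds an argument and the initial contents of the
  -- registers are immaterial.
  obtain ⟨p, hp⟩ := h Empty.elim 0 fun v => v.elim
  refine ⟨p.automaton.machine, p.automaton.logSpace_machine, fun w => ?_⟩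
  rw [Automaton.accepts_machine_iff, ← Prog.exists_sem_iff]
  exact ⟨hp.complete w _, fun ⟨s, hs⟩ => hp.sound w _ s hs⟩

end Noninterference

/-! ### The characterisation and membership in NL -/

theorem corollary9 :
    (∀ (S A D O : Type*) [Finite S] [Finite A] [Finite D]
        (M : Noninterference.System S A D O) (pol : D → D → Prop) (_ : ∀ u, pol u u),
      M.IPSecure pol ↔
        ∃ R : S → D → D → Setoid S, M.OC R ∧ M.SC (fun _ => pol) R ∧ M.LR (fun _ => pol) R) ∧
    Noninterference.InNL Noninterference.ipSecurityProblem := by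
  refine ⟨fun S A D O _ _ _ M pol hrefl => ?_, ?_⟩
  · exact (Noninterference.System.ipSecure_iff_locallySecure hrefl).trans
      Noninterference.System.locallySecure_iff_exists_unwinding
  · exact Noninterference.Checkable.inNL Noninterference.definable_ipSecurityProblem.pos
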